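/- Let $A$ be a finite dimensional connected algebra over a field $K$, and let $D=\operatorname{Hom}_K(-,K)$. Modules are finite dimensional right $A$-modules unless stated otherwise. We use the following notions. - The dominant dimension $\operatorname{domdim}(M)\in\{0,1,2,\dots,\infty\}$ of a (left or right) module $M$ with minimal injective resolution $0\to M\to I_0\to I_1\to\cdots$ is the supremum of all $n$ such that $I_0,\dots,I_{n-1}$ are projective. The codominant dimension of $M$ is the dominant dimension of the left module $D(M)$. The finitistic dominant dimension is $\operatorname{fdomdim}(A)=\sup\{\operatorname{domdim}(M)\mid \operatorname{domdim}(M)<\infty\}$. - $A$ is gendo-symmetric if $\operatorname{domdim}(A_A)\ge 2$ and there is an idempotent $e\in A$ such that $eA$ is a minimal faithful projective-injective right module (minimal faithful: faithful, and a direct summand of every faithful module) and $eA\cong D(Ae)$ as $(eAe,A)$-bimodules. - A module $M$ is Gorenstein projective if $\operatorname{Ext}^i(M,A)=0=\operatorname{Ext}^i(\operatorname{Tr}M,A)$ for all $i\ge 1$, where $\operatorname{Tr}M$ is the transpose; it is Gorenstein injective if the left module $D(M)$ is Gorenstein projective; it is Gorenstein projective-injective if it is both. - $A$ is nearly Gorenstein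 if the Gorenstein projective modules are exactly the modules $M$ with $\operatorname{Ext}^i(M,A)=0$ for all $i\ge1$, and the Gorenstein injective modules are exactly the modules $M$ with $\operatorname{Ext}^i(D(A),M)=0$ for all $i\ge1$. - $A$ is CM-finite if there are only finitely many indecomposable Gorenstein projective modules up to isomorphism; $A$ is Gorenstein of Gorenstein dimension $g\in\mathbb{N}$ if the left and the right injective dimension of $A$ are both equal to $g$. - $\nu^{-1}(M)=\operatorname{Hom}_A(D(M),A)$ is the inverse Nakayama functor. Assume that $A$ is not selfinjective, is gendo-symmetric, and is nearly Gorenstein. 1. For an indecomposable module $M$ that is neither injective nor projective, the following are equivalent: (i) $M$ has infinite dominant dimension; (ii) $M$ is Gorenstein projective-injective and $\nu^{-1}(M)\cong M$; (iii) $M$ is Gorenstein projective-injective; (iv) $M$ has infinite codominant dimension. 2. If, moreover, $A$ is CM-finite and Gorenstein of Gorenstein dimension $g$, then every noninjective module has finite dominant dimension, and $\operatorname{fdomdim}(A)\le g+1$. -/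

import Mathlib

open CategoryTheory MulOpposite

universe u

noncomputable section

namespace GendoSymm

/-! Throughout, a right module over a ring `A` is a module over `Aᵐᵒᵖ`. -/

section Dimensions

variable (R : Type u) [Ring R]

/-- A submodule `N` of `X` is essential if it meets every nonzero submodule nontrivially. -/
def IsEssential {R : Type u} [Ring R] {X : Type u} [AddCommGroup X] [Module R X]
    (N : Submodule R X) : Prop :=
  ∀ S : Submodule R X, S ⊓ N = ⊥ → S = ⊥

/-- A minimal injective resolution `0 → M → I 0 → I 1 → ⋯` by finitely generated modules: an
exact sequence in which every `I n` is an injective envelope of the image of the incoming map. -/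
structure MinimalInjectiveResolution (M : Type u) [AddCommGroup M] [Module R M] where
  I : ℕ → ModuleCat.{u} R
  finite : ∀ n, Module.Finite R (I n)
  injective : ∀ n, Module.Injective R (I n)
  ι : M →ₗ[R] I 0
  d : ∀ n, I n →ₗ[R] I (n + 1)
  ι_injective : Function.Injective ι
  exact_zero : Function.Exact ι (d 0)
  exact_succ : ∀ n, Function.Exact (d n) (d (n + 1))
  ι_essential : IsEssential (LinearMap.range ι)
  d_essential : ∀ n, IsEssential (LinearMap.range (d n))

/-- The dominant dimension of `M`: the supremum of all `n` such that the first `n` terms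
`I 0, …, I (n - 1)` of a minimal injective resolution of `M` are projective. -/
def domDim (M : Type u) [AddCommGroup M] [Module R M] : ℕ∞ :=
  ⨆ n ∈ {n : ℕ | ∃ J : MinimalInjectiveResolution R M,
    ∀ i < n, Module.Projective R (J.I i)}, (n : ℕ∞)

/-- The finitistic dominant dimension: the supremum of the dominant dimensions of those finitely
generated modules whose dominant dimension is finite. -/
def finitisticDomDim : ℕ∞ :=
  sSup {d : ℕ∞ | ∃ M : ModuleCat.{u} R, Module.Finite R M ∧ domDim R M = d ∧ d < ⊤}

/-- `Ext^i(M, N) = 0` for all `i ≥ 1`. -/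
def ExtVanishes (M N : Type u) [AddCommGroup M] [Module R M] [AddCommGroup N] [Module R N] :
    Prop :=
  ∀ i : ℕ, 1 ≤ i → Subsingleton (Abelian.Ext (ModuleCat.of R M) (ModuleCat.of R N) i)

end Dimensions

section GorensteinProjective

variable (R S : Type u) [Ring R] [Ring S]
  (A : Type u) [AddCommGroup A] [Module R A] [Module S A] [SMulCommClass R S A]

/-- The cokernel of `Hom_R(f, A) : Hom_R(P₀, A) → Hom_R(P₁, A)`, for `f : P₁ → P₀`, as an
`S`-module. If `P₁ → P₀ → M → 0` is a presentation of `M` by finitely generated projectives and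
`A` is the regular bimodule, this is the transpose `Tr M` (up to projective summands). -/
abbrev Transpose {P₁ P₀ : Type u} [AddCommGroup P₁] [Module R P₁] [AddCommGroup P₀] [Module R P₀]
    (f : P₁ →ₗ[R] P₀) : Type u :=
  (P₁ →ₗ[R] A) ⧸ LinearMap.range (LinearMap.lcomp S A f)

/-- `Ext^i(M, A) = 0 = Ext^i(Tr M, A)` for all `i ≥ 1`, where `M` is an `R`-module and `Tr M` is an
`S`-module. It is used only when `A` is a ring and `(R, S)` is `(A, Aᵐᵒᵖ)` or `(Aᵐᵒᵖ, A)`. The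
transpose is computed from a presentation by finitely generated projectives; another
presentation changes it by projective summands only, which do not affect the condition. -/
def GorensteinProjectiveAux (M : Type u) [AddCommGroup M] [Module R M] : Prop :=
  ExtVanishes R M A ∧
    ∃ (P₁ P₀ : ModuleCat.{u} R) (f : P₁ →ₗ[R] P₀) (p : P₀ →ₗ[R] M),
      Module.Finite R P₁ ∧ Module.Projective R P₁ ∧
      Module.Finite R P₀ ∧ Module.Projective R P₀ ∧
      Function.Exact f p ∧ Function.Surjective p ∧
      ExtVanishes S (Transpose R S A f) A

end GorensteinProjective

/-- The underlying space of `D(M) = Hom_K(M, K)`. -/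
def KDual (K M : Type u) [Field K] [AddCommGroup M] [Module K M] : Type u :=
  M →ₗ[K] K

section KDual

variable {K : Type u} [Field K] {M : Type u} [AddCommGroup M] [Module K M]

instance : AddCommGroup (KDual K M) := inferInstanceAs (AddCommGroup (M →ₗ[K] K))

/-- An element of `D(M)` as a linear form. -/
def KDual.toForm (f : KDual K M) : M →ₗ[K] K := f

variable {A : Type u} [Ring A] [Algebra K A]

/-- The dual of a left module is a right module, `(f · a)(m) = f (a m)`. -/
instance KDual.moduleOfLeft [Module A M] [IsScalarTower K A M] : Module Aᵐᵒᵖ (KDual K M) where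
  smul c f := f.toForm ∘ₗ Algebra.lsmul K K M (unop c)
  one_smul f := LinearMap.ext fun m => congrArg f.toForm (one_smul A m)
  mul_smul c c' f := LinearMap.ext fun m =>
    congrArg f.toForm (mul_smul (unop c') (unop c) m)
  smul_zero _ := LinearMap.ext fun _ => rfl
  smul_add _ _ _ := LinearMap.ext fun _ => rfl
  add_smul c c' f := LinearMap.ext fun m =>
    (congrArg f.toForm (add_smul (unop c) (unop c') m)).trans (map_add f.toForm _ _)
  zero_smul f := LinearMap.ext fun m =>
    (congrArg f.toForm (zero_smul A m)).trans (map_zero f.toForm)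

/-- The dual of a right module is a left module, `(a · f)(m) = f (m a)`. -/
instance KDual.moduleOfRight [Module Aᵐᵒᵖ M] [IsScalarTower K Aᵐᵒᵖ M] : Module A (KDual K M) where
  smul a f := f.toForm ∘ₗ Algebra.lsmul K K M (op a)
  one_smul f := LinearMap.ext fun m => congrArg f.toForm (one_smul Aᵐᵒᵖ m)
  mul_smul a a' f := LinearMap.ext fun m =>
    congrArg f.toForm (mul_smul (op a') (op a) m)
  smul_zero _ := LinearMap.ext fun _ => rfl
  smul_add _ _ _ := LinearMap.ext fun _ => rfl
  add_smul a a' f := LinearMap.ext fun m =>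
    (congrArg f.toForm (add_smul (op a) (op a') m)).trans (map_add f.toForm _ _)
  zero_smul f := LinearMap.ext fun m =>
    (congrArg f.toForm (zero_smul Aᵐᵒᵖ m)).trans (map_zero f.toForm)

theorem KDual.op_smul_apply [Module A M] [IsScalarTower K A M] (a : A) (f : KDual K M) (m : M) :
    (op a • f).toForm m = f.toForm (a • m) := rfl

theorem KDual.smul_apply [Module Aᵐᵒᵖ M] [IsScalarTower K Aᵐᵒᵖ M] (a : A) (f : KDual K M) (m : M) :
    (a • f).toForm m = f.toForm (op a • m) := rfl

end KDual

section RightModules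

variable (K A : Type u) [Field K] [Ring A] [Algebra K A]
  (M : Type u) [AddCommGroup M] [Module K M] [Module Aᵐᵒᵖ M] [IsScalarTower K Aᵐᵒᵖ M]

/-- The codominant dimension of the right module `M`: the dominant dimension of the left module
`D(M)`. -/
def codomDim : ℕ∞ := domDim A (KDual K M)

/-- The inverse Nakayama functor on a right module `M`: the right module `Hom_A(D(M), A)`. -/
abbrev NakayamaInv : Type u := KDual K M →ₗ[A] A

/-- Gorenstein projective right modules. -/
def IsGorensteinProjective (A : Type u) [Ring A] (M : Type u) [AddCommGroup M] [Module Aᵐᵒᵖ M] :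
    Prop :=
  GorensteinProjectiveAux Aᵐᵒᵖ A A M

/-- The right module `M` is Gorenstein injective if the left module `D(M)` is Gorenstein
projective. -/
def IsGorensteinInjective : Prop := GorensteinProjectiveAux A Aᵐᵒᵖ A (KDual K M)

/-- Gorenstein projective-injective right modules. -/
def IsGorensteinProjectiveInjective : Prop :=
  IsGorensteinProjective A M ∧ IsGorensteinInjective K A M

end RightModules

section Algebras

variable (K A : Type u) [Field K] [Ring A] [Algebra K A]

/-- `A` is connected (indecomposable as an algebra): it is nonzero, and `0` and `1` are its only
central idempotents. -/
def IsConnectedAlgebra (A : Type u) [Ring A] : Prop :=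
  Nontrivial A ∧ ∀ e : A, IsIdempotentElem e → (∀ a : A, e * a = a * e) → e = 0 ∨ e = 1

/-- The right ideal `eA`. -/
def rightIdeal {A : Type u} [Ring A] (e : A) : Submodule Aᵐᵒᵖ A where
  carrier := {x | ∃ a, e * a = x}
  add_mem' := by
    rintro _ _ ⟨a, rfl⟩ ⟨b, rfl⟩
    exact ⟨a + b, mul_add e a b⟩
  zero_mem' := ⟨0, mul_zero e⟩
  smul_mem' := by
    rintro c _ ⟨a, rfl⟩
    exact ⟨a * unop c, (mul_assoc e a (unop c)).symm⟩

/-- The left ideal `Ae`. -/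
def leftIdeal {A : Type u} [Ring A] (e : A) : Submodule A A where
  carrier := {x | ∃ a, a * e = x}
  add_mem' := by
    rintro _ _ ⟨a, rfl⟩ ⟨b, rfl⟩
    exact ⟨a + b, add_mul a b e⟩
  zero_mem' := ⟨0, zero_mul e⟩
  smul_mem' := by
    rintro c _ ⟨a, rfl⟩
    exact ⟨c * a, mul_assoc c a e⟩

/-- Left multiplication by `ebe` on `eA`. -/
def cornerMul {A : Type u} [Ring A] (e b : A) (x : rightIdeal e) : rightIdeal e :=
  ⟨e * b * e * x, b * e * x, by simp only [mul_assoc]⟩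

/-- Right multiplication by `ebe` on `Ae`. -/
def mulCorner {A : Type u} [Ring A] (e b : A) (y : leftIdeal e) : leftIdeal e :=
  ⟨y * (e * b * e), y * (e * b), by simp only [mul_assoc]⟩

/-- `N` is a minimal faithful right module: it is faithful, and a direct summand of every
finitely generated faithful right module. -/
def IsMinimalFaithful (A : Type u) [Ring A] (N : Type u) [AddCommGroup N] [Module Aᵐᵒᵖ N] : Prop :=
  FaithfulSMul Aᵐᵒᵖ N ∧
    ∀ X : ModuleCat.{u} Aᵐᵒᵖ, Module.Finite Aᵐᵒᵖ X → FaithfulSMul Aᵐᵒᵖ X →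
      ∃ (i : N →ₗ[Aᵐᵒᵖ] X) (r : X →ₗ[Aᵐᵒᵖ] N), r ∘ₗ i = LinearMap.id

/-- `A` is gendo-symmetric: it has dominant dimension at least two, and there is an idempotent `e`
such that `eA` is a minimal faithful projective-injective right module and `eA ≅ D(Ae)` as
`(eAe, A)`-bimodules. -/
def IsGendoSymmetric : Prop :=
  2 ≤ domDim Aᵐᵒᵖ A ∧
    ∃ e : A, IsIdempotentElem e ∧
      IsMinimalFaithful A (rightIdeal e) ∧
      Module.Projective Aᵐᵒᵖ (rightIdeal e) ∧ Module.Injective Aᵐᵒᵖ (rightIdeal e) ∧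
      ∃ φ : rightIdeal e ≃ₗ[Aᵐᵒᵖ] KDual K (leftIdeal e),
        ∀ (b : A) (x : rightIdeal e) (y : leftIdeal e),
          (φ (cornerMul e b x)).toForm y = (φ x).toForm (mulCorner e b y)

/-- `A` is nearly Gorenstein: for finite dimensional right modules `M`, being Gorenstein
injective means `Ext^i(D(A), M) = 0` for all `i ≥ 1`, and being Gorenstein projective means
`Ext^i(M, A) = 0` for all `i ≥ 1`. -/
def IsNearlyGorenstein : Prop :=
  ∀ (M : Type u) [AddCommGroup M] [Module K M] [Module Aᵐᵒᵖ M] [IsScalarTower K Aᵐᵒᵖ M]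
    [FiniteDimensional K M],
    (IsGorensteinInjective K A M ↔ ExtVanishes Aᵐᵒᵖ (KDual K A) M) ∧
    (IsGorensteinProjective A M ↔ ExtVanishes Aᵐᵒᵖ M A)

/-- `A` is CM-finite: up to isomorphism there are only finitely many indecomposable finitely
generated Gorenstein projective right modules. -/
def IsCMFinite (A : Type u) [Ring A] : Prop :=
  ∃ (n : ℕ) (G : Fin n → ModuleCat.{u} Aᵐᵒᵖ),
    ∀ M : ModuleCat.{u} Aᵐᵒᵖ, Module.Finite Aᵐᵒᵖ M → Indecomposable M →
      IsGorensteinProjective A M → ∃ i, Nonempty (M ≅ G i)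

/-- `A` is Gorenstein of Gorenstein dimension `g`: the injective dimensions of the right and of
the left regular module are both equal to `g`. -/
def IsGorensteinOfDim (A : Type u) [Ring A] (g : ℕ) : Prop :=
  injectiveDimension (ModuleCat.of Aᵐᵒᵖ A) = g ∧ injectiveDimension (ModuleCat.of A A) = g

end Algebras

end GendoSymm

end

/-!
Write `D(A)` for the dual of the regular left module and `θ : D(A) → A` for the bimodule map given
by the trace form on `eAe`. The map `η_M : M → Hom(D(A), M)`, `m ↦ (f ↦ θ(f) m)`, is bijective
exactly when `domdim M ≥ 2`; shifting dimensions, `domdim M = ∞` exactly when moreover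
`Ext^i(D(A), M) = 0` for all `i ≥ 1`. Over a nearly Gorenstein algebra this vanishing says that
`M` is Gorenstein injective, whence `Ext^i(ν⁻¹(M), A) = 0` for `i ≥ 1`. Dualizing `η_M` turns its
bijectivity into `ν⁻¹(M) ≅ M`, so that `M` is Gorenstein projective as well. Conversely, a
Gorenstein projective module is the kernel of a map of projective modules, so its `η` is
bijective. The left modules `D(M)` are treated in the same way. If `A` has left injective
dimension at most `g`, then `Ext^i(D(A), M) ≅ Ext^i(D(M), A)` vanishes for `i > g` anyway, which
bounds the finitistic dominant dimension.

The modules of infinite dominant dimension form an extension closed class in which projective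
modules are injective, and which is contravariantly finite if `A` is CM-finite. By Wakamatsu's
lemma the kernel `Z` of a minimal approximation satisfies `Ext¹(V, Z) = 0` for all `V` in the
class, and the trace form turns this into a factorization of every map `Z → V` through some
`(eA)ⁿ`. It follows that a simple module is in the class or has no extensions with its members, in
either direction. A noninjective member would be nonprojective and thus give a nonprojective
simple member, and connectedness would put `A` itself into the class, making it injective.
-/

noncomputable section

namespace GendoSymm

/-! ### Short exact sequences and pushouts -/

section ShortExact

variable {R : Type*} [Ring R] {X Y Z T : Type*} [AddCommGroup X] [Module R X] [AddCommGroup Y]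
  [Module R Y] [AddCommGroup Z] [Module R Z] [AddCommGroup T] [Module R T]

theorem exists_desc_of_exact {f : X →ₗ[R] Y} {g : Y →ₗ[R] Z} (hfg : Function.Exact f g)
    (hg : Function.Surjective g) (a : Y →ₗ[R] T) (ha : a ∘ₗ f = 0) :
    ∃ b : Z →ₗ[R] T, b ∘ₗ g = a := by
  let s := hfg.linearEquivOfSurjective hg
  refine ⟨(LinearMap.range f).liftQ a (LinearMap.range_le_ker_iff.2 ha) ∘ₗ s.symm.toLinearMap,
    LinearMap.ext fun y => ?_⟩
  have hs : s.symm (g y) = (LinearMap.range f).mkQ y := by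
    rw [LinearEquiv.symm_apply_eq]
    rfl
  simp only [LinearMap.comp_apply, LinearEquiv.coe_coe, hs, Submodule.mkQ_apply,
    Submodule.liftQ_apply]

/-- A short exact sequence `0 → X → Y → Z → 0`, given by linear maps so that it can be formed
without bundling the modules. -/
structure IsShortExact (f : X →ₗ[R] Y) (g : Y →ₗ[R] Z) : Prop where
  inj : Function.Injective f
  exact : Function.Exact f g
  surj : Function.Surjective g

namespace IsShortExact

theorem ker_subtype (g : Y →ₗ[R] Z) (hg : Function.Surjective g) :
    IsShortExact (LinearMap.ker g).subtype g :=
  ⟨Subtype.val_injective, LinearMap.exact_subtype_ker_map g, hg⟩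

theorem subtype_mkQ (S : Submodule R Y) : IsShortExact S.subtype S.mkQ :=
  ⟨Subtype.val_injective, LinearMap.exact_subtype_mkQ S, S.mkQ_surjective⟩

theorem mkQ_range (f : X →ₗ[R] Y) (hf : Function.Injective f) :
    IsShortExact f (LinearMap.range f).mkQ :=
  ⟨hf, LinearMap.exact_map_mkQ_range f, Submodule.mkQ_surjective _⟩

theorem inl_snd : IsShortExact (LinearMap.inl R X Y) (LinearMap.snd R X Y) :=
  ⟨LinearMap.inl_injective, LinearMap.exact_iff.2 (LinearMap.range_inl R X Y).symm,
    LinearMap.snd_surjective⟩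

variable {f : X →ₗ[R] Y} {g : Y →ₗ[R] Z}

theorem exists_desc (h : IsShortExact f g) (a : Y →ₗ[R] T) (ha : a ∘ₗ f = 0) :
    ∃ b : Z →ₗ[R] T, b ∘ₗ g = a :=
  exists_desc_of_exact h.exact h.surj a ha

theorem exists_codesc (h : IsShortExact f g) (a : T →ₗ[R] Y) (ha : g ∘ₗ a = 0) :
    ∃ b : T →ₗ[R] X, f ∘ₗ b = a := by
  let s := LinearEquiv.ofInjective f h.inj
  refine ⟨s.symm.toLinearMap ∘ₗ LinearMap.codRestrict (LinearMap.range f) a fun t =>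
    (h.exact _).1 (LinearMap.congr_fun ha t), LinearMap.ext fun t => ?_⟩
  exact congrArg Subtype.val (s.apply_symm_apply _)

end IsShortExact

section Pushout

variable {W P U V : Type*} [AddCommGroup W] [Module R W] [AddCommGroup P] [Module R P]
  [AddCommGroup U] [Module R U] [AddCommGroup V] [Module R V]

/-- The pushout of `U ← W → P` in the category of modules. -/
abbrev Pushout (a : W →ₗ[R] U) (i : W →ₗ[R] P) : Type _ :=
  (U × P) ⧸ LinearMap.range (a.prod (-i))

namespace Pushout

variable (a : W →ₗ[R] U) (i : W →ₗ[R] P)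

/-- The structure map `U → Pushout a i`. -/
def inl : U →ₗ[R] Pushout a i := (LinearMap.range (a.prod (-i))).mkQ ∘ₗ LinearMap.inl R U P

/-- The structure map `P → Pushout a i`. -/
def inr : P →ₗ[R] Pushout a i := (LinearMap.range (a.prod (-i))).mkQ ∘ₗ LinearMap.inr R U P

theorem condition : inl a i ∘ₗ a = inr a i ∘ₗ i :=
  LinearMap.ext fun w => (Submodule.Quotient.eq _).2 ⟨w, by ext <;> simp⟩

variable {a i}

/-- The map out of a pushout induced by a commutative square. -/
def desc (α : U →ₗ[R] T) (β : P →ₗ[R] T) (h : α ∘ₗ a = β ∘ₗ i) : Pushout a i →ₗ[R] T :=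
  (LinearMap.range (a.prod (-i))).liftQ (α.coprod β) <| by
    rintro _ ⟨w, rfl⟩
    have hw : α (a w) = β (i w) := LinearMap.congr_fun h w
    simp [hw]

variable {α : U →ₗ[R] T} {β : P →ₗ[R] T} (h : α ∘ₗ a = β ∘ₗ i)

theorem desc_comp_inl : desc α β h ∘ₗ inl a i = α := by ext; simp [desc, inl]

theorem desc_comp_inr : desc α β h ∘ₗ inr a i = β := by ext; simp [desc, inr]

end Pushout

theorem IsShortExact.pushout {i : W →ₗ[R] P} {q : P →ₗ[R] V} (h : IsShortExact i q)
    (a : W →ₗ[R] U) :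
    IsShortExact (Pushout.inl a i)
      (Pushout.desc (a := a) 0 q (by ext w; simp [h.exact.apply_apply_eq_zero])) where
  inj := by
    refine (injective_iff_map_eq_zero _).2 fun x hx => ?_
    obtain ⟨w, hw⟩ := (Submodule.Quotient.mk_eq_zero _).1 hx
    have hiw : i w = i 0 := by simpa using congrArg Prod.snd hw
    simpa [h.inj hiw, eq_comm] using congrArg Prod.fst hw
  exact z := by
    obtain ⟨⟨x, y⟩, rfl⟩ := Submodule.mkQ_surjective _ z
    constructor
    · intro hz
      obtain ⟨w, rfl⟩ := (h.exact y).1 (by simpa [Pushout.desc] using hz)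
      exact ⟨x + a w, (Submodule.Quotient.eq _).2 ⟨w, by ext <;> simp⟩⟩
    · rintro ⟨x', hx'⟩
      rw [← hx']
      simp [Pushout.desc, Pushout.inl]
  surj v := by
    obtain ⟨y, rfl⟩ := h.surj v
    refine ⟨Pushout.inr a i y, ?_⟩
    simp [Pushout.desc, Pushout.inr]

end Pushout

end ShortExact

/-! ### Endomorphisms of finite length modules -/

section Fitting

variable {R : Type*} [Ring R] {M T : Type*} [AddCommGroup M] [Module R M] [AddCommGroup T]
  [Module R T]

theorem exists_retraction_of_isCompl {p q : Submodule R M} (h : IsCompl p q) :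
    ∃ r : M →ₗ[R] q, r ∘ₗ q.subtype = LinearMap.id :=
  ⟨q.projectionOnto p h.symm, by ext x; simp⟩

theorem comp_pow_eq_of_comp_eq {h : M →ₗ[R] M} {f : M →ₗ[R] T} (hf : f ∘ₗ h = f) (k : ℕ) :
    f ∘ₗ (h ^ k) = f := by
  induction k with
  | zero => rfl
  | succ k ih => rw [pow_succ', Module.End.mul_eq_comp, ← LinearMap.comp_assoc, hf, ih]

-- By Fitting's lemma some power of `h` has a complemented image; minimality makes it all of `N`.
theorem bijective_of_minimal [IsArtinian R M] [IsNoetherian R M] {P : Submodule R M → Prop}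
    {N : Submodule R M} (hmin : ∀ N', P N' → ¬ N' < N) (h : N →ₗ[R] N)
    (hP : ∀ k, IsCompl (LinearMap.ker (h ^ k)) (LinearMap.range (h ^ k)) →
      P ((LinearMap.range (h ^ k)).map N.subtype)) : Function.Bijective h := by
  obtain ⟨k, hk⟩ := Filter.eventually_atTop.1 (LinearMap.eventually_isCompl_ker_pow_range_pow h)
  have hmap : (LinearMap.range (h ^ (k + 1))).map N.subtype = N := by
    by_contra hne
    exact hmin _ (hP _ (hk _ k.le_succ)) (lt_of_le_of_ne (Submodule.map_subtype_le _ _) hne)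
  have htop : LinearMap.range (h ^ (k + 1)) = ⊤ :=
    Submodule.map_injective_of_injective N.injective_subtype <| by
      rw [hmap, Submodule.map_subtype_top]
  have hsurj : Function.Surjective h := fun x => by
    obtain ⟨y, hy⟩ := LinearMap.range_eq_top.1 htop x
    exact ⟨(h ^ k) y, by rw [← hy, pow_succ', Module.End.mul_apply]⟩
  exact IsNoetherian.bijective_of_surjective_endomorphism h hsurj

theorem exists_simple_quotient (R : Type u) [Ring R] (M : Type u) [AddCommGroup M] [Module R M]
    [Module.Finite R M] [Nontrivial M] :
    ∃ (T : ModuleCat.{u} R) (q : M →ₗ[R] T), IsSimpleModule R T ∧ Function.Surjective q := by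
  obtain ⟨m, hm⟩ := IsCoatomic.exists_coatom (Submodule R M)
  exact ⟨ModuleCat.of R (M ⧸ m), m.mkQ, isSimpleModule_iff_isCoatom.2 hm, m.mkQ_surjective⟩

end Fitting

/-! ### Vanishing of `Ext` -/

section ExtVanishing

open Abelian

variable {R : Type u} [Ring R] {X Y Z N : Type u} [AddCommGroup X] [Module R X] [AddCommGroup Y]
  [Module R Y] [AddCommGroup Z] [Module R Z] [AddCommGroup N] [Module R N]

/-- `Ext^i(M, N) = 0` in the single degree `i`. -/
def ExtVanishesAt (R : Type u) [Ring R] (M N : Type u) [AddCommGroup M] [Module R M]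
    [AddCommGroup N] [Module R N] (i : ℕ) : Prop :=
  Subsingleton (Ext (ModuleCat.of R M) (ModuleCat.of R N) i)

namespace ExtVanishesAt

theorem of_forall_eq_zero {i : ℕ}
    (h : ∀ x : Ext (ModuleCat.of R X) (ModuleCat.of R N) i, x = 0) : ExtVanishesAt R X N i :=
  ⟨fun a b => (h a).trans (h b).symm⟩

theorem of_projective [Module.Projective R X] {i : ℕ} (hi : 1 ≤ i) : ExtVanishesAt R X N i := by
  obtain ⟨i, rfl⟩ := Nat.exists_eq_add_of_le' hi
  have : Projective (ModuleCat.of R X) := (IsProjective.iff_projective X).1 inferInstance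
  exact Ext.subsingleton_of_projective _ _ _

theorem of_injective [Module.Injective R N] {i : ℕ} (hi : 1 ≤ i) : ExtVanishesAt R X N i := by
  obtain ⟨i, rfl⟩ := Nat.exists_eq_add_of_le' hi
  have : Injective (ModuleCat.of R N) := (Module.injective_iff_injective_object R N).1 inferInstance
  exact Ext.subsingleton_of_injective _ _ _

theorem of_injectiveDimension_le {g i : ℕ} (h : injectiveDimension (ModuleCat.of R N) ≤ g)
    (hi : g < i) : ExtVanishesAt R X N i := by
  have := (injectiveDimension_le_iff (ModuleCat.of R N) g).1 h
  exact HasInjectiveDimensionLT.subsingleton _ (g + 1) i hi _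

theorem of_retract_left {i : ℕ} (a : X →ₗ[R] Y) (b : Y →ₗ[R] X) (hab : b ∘ₗ a = LinearMap.id)
    (h : ExtVanishesAt R Y N i) : ExtVanishesAt R X N i := by
  refine of_forall_eq_zero fun x => ?_
  have hid : ModuleCat.ofHom a ≫ ModuleCat.ofHom b = 𝟙 _ := by
    rw [← ModuleCat.ofHom_comp, hab]
    rfl
  rw [← Ext.mk₀_id_comp x, ← hid, ← Ext.mk₀_comp_mk₀_assoc,
    h.elim ((Ext.mk₀ (ModuleCat.ofHom b)).comp x (zero_add i)) 0, Ext.comp_zero]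

theorem of_retract_right {i : ℕ} (a : X →ₗ[R] Y) (b : Y →ₗ[R] X) (hab : b ∘ₗ a = LinearMap.id)
    (h : ExtVanishesAt R N Y i) : ExtVanishesAt R N X i := by
  refine of_forall_eq_zero fun x => ?_
  have hid : ModuleCat.ofHom a ≫ ModuleCat.ofHom b = 𝟙 _ := by
    rw [← ModuleCat.ofHom_comp, hab]
    rfl
  rw [← Ext.comp_mk₀_id x, ← hid, ← Ext.mk₀_comp_mk₀, ← Ext.comp_assoc_of_third_deg_zero,
    h.elim (x.comp (Ext.mk₀ (ModuleCat.ofHom a)) (add_zero i)) 0, Ext.zero_comp]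

theorem congr_left (a : X ≃ₗ[R] Y) {i : ℕ} : ExtVanishesAt R X N i ↔ ExtVanishesAt R Y N i :=
  ⟨of_retract_left a.symm.toLinearMap a.toLinearMap (by ext; simp),
    of_retract_left a.toLinearMap a.symm.toLinearMap (by ext; simp)⟩

end ExtVanishesAt

theorem ExtVanishes.congr_left (a : X ≃ₗ[R] Y) (h : ExtVanishes R X N) : ExtVanishes R Y N :=
  fun i hi => (ExtVanishesAt.congr_left a).1 (h i hi)

namespace IsShortExact

variable {f : X →ₗ[R] Y} {g : Y →ₗ[R] Z}

theorem shortExact (h : IsShortExact f g) :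
    (ShortComplex.mk (ModuleCat.ofHom f) (ModuleCat.ofHom g)
      (by ext x; exact h.exact.apply_apply_eq_zero x)).ShortExact where
  exact := (ShortComplex.ShortExact.moduleCat_exact_iff_function_exact _).2 h.exact
  mono_f := (ModuleCat.mono_iff_injective _).2 h.inj
  epi_g := (ModuleCat.epi_iff_surjective _).2 h.surj

theorem exists_extend (h : IsShortExact f g) (hE : ExtVanishesAt R Z N 1) (k : X →ₗ[R] N) :
    ∃ l : Y →ₗ[R] N, l ∘ₗ f = k := by
  obtain ⟨x, hx⟩ := Ext.contravariant_sequence_exact₁ h.shortExact (ModuleCat.of R N)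
    (Ext.mk₀ (ModuleCat.ofHom k)) (n₁ := 1) rfl (hE.elim _ _)
  obtain ⟨l, rfl⟩ := Ext.homEquiv₀.symm.surjective x
  have hl : ModuleCat.ofHom f ≫ l = ModuleCat.ofHom k :=
    Ext.homEquiv₀.symm.injective (by simpa using hx)
  exact ⟨l.hom, by simpa using congrArg ModuleCat.Hom.hom hl⟩

theorem exists_lift (h : IsShortExact f g) (hE : ExtVanishesAt R N X 1) (k : N →ₗ[R] Z) :
    ∃ l : N →ₗ[R] Y, g ∘ₗ l = k := by
  obtain ⟨x, hx⟩ := Ext.covariant_sequence_exact₃ (ModuleCat.of R N) h.shortExact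
    (Ext.mk₀ (ModuleCat.ofHom k)) (n₁ := 1) rfl (hE.elim _ _)
  obtain ⟨l, rfl⟩ := Ext.homEquiv₀.symm.surjective x
  have hl : l ≫ ModuleCat.ofHom g = ModuleCat.ofHom k :=
    Ext.homEquiv₀.symm.injective (by simpa using hx)
  exact ⟨l.hom, by simpa using congrArg ModuleCat.Hom.hom hl⟩

theorem exists_retraction (h : IsShortExact f g) (hE : ExtVanishesAt R Z X 1) :
    ∃ r : Y →ₗ[R] X, r ∘ₗ f = LinearMap.id :=
  h.exists_extend hE _

theorem extVanishesAt_one_of_extend (h : IsShortExact f g) (hY : ExtVanishesAt R Y N 1)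
    (hext : ∀ k : X →ₗ[R] N, ∃ l : Y →ₗ[R] N, l ∘ₗ f = k) : ExtVanishesAt R Z N 1 := by
  refine .of_forall_eq_zero fun x => ?_
  obtain ⟨y, rfl⟩ := Ext.contravariant_sequence_exact₃ h.shortExact (ModuleCat.of R N) x
    (hY.elim _ _) (n₀ := 0) rfl
  obtain ⟨k, rfl⟩ := Ext.homEquiv₀.symm.surjective y
  obtain ⟨l, hl⟩ := hext k.hom
  obtain rfl : k = ModuleCat.ofHom f ≫ ModuleCat.ofHom l := by
    ext x
    exact (LinearMap.congr_fun hl x).symm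
  simp only [Ext.homEquiv₀_symm_apply, ← Ext.mk₀_comp_mk₀]
  exact h.shortExact.extClass_comp_assoc _

theorem extVanishesAt_one_of_lift (h : IsShortExact f g) (hY : ExtVanishesAt R N Y 1)
    (hlift : ∀ k : N →ₗ[R] Z, ∃ l : N →ₗ[R] Y, g ∘ₗ l = k) : ExtVanishesAt R N X 1 := by
  refine .of_forall_eq_zero fun x => ?_
  obtain ⟨y, rfl⟩ := Ext.covariant_sequence_exact₁ (ModuleCat.of R N) h.shortExact x
    (hY.elim _ _) (n₀ := 0) rfl
  obtain ⟨k, rfl⟩ := Ext.homEquiv₀.symm.surjective y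
  obtain ⟨l, hl⟩ := hlift k.hom
  obtain rfl : k = ModuleCat.ofHom l ≫ ModuleCat.ofHom g := by
    ext x
    exact (LinearMap.congr_fun hl x).symm
  simp only [Ext.homEquiv₀_symm_apply, ← Ext.mk₀_comp_mk₀]
  rw [Ext.comp_assoc_of_second_deg_zero, h.shortExact.comp_extClass, Ext.comp_zero]

theorem extVanishesAt_contravariant₁ (h : IsShortExact f g) {i : ℕ}
    (hY : ExtVanishesAt R Y N i) (hZ : ExtVanishesAt R Z N (i + 1)) : ExtVanishesAt R X N i := by
  refine .of_forall_eq_zero fun x => ?_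
  obtain ⟨y, rfl⟩ := Ext.contravariant_sequence_exact₁ h.shortExact (ModuleCat.of R N) x
    (n₁ := i + 1) (add_comm _ _) (hZ.elim _ _)
  rw [hY.elim y 0, Ext.comp_zero]

theorem extVanishesAt_contravariant₃ (h : IsShortExact f g) {i : ℕ} (hX : ExtVanishesAt R X N i)
    (hY : ExtVanishesAt R Y N (i + 1)) : ExtVanishesAt R Z N (i + 1) := by
  refine .of_forall_eq_zero fun x => ?_
  obtain ⟨y, rfl⟩ := Ext.contravariant_sequence_exact₃ h.shortExact (ModuleCat.of R N) x
    (hY.elim _ _) (n₀ := i) (add_comm _ _)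
  rw [hX.elim y 0, Ext.comp_zero]

theorem extVanishesAt_covariant₁ (h : IsShortExact f g) {i : ℕ} (hZ : ExtVanishesAt R N Z i)
    (hY : ExtVanishesAt R N Y (i + 1)) : ExtVanishesAt R N X (i + 1) := by
  refine .of_forall_eq_zero fun x => ?_
  obtain ⟨y, rfl⟩ := Ext.covariant_sequence_exact₁ (ModuleCat.of R N) h.shortExact x
    (hY.elim _ _) (n₀ := i) rfl
  rw [hZ.elim y 0, Ext.zero_comp]

theorem extVanishesAt_covariant₂ (h : IsShortExact f g) {i : ℕ} (hX : ExtVanishesAt R N X i)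
    (hZ : ExtVanishesAt R N Z i) : ExtVanishesAt R N Y i := by
  refine .of_forall_eq_zero fun x => ?_
  obtain ⟨y, rfl⟩ := Ext.covariant_sequence_exact₂ (ModuleCat.of R N) h.shortExact x
    (hZ.elim _ _)
  rw [hX.elim y 0, Ext.zero_comp]

theorem extVanishesAt_covariant₃ (h : IsShortExact f g) {i : ℕ} (hY : ExtVanishesAt R N Y i)
    (hX : ExtVanishesAt R N X (i + 1)) : ExtVanishesAt R N Z i := by
  refine .of_forall_eq_zero fun x => ?_
  obtain ⟨y, rfl⟩ := Ext.covariant_sequence_exact₃ (ModuleCat.of R N) h.shortExact x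
    (n₁ := i + 1) rfl (hX.elim _ _)
  rw [hY.elim y 0, Ext.zero_comp]

end IsShortExact

theorem isShortExact_pi_succ (N : Type*) [AddCommGroup N] [Module R N] (n : ℕ) :
    IsShortExact (LinearMap.single R (fun _ : Fin (n + 1) => N) 0)
      (LinearMap.funLeft R N Fin.succ) where
  inj := Pi.single_injective (M := fun _ : Fin (n + 1) => N) 0
  exact x := by
    constructor
    · intro hx
      refine ⟨x 0, funext fun j => Fin.cases (by simp) (fun k => ?_) j⟩
      simpa using (congrFun hx k).symm
    · rintro ⟨y, rfl⟩
      exact funext fun j => by simp [LinearMap.funLeft_apply]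
  surj := LinearMap.funLeft_surjective_of_injective R N _ (Fin.succ_injective n)

theorem ExtVanishesAt.pi {i : ℕ} (h : ExtVanishesAt R X N i) (n : ℕ) :
    ExtVanishesAt R X (Fin n → N) i := by
  induction n with
  | zero =>
    refine .of_retract_right (0 : (Fin 0 → N) →ₗ[R] N) 0 (Subsingleton.elim _ _) h
  | succ n ih => exact (isShortExact_pi_succ N n).extVanishesAt_covariant₂ h ih

end ExtVanishing

/-! ### Modules over finite dimensional algebras -/

section Injective

variable {R : Type u} [Ring R] {M N : Type u} [AddCommGroup M] [Module R M] [AddCommGroup N]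
  [Module R N] [Module.Injective R N]

theorem injective_of_retract (a : M →ₗ[R] N) (b : N →ₗ[R] M) (hab : b ∘ₗ a = LinearMap.id) :
    Module.Injective R M where
  out X Y _ _ _ _ f hf g := by
    obtain ⟨h, hh⟩ := Module.Injective.out f hf (a ∘ₗ g)
    refine ⟨b ∘ₗ h, fun x => ?_⟩
    rw [LinearMap.comp_apply, hh]
    exact LinearMap.congr_fun hab (g x)

theorem injective_of_linearEquiv (a : M ≃ₗ[R] N) : Module.Injective R M :=
  injective_of_retract a.toLinearMap a.symm.toLinearMap (by ext; simp)

end Injective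

section Algebra

variable (K R : Type u) [Field K] [Ring R] [Algebra K R] (M : Type u) [AddCommGroup M] [Module R M]

/-- The vector space structure of a module over a `K`-algebra, for modules that are not given with
one. -/
abbrev scalarModule : Module K M := Module.compHom M (algebraMap K R)

theorem scalarModule_isScalarTower : letI := scalarModule K R M; IsScalarTower K R M :=
  letI := scalarModule K R M
  ⟨fun c r m => by
    change (c • r) • m = algebraMap K R c • r • m
    rw [Algebra.smul_def, mul_smul]⟩

variable {K R M} in
theorem finiteDimensional_submodule [Module K M] [IsScalarTower K R M] [FiniteDimensional K M]
    (S : Submodule R M) : FiniteDimensional K S :=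
  FiniteDimensional.of_injective (S.subtype.restrictScalars K) Subtype.val_injective

variable {R} in
theorem injective_of_forall_extend {Q : Type u} [AddCommGroup Q] [Module R Q]
    (h : ∀ (X Y : Type u) [AddCommGroup X] [AddCommGroup Y] [Module R X] [Module R Y]
      [Module K X] [Module K Y] [IsScalarTower K R X] [IsScalarTower K R Y] (f : X →ₗ[R] Y),
      Function.Injective f → ∀ g : X →ₗ[R] Q, ∃ h : Y →ₗ[R] Q, ∀ x, h (f x) = g x) :
    Module.Injective R Q where
  out X Y _ _ _ _ f hf g := by
    let := scalarModule K R X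
    let := scalarModule K R Y
    have := scalarModule_isScalarTower K R X
    have := scalarModule_isScalarTower K R Y
    exact h X Y f hf g

end Algebra

section DomDim

variable {R : Type u} [Ring R] {M : Type u} [AddCommGroup M] [Module R M]

theorem exists_resolution_of_le_domDim {n : ℕ} (h : ((n + 1 : ℕ) : ℕ∞) ≤ domDim R M) :
    ∃ J : MinimalInjectiveResolution R M, ∀ i < n + 1, Module.Projective R (J.I i) := by
  have h1 : (n : ℕ∞) < domDim R M := lt_of_lt_of_le (by exact_mod_cast Nat.lt_succ_self n) h
  simp only [domDim, lt_iSup_iff] at h1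
  obtain ⟨m, ⟨J, hJ⟩, hm⟩ := h1
  have hm' : n < m := by exact_mod_cast hm
  exact ⟨J, fun i hi => hJ i (by omega)⟩

theorem le_domDim (J : MinimalInjectiveResolution R M) {n : ℕ}
    (h : ∀ i < n, Module.Projective R (J.I i)) : (n : ℕ∞) ≤ domDim R M :=
  le_iSup₂_of_le (f := fun (n : ℕ) (_ : n ∈ {n : ℕ | ∃ J : MinimalInjectiveResolution R M,
    ∀ i < n, Module.Projective R (J.I i)}) => (n : ℕ∞)) n ⟨J, h⟩ le_rfl

end DomDim

/-! ### The symmetric form on the corner algebra -/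

/-- What is used of a gendo-symmetric algebra: an idempotent `e` of `R` with a form `tr` which is
symmetric on `eRe`, induces a perfect pairing `eR × Re → K`, and for which the balanced bilinear
forms on `eR × Re` are exactly the forms `(x, y) ↦ tr (x r y)`. Elements of `eR` and `Re` are
written `e * x` and `y * e`, so that all fields quantify over `R`. The notion is left-right
symmetric, whereas the definition of gendo-symmetric algebras is one-sided. -/
structure GendoCore (K R : Type u) [Field K] [Ring R] [Algebra K R] where
  e : R
  idem : e * e = e
  tr : R →ₗ[K] K
  tr_comm : ∀ a b, tr (e * a * e * b * e) = tr (e * b * e * a * e)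
  nondeg_left : ∀ x, (∀ y, tr (e * x * y * e) = 0) → e * x = 0
  nondeg_right : ∀ y, (∀ x, tr (e * x * y * e) = 0) → y * e = 0
  rep_left : ∀ μ : R →ₗ[K] K, ∃ x, ∀ y, tr (e * x * y * e) = μ (y * e)
  rep_right : ∀ μ : R →ₗ[K] K, ∃ y, ∀ x, tr (e * x * y * e) = μ (e * x)
  faithful : ∀ r, (∀ x y, tr (e * x * r * y * e) = 0) → r = 0
  balanced : ∀ β : R →ₗ[K] R →ₗ[K] K,
    (∀ b x y, β (e * b * e * x) (y * e) = β (e * x) (y * e * b * e)) →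
      ∃ r, ∀ x y, β (e * x) (y * e) = tr (e * x * r * y * e)

/-- The same data for the opposite algebra. -/
def GendoCore.op {K R : Type u} [Field K] [Ring R] [Algebra K R] (D : GendoCore K R) :
    GendoCore K Rᵐᵒᵖ where
  e := MulOpposite.op D.e
  idem := by rw [← op_mul, D.idem]
  tr := D.tr ∘ₗ (opLinearEquiv K).symm.toLinearMap
  tr_comm a b := by simpa [mul_assoc] using D.tr_comm b.unop a.unop
  nondeg_left x h := unop_injective <| D.nondeg_right x.unop fun y => by
    simpa [mul_assoc] using h (MulOpposite.op y)
  nondeg_right x h := unop_injective <| D.nondeg_left x.unop fun y => by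
    simpa [mul_assoc] using h (MulOpposite.op y)
  rep_left μ := by
    obtain ⟨x, hx⟩ := D.rep_right (μ ∘ₗ (opLinearEquiv K).toLinearMap)
    exact ⟨MulOpposite.op x, fun y => by simpa [mul_assoc] using hx y.unop⟩
  rep_right μ := by
    obtain ⟨x, hx⟩ := D.rep_left (μ ∘ₗ (opLinearEquiv K).toLinearMap)
    exact ⟨MulOpposite.op x, fun y => by simpa [mul_assoc] using hx y.unop⟩
  faithful r h := unop_injective <| D.faithful r.unop fun x y => by
    simpa [mul_assoc] using h (MulOpposite.op y) (MulOpposite.op x)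
  balanced β h := by
    obtain ⟨r, hr⟩ := D.balanced ((β.compl₁₂ (opLinearEquiv K).toLinearMap
      (opLinearEquiv K).toLinearMap).flip) fun b x y => by
        simpa [mul_assoc] using
          (h (MulOpposite.op b) (MulOpposite.op y) (MulOpposite.op x)).symm
    exact ⟨MulOpposite.op r, fun x y => by simpa [mul_assoc] using hr y.unop x.unop⟩

section Corner

variable {K A : Type u} [Field K] [Ring A] {e : A}

theorem mem_rightIdeal_iff (he : e * e = e) {x : A} : x ∈ rightIdeal e ↔ e * x = x :=
  ⟨by rintro ⟨a, rfl⟩; rw [← mul_assoc, he], fun h => ⟨x, h⟩⟩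

theorem mem_leftIdeal_iff (he : e * e = e) {x : A} : x ∈ leftIdeal e ↔ x * e = x :=
  ⟨by rintro ⟨a, rfl⟩; rw [mul_assoc, he], fun h => ⟨x, h⟩⟩

variable [Algebra K A]

instance [FiniteDimensional K A] : FiniteDimensional K (rightIdeal e) :=
  finiteDimensional_submodule _

instance [FiniteDimensional K A] : FiniteDimensional K (leftIdeal e) :=
  finiteDimensional_submodule _

variable (K) in
/-- Right multiplication by `e`, as a map to `Ae`. -/
def mulIdem (e : A) : A →ₗ[K] leftIdeal e where
  toFun a := ⟨a * e, a, rfl⟩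
  map_add' a b := Subtype.ext (add_mul a b e)
  map_smul' c a := Subtype.ext (smul_mul_assoc c a e)

section TraceForm

variable (he : e * e = e) (φ : rightIdeal e ≃ₗ[Aᵐᵒᵖ] KDual K (leftIdeal e))

/-- The form `a ↦ φ(e)(ae)` attached to an isomorphism `φ : eA ≅ D(Ae)`. -/
def traceForm : A →ₗ[K] K := (φ ⟨e, ⟨e, he⟩⟩).toForm ∘ₗ mulIdem K e

theorem apply_eq_traceForm (x : rightIdeal e) (y : leftIdeal e) :
    (φ x).toForm y = traceForm he φ (x * y) := by
  have hx : x = (MulOpposite.op (x : A)) • (⟨e, ⟨e, he⟩⟩ : rightIdeal e) :=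
    Subtype.ext ((mem_rightIdeal_iff he).1 x.2).symm
  conv_lhs => rw [hx, map_smul, KDual.op_smul_apply]
  refine congrArg (φ ⟨e, ⟨e, he⟩⟩).toForm (Subtype.ext ?_)
  change (x : A) * y = x * y * e
  rw [mul_assoc, (mem_leftIdeal_iff he).1 y.2]

theorem traceForm_comm
    (hφ : ∀ (b : A) (x : rightIdeal e) (y : leftIdeal e),
      (φ (cornerMul e b x)).toForm y = (φ x).toForm (mulCorner e b y)) (a b : A) :
    traceForm he φ (e * a * e * b * e) = traceForm he φ (e * b * e * a * e) := by
  have h := hφ b ⟨e, ⟨e, he⟩⟩ ⟨e * a * e, ⟨e * a, rfl⟩⟩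
  rw [apply_eq_traceForm he, apply_eq_traceForm he] at h
  have he' : ∀ z : A, e * (e * z) = e * z := fun z => by rw [← mul_assoc, he]
  simpa only [cornerMul, mulCorner, mul_assoc, he, he'] using h.symm

theorem eq_zero_of_traceForm_left (x : rightIdeal e)
    (h : ∀ y : leftIdeal e, traceForm he φ (x * y) = 0) : x = 0 := by
  refine φ.injective ?_
  rw [map_zero]
  exact LinearMap.ext fun y => (apply_eq_traceForm he φ x y).trans (h y)

theorem eq_zero_of_traceForm_right (y : leftIdeal e)
    (h : ∀ x : rightIdeal e, traceForm he φ (x * y) = 0) : y = 0 := by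
  refine (Module.forall_dual_apply_eq_zero_iff K y).1 fun g => ?_
  obtain ⟨x, rfl⟩ := φ.surjective g
  exact (apply_eq_traceForm he φ x y).trans (h x)

/-- The pairing `eA × Ae → K` given by the product and the form `traceForm`. -/
def tracePairing : rightIdeal e →ₗ[K] leftIdeal e →ₗ[K] K :=
  ((LinearMap.mul K A).compr₂ (traceForm he φ)).compl₁₂
    (LinearMap.restrictScalars K (rightIdeal e).subtype)
    (LinearMap.restrictScalars K (leftIdeal e).subtype)

theorem tracePairing_isPerfPair [FiniteDimensional K A] : (tracePairing he φ).IsPerfPair :=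
  .of_injective
    ((injective_iff_map_eq_zero _).2 fun x hx =>
      eq_zero_of_traceForm_left he φ x fun y => LinearMap.congr_fun hx y)
    ((injective_iff_map_eq_zero _).2 fun x hx =>
      eq_zero_of_traceForm_right he φ x fun y => LinearMap.congr_fun hx y)

end TraceForm

end Corner

/-! ### The double centralizer property -/

section DoubleCentralizer

variable {K A : Type u} [Field K] [Ring A] {e : A}

theorem exists_map_rightIdeal_ne_zero [FaithfulSMul Aᵐᵒᵖ (rightIdeal e)] {P : Type u}
    [AddCommGroup P] [Module Aᵐᵒᵖ P] [Module.Projective Aᵐᵒᵖ P] {p : P} (hp : p ≠ 0) :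
    ∃ ψ : P →ₗ[Aᵐᵒᵖ] rightIdeal e, ψ p ≠ 0 := by
  by_contra! h
  refine hp ((Module.forall_dual_apply_eq_zero_iff Aᵐᵒᵖ p).1 fun g => ?_)
  refine FaithfulSMul.eq_of_smul_eq_smul (α := rightIdeal e) fun x => ?_
  rw [zero_smul]
  exact h ((LinearMap.toSpanSingleton Aᵐᵒᵖ (rightIdeal e) x) ∘ₗ g)

theorem mem_range_of_two_le_domDim (hdom : 2 ≤ domDim Aᵐᵒᵖ A)
    [FaithfulSMul Aᵐᵒᵖ (rightIdeal e)] [Module.Injective Aᵐᵒᵖ (rightIdeal e)] {n : ℕ}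
    {j : A →ₗ[Aᵐᵒᵖ] (Fin n → rightIdeal e)} (hj : Function.Injective j)
    {z : Fin n → rightIdeal e}
    (hz : ∀ ψ : (Fin n → rightIdeal e) →ₗ[Aᵐᵒᵖ] rightIdeal e, ψ ∘ₗ j = 0 → ψ z = 0) :
    z ∈ LinearMap.range j := by
  obtain ⟨J, hJ⟩ := exists_resolution_of_le_domDim (n := 1) (by exact_mod_cast hdom)
  have := J.injective 0
  have := hJ 1 (by norm_num)
  obtain ⟨i, hi⟩ := Module.Injective.out J.ι J.ι_injective j
  obtain ⟨r, hr⟩ := Module.Injective.out j hj J.ι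
  have hdr : J.d 0 (r z) = 0 := by
    by_contra hne
    obtain ⟨ψ, hψ⟩ := exists_map_rightIdeal_ne_zero (e := e) hne
    refine hψ (hz (ψ ∘ₗ J.d 0 ∘ₗ r) (LinearMap.ext fun a => ?_))
    simp [hr, J.exact_zero.apply_apply_eq_zero]
  have hir : z = i (r z) := funext fun s => sub_eq_zero.1 <| by
    refine hz (LinearMap.proj s ∘ₗ (LinearMap.id - i ∘ₗ r)) (LinearMap.ext fun a => ?_)
    simp [hr, hi]
  obtain ⟨a, ha⟩ := (J.exact_zero _).1 hdr
  exact ⟨a, by rw [← hi, ha, ← hir]⟩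

theorem rightIdeal_map_apply (he : e * e = e) (ψ : rightIdeal e →ₗ[Aᵐᵒᵖ] rightIdeal e)
    (x : rightIdeal e) : ψ x = cornerMul e (ψ ⟨e, ⟨e, he⟩⟩) x := by
  have hx : x = (MulOpposite.op (x : A)) • (⟨e, ⟨e, he⟩⟩ : rightIdeal e) :=
    Subtype.ext ((mem_rightIdeal_iff he).1 x.2).symm
  refine Subtype.ext ?_
  change _ = e * _ * e * (x : A)
  rw [(mem_rightIdeal_iff he).1 (Subtype.prop _), mul_assoc, (mem_rightIdeal_iff he).1 x.2]
  conv_lhs => rw [hx, map_smul]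
  rfl

theorem rightIdeal_pi_map_apply (he : e * e = e) {n : ℕ}
    (ψ : (Fin n → rightIdeal e) →ₗ[Aᵐᵒᵖ] rightIdeal e) (z : Fin n → rightIdeal e) :
    ψ z = ∑ s, cornerMul e (ψ (Pi.single s ⟨e, ⟨e, he⟩⟩)) (z s) := by
  conv_lhs => rw [← Finset.univ_sum_single z, map_sum]
  exact Finset.sum_congr rfl fun s _ =>
    rightIdeal_map_apply he (ψ ∘ₗ LinearMap.single Aᵐᵒᵖ (fun _ => rightIdeal e) s) (z s)

/-- The map of right modules `A → Nⁿ`, `a ↦ (v₁ a, …, vₙ a)`. -/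
def orbitMap {N : Type*} [AddCommGroup N] [Module Aᵐᵒᵖ N] {n : ℕ} (v : Fin n → N) :
    A →ₗ[Aᵐᵒᵖ] (Fin n → N) where
  toFun a s := MulOpposite.op a • v s
  map_add' a b := funext fun s => by rw [MulOpposite.op_add, add_smul, Pi.add_apply]
  map_smul' c a := funext fun s => by
    change MulOpposite.op (a * c.unop) • v s = c • MulOpposite.op a • v s
    rw [op_mul, mul_smul, op_unop]

theorem orbitMap_one {N : Type*} [AddCommGroup N] [Module Aᵐᵒᵖ N] {n : ℕ} (v : Fin n → N) :
    orbitMap v (1 : A) = v :=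
  funext fun s => by
    change MulOpposite.op (1 : A) • v s = v s
    rw [op_one, one_smul]

variable [Algebra K A]

theorem smul_eq_cornerMul (he : e * e = e) (c : K) (x : rightIdeal e) :
    c • x = cornerMul e (algebraMap K A c) x := by
  refine Subtype.ext ?_
  change c • (x : A) = e * algebraMap K A c * e * x
  rw [mul_assoc, (mem_rightIdeal_iff he).1 x.2, ← Algebra.commutes, mul_assoc,
    (mem_rightIdeal_iff he).1 x.2, Algebra.smul_def]

theorem apply_eq_op_smul_of_span_eq_top (he : e * e = e) {n : ℕ} {v : Fin n → rightIdeal e}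
    (hv : Submodule.span K (Set.range v) = ⊤) {g : rightIdeal e →+ rightIdeal e}
    (hg : ∀ b x, g (cornerMul e b x) = cornerMul e b (g x)) {a : A}
    (hs : ∀ s, g (v s) = MulOpposite.op a • v s) (x : rightIdeal e) :
    g x = MulOpposite.op a • x := by
  have hx : x ∈ Submodule.span K (Set.range v) := hv ▸ Submodule.mem_top
  induction hx using Submodule.span_induction with
  | mem x hx => obtain ⟨s, rfl⟩ := hx; exact hs s
  | zero => rw [map_zero, smul_zero]
  | add x y _ _ hx hy => rw [map_add, hx, hy, smul_add]
  | smul c x _ hx =>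
    rw [smul_eq_cornerMul he, hg, hx, ← smul_eq_cornerMul he, ← smul_eq_cornerMul he, smul_comm]

theorem orbitMap_injective (he : e * e = e) [FaithfulSMul Aᵐᵒᵖ (rightIdeal e)] {n : ℕ}
    {v : Fin n → rightIdeal e} (hv : Submodule.span K (Set.range v) = ⊤) :
    Function.Injective (orbitMap v : A →ₗ[Aᵐᵒᵖ] _) := by
  refine (injective_iff_map_eq_zero _).2 fun a ha => ?_
  refine op_injective (FaithfulSMul.eq_of_smul_eq_smul (α := rightIdeal e) fun x => ?_)
  rw [← apply_eq_op_smul_of_span_eq_top he hv (g := 0)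
    (fun b x => Subtype.ext (by simp [cornerMul])) (fun s => (congrFun ha s).symm), op_zero,
    zero_smul, AddMonoidHom.zero_apply]

variable [FiniteDimensional K A] (hdom : 2 ≤ domDim Aᵐᵒᵖ A) [FaithfulSMul Aᵐᵒᵖ (rightIdeal e)]
  [Module.Injective Aᵐᵒᵖ (rightIdeal e)]

variable (K) in
include K hdom in
theorem exists_eq_op_smul_of_commute (he : e * e = e) (h : rightIdeal e →+ rightIdeal e)
    (hh : ∀ b x, h (cornerMul e b x) = cornerMul e b (h x)) :
    ∃ a : A, ∀ x, h x = MulOpposite.op a • x := by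
  obtain ⟨n, v, hv⟩ := Module.Finite.exists_fin (R := K) (M := rightIdeal e)
  have hmem : (fun s => h (v s)) ∈ LinearMap.range (orbitMap v : A →ₗ[Aᵐᵒᵖ] _) := by
    refine mem_range_of_two_le_domDim hdom (orbitMap_injective he hv) fun ψ hψ => ?_
    have hψv : ψ v = 0 := by
      rw [← orbitMap_one (A := A) v]
      exact LinearMap.congr_fun hψ 1
    calc ψ (fun s => h (v s)) = h (ψ v) := by
          rw [rightIdeal_pi_map_apply he ψ, rightIdeal_pi_map_apply he ψ v, map_sum]
          exact Finset.sum_congr rfl fun s _ => (hh _ _).symm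
      _ = 0 := by rw [hψv, map_zero]
  obtain ⟨a, ha⟩ := hmem
  exact ⟨a, apply_eq_op_smul_of_span_eq_top he hv hh fun s => (congrFun ha s).symm⟩

include hdom in
theorem exists_traceForm_of_balanced (he : e * e = e)
    (φ : rightIdeal e ≃ₗ[Aᵐᵒᵖ] KDual K (leftIdeal e))
    (hφ : ∀ (b : A) (x : rightIdeal e) (y : leftIdeal e),
      (φ (cornerMul e b x)).toForm y = (φ x).toForm (mulCorner e b y))
    (β : A →ₗ[K] A →ₗ[K] K)
    (hβ : ∀ b x y, β (e * b * e * x) (y * e) = β (e * x) (y * e * b * e)) :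
    ∃ r, ∀ x y, β (e * x) (y * e) = traceForm he φ (e * x * r * y * e) := by
  let g : rightIdeal e →+ KDual K (leftIdeal e) :=
    { toFun x := (β x) ∘ₗ LinearMap.restrictScalars K (leftIdeal e).subtype
      map_zero' := LinearMap.ext fun y => by simp; rfl
      map_add' x x' := LinearMap.ext fun y => by simp; rfl }
  let h : rightIdeal e →+ rightIdeal e := φ.symm.toAddEquiv.toAddMonoidHom.comp g
  have hform : ∀ x y, (φ (h x)).toForm y = β x y := fun x y =>
    LinearMap.congr_fun (φ.apply_symm_apply (g x)) y
  have hcomm : ∀ b x, h (cornerMul e b x) = cornerMul e b (h x) := fun b x => by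
    refine φ.injective (LinearMap.ext fun y => ?_)
    refine (hform _ y).trans (Eq.trans ?_ (hφ b (h x) y).symm)
    rw [hform]
    have := hβ b x y
    rw [(mem_rightIdeal_iff he).1 x.2, (mem_leftIdeal_iff he).1 y.2] at this
    refine this.trans (congrArg (β x) ?_)
    change (y : A) * b * e = y * (e * b * e)
    rw [← mul_assoc, ← mul_assoc, (mem_leftIdeal_iff he).1 y.2]
  obtain ⟨a, ha⟩ := exists_eq_op_smul_of_commute K hdom he h hcomm
  refine ⟨a, fun x y => ?_⟩
  have hxy := hform ⟨e * x, ⟨x, rfl⟩⟩ ⟨y * e, ⟨y, rfl⟩⟩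
  rw [ha, apply_eq_traceForm he] at hxy
  rw [← hxy, mul_assoc (e * x * a)]
  rfl

end DoubleCentralizer

theorem IsGendoSymmetric.nonempty_gendoCore {K A : Type u} [Field K] [Ring A] [Algebra K A]
    [FiniteDimensional K A] (h : IsGendoSymmetric K A) : Nonempty (GendoCore K A) := by
  obtain ⟨hdom, e, he, ⟨hf, -⟩, -, hinj, φ, hφ⟩ := h
  have he : e * e = e := he
  have hp := tracePairing_isPerfPair he φ
  refine ⟨⟨e, he, traceForm he φ, traceForm_comm he φ hφ, fun x h => ?_, fun y h => ?_,
    fun μ => ?_, fun μ => ?_, fun r h => ?_, exists_traceForm_of_balanced hdom he φ hφ⟩⟩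
  · refine congrArg Subtype.val (eq_zero_of_traceForm_left he φ ⟨e * x, ⟨x, rfl⟩⟩ fun y => ?_)
    rw [← h y, mul_assoc _ (y : A) e, (mem_leftIdeal_iff he).1 y.2]
  · refine congrArg Subtype.val (eq_zero_of_traceForm_right he φ ⟨y * e, ⟨y, rfl⟩⟩ fun x => ?_)
    rw [← h x, (mem_rightIdeal_iff he).1 x.2, mul_assoc]
  · obtain ⟨x, hx⟩ := hp.bijective_left.2 (μ ∘ₗ LinearMap.restrictScalars K (leftIdeal e).subtype)
    refine ⟨x, fun y => Eq.trans ?_ (LinearMap.congr_fun hx ⟨y * e, ⟨y, rfl⟩⟩)⟩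
    change _ = traceForm he φ (x * (y * e))
    rw [(mem_rightIdeal_iff he).1 x.2, mul_assoc]
  · obtain ⟨y, hy⟩ := hp.bijective_right.2 (μ ∘ₗ LinearMap.restrictScalars K (rightIdeal e).subtype)
    refine ⟨y, fun x => Eq.trans ?_ (LinearMap.congr_fun hy ⟨e * x, ⟨x, rfl⟩⟩)⟩
    change _ = traceForm he φ (e * x * y)
    rw [mul_assoc, (mem_leftIdeal_iff he).1 y.2]
  · refine op_injective (FaithfulSMul.eq_of_smul_eq_smul (α := rightIdeal e) fun x => ?_)
    rw [op_zero, zero_smul]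
    refine eq_zero_of_traceForm_left he φ _ fun y => ?_
    change traceForm he φ (x * r * y) = 0
    rw [← h x y, (mem_rightIdeal_iff he).1 x.2, mul_assoc _ (y : A) e,
      (mem_leftIdeal_iff he).1 y.2]

/-! ### The natural map `M → Hom(D(A), M)` -/

section Eta

variable {K : Type u} [Field K] {R : Type u} [Ring R] [Algebra K R]

/-- An identification of the left `R`-module `E` with the `K`-dual of the right regular module.
For `R = A` and `R = Aᵐᵒᵖ` this covers both one-sided module structures of `D(A)`. -/
structure RegularDual (K R : Type u) [Field K] [Ring R] [Algebra K R] (E : Type u)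
    [AddCommGroup E] [Module R E] where
  ev : E ≃+ (R →ₗ[K] K)
  ev_smul : ∀ r f x, ev (r • f) x = ev f (x * r)

variable {E : Type u} [AddCommGroup E] [Module R E]

namespace RegularDual

variable (V : RegularDual K R E)

theorem ev_symm_smul (c : K) (μ : R →ₗ[K] K) :
    V.ev.symm (c • μ) = algebraMap K R c • V.ev.symm μ := by
  refine V.ev.injective (LinearMap.ext fun x => ?_)
  rw [V.ev.apply_symm_apply, V.ev_smul, V.ev.apply_symm_apply, ← Algebra.commutes,
    ← Algebra.smul_def, map_smul, LinearMap.smul_apply]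

theorem ev_separates {x y : R} (h : ∀ f, V.ev f x = V.ev f y) : x = y := by
  refine sub_eq_zero.1 ((Module.forall_dual_apply_eq_zero_iff K (x - y)).1 fun μ => ?_)
  have hμ := h (V.ev.symm μ)
  rw [V.ev.apply_symm_apply] at hμ
  rw [map_sub, hμ, sub_self]

theorem exists_ev_eq [FiniteDimensional K R] (h : E →ₗ[R] R) (τ : R →ₗ[K] R →ₗ[K] K) :
    ∃ ψ : R →ₗ[K] R, ∀ y f, V.ev f (ψ y) = τ y (h f) := by
  let L : R →ₗ[K] Module.Dual K (Module.Dual K R) :=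
    { toFun := fun y =>
        { toFun := fun μ => τ y (h (V.ev.symm μ))
          map_add' := fun μ μ' => by rw [map_add, map_add, map_add]
          map_smul' := fun c μ => by
            rw [V.ev_symm_smul, map_smul, smul_eq_mul, ← Algebra.smul_def, map_smul]; rfl }
      map_add' := fun y y' => by ext; simp
      map_smul' := fun c y => by ext; simp }
  refine ⟨(Module.evalEquiv K R).symm.toLinearMap ∘ₗ L, fun y f => ?_⟩
  have hL : Module.Dual.eval K R ((Module.evalEquiv K R).symm (L y)) = L y :=
    (Module.evalEquiv K R).apply_symm_apply (L y)
  refine (LinearMap.congr_fun hL (V.ev f)).trans ?_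
  change τ y (h (V.ev.symm (V.ev f))) = _
  rw [V.ev.symm_apply_apply]

end RegularDual

namespace GendoCore

variable (D : GendoCore K R)

theorem e_mul_e_mul (x : R) : D.e * (D.e * x) = D.e * x := by rw [← mul_assoc, D.idem]

theorem eq_of_tr {r s : R}
    (h : ∀ x y, D.tr (D.e * x * r * y * D.e) = D.tr (D.e * x * s * y * D.e)) : r = s := by
  refine sub_eq_zero.1 (D.faithful _ fun x y => ?_)
  rw [mul_sub, sub_mul, sub_mul, map_sub, h, sub_self]

variable (V : RegularDual K R E)

theorem exists_theta (f : E) :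
    ∃ r, ∀ x y, D.tr (D.e * x * r * y * D.e) = V.ev f (y * D.e * x) := by
  obtain ⟨r, hr⟩ := D.balanced ((LinearMap.mul K R).flip.compr₂ (V.ev f)) (fun b x y => by
    simp only [LinearMap.compr₂_apply, LinearMap.flip_apply, LinearMap.mul_apply', mul_assoc,
      D.e_mul_e_mul])
  refine ⟨r, fun x y => ?_⟩
  rw [← hr x y]
  simp only [LinearMap.compr₂_apply, LinearMap.flip_apply, LinearMap.mul_apply', mul_assoc,
    D.e_mul_e_mul]

/-- The map of bimodules `θ : D(A) → A` with `tr (e x θ(f) y e) = f (y e x)`. Up to the isomorphism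
`eA ≅ D(Ae)` it is dual to the multiplication map `Ae ⊗ eA → A`. -/
def theta : E →ₗ[R] R where
  toFun f := (D.exists_theta V f).choose
  map_add' f g := D.eq_of_tr fun x y => by
    rw [(D.exists_theta V (f + g)).choose_spec, mul_add, add_mul, add_mul, map_add,
      map_add, (D.exists_theta V f).choose_spec, (D.exists_theta V g).choose_spec]
    rfl
  map_smul' r f := D.eq_of_tr fun x y => by
    rw [(D.exists_theta V (r • f)).choose_spec, V.ev_smul, RingHom.id_apply, smul_eq_mul,
      ← mul_assoc (D.e * x), mul_assoc D.e x r, (D.exists_theta V f).choose_spec, mul_assoc _ x r]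

theorem tr_theta (f : E) (x y : R) :
    D.tr (D.e * x * D.theta V f * y * D.e) = V.ev f (y * D.e * x) :=
  (D.exists_theta V f).choose_spec x y

theorem theta_eq_mul {f f' : E} {r : R} (h : ∀ x, V.ev f' x = V.ev f (r * x)) :
    D.theta V f' = D.theta V f * r :=
  D.eq_of_tr fun x y => by
    rw [tr_theta, h, ← mul_assoc (D.e * x), mul_assoc _ r y, tr_theta, mul_assoc, mul_assoc,
      mul_assoc]

variable {M N : Type u} [AddCommGroup M] [Module R M] [AddCommGroup N] [Module R N]

/-- The natural map `M → Hom(D(A), M)`, `m ↦ (f ↦ θ(f) m)`. Its kernel and cokernel measure the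
first two steps of the dominant dimension of `M`. -/
def eta : M →+ (E →ₗ[R] M) where
  toFun m := (LinearMap.toSpanSingleton R M m) ∘ₗ D.theta V
  map_zero' := by ext; simp
  map_add' m m' := by ext; simp

theorem eta_apply (m : M) (f : E) : D.eta V m f = D.theta V f • m := rfl

theorem eta_map (k : M →ₗ[R] N) (m : M) : D.eta V (k m) = k ∘ₗ D.eta V m := by
  ext f; simp [eta_apply]

variable (M) in
/-- The natural map `M → Hom(D(A), M)` is injective. -/
def EtaInj : Prop := Function.Injective (D.eta V (M := M))

variable (M) in
/-- The natural map `M → Hom(D(A), M)` is bijective. -/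
def EtaBij : Prop := Function.Bijective (D.eta V (M := M))

variable {D V}

theorem EtaBij.etaInj (h : D.EtaBij V M) : D.EtaInj V M := h.1

theorem EtaInj.of_injective (k : M →ₗ[R] N) (hk : Function.Injective k) (h : D.EtaInj V N) :
    D.EtaInj V M := by
  refine (injective_iff_map_eq_zero _).2 fun m hm => hk (h ?_)
  rw [eta_map, hm, map_zero, map_zero, LinearMap.comp_zero]

theorem EtaBij.of_exact {J : Type u} [AddCommGroup J] [Module R J] {k : M →ₗ[R] N}
    {l : N →ₗ[R] J} (hk : Function.Injective k) (hkl : Function.Exact k l)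
    (hN : D.EtaBij V N) (hJ : D.EtaInj V J) : D.EtaBij V M := by
  refine ⟨hN.etaInj.of_injective k hk, fun h => ?_⟩
  obtain ⟨n, hn⟩ := hN.2 (k ∘ₗ h)
  have hl : l n = 0 := by
    refine hJ ?_
    rw [eta_map, hn, map_zero]
    ext f; exact hkl.apply_apply_eq_zero _
  obtain ⟨m, rfl⟩ := (hkl n).1 hl
  rw [eta_map] at hn
  exact ⟨m, LinearMap.ext fun f => hk (LinearMap.congr_fun hn f)⟩

theorem EtaBij.of_retract (a : M →ₗ[R] N) (b : N →ₗ[R] M) (hab : b ∘ₗ a = LinearMap.id)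
    (h : D.EtaBij V N) : D.EtaBij V M := by
  have hab' : ∀ m, b (a m) = m := LinearMap.congr_fun hab
  refine ⟨h.etaInj.of_injective a (Function.LeftInverse.injective hab'), fun k => ?_⟩
  obtain ⟨n, hn⟩ := h.2 (a ∘ₗ k)
  refine ⟨b n, ?_⟩
  rw [eta_map, hn]
  ext f; exact hab' _

theorem EtaBij.pi {n : ℕ} (h : D.EtaBij V M) : D.EtaBij V (Fin n → M) := by
  constructor
  · intro x y hxy
    funext i
    have hi := congrArg (fun l => LinearMap.proj i ∘ₗ l) hxy
    simp only [← eta_map] at hi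
    exact h.1 hi
  · intro k
    choose m hm using fun i => h.2 (LinearMap.proj i ∘ₗ k)
    refine ⟨m, ?_⟩
    ext f i
    exact LinearMap.congr_fun (hm i) f

variable {X Y Z : Type u} [AddCommGroup X] [Module R X] [AddCommGroup Y] [Module R Y]
  [AddCommGroup Z] [Module R Z] {f : X →ₗ[R] Y} {g : Y →ₗ[R] Z}

theorem EtaInj.coker (hfg : IsShortExact f g) (hX : D.EtaBij V X) (hY : D.EtaInj V Y) :
    D.EtaInj V Z := by
  refine (injective_iff_map_eq_zero _).2 fun z hz => ?_
  obtain ⟨y, rfl⟩ := hfg.surj z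
  rw [eta_map] at hz
  obtain ⟨k, hk⟩ := hfg.exists_codesc _ hz
  obtain ⟨x, rfl⟩ := hX.2 k
  rw [← eta_map] at hk
  rw [← hY hk]
  exact hfg.exact.apply_apply_eq_zero x

theorem EtaBij.coker (hfg : IsShortExact f g) (hX : D.EtaBij V X) (hY : D.EtaBij V Y)
    (hE : ExtVanishesAt R E X 1) : D.EtaBij V Z := by
  refine ⟨EtaInj.coker hfg hX hY.etaInj, fun k => ?_⟩
  obtain ⟨l, rfl⟩ := hfg.exists_lift hE k
  obtain ⟨y, rfl⟩ := hY.2 l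
  exact ⟨g y, eta_map D V g y⟩

theorem EtaInj.extension (hfg : IsShortExact f g) (hX : D.EtaInj V X) (hZ : D.EtaInj V Z) :
    D.EtaInj V Y := by
  refine (injective_iff_map_eq_zero _).2 fun y hy => ?_
  have hgy : g y = 0 := hZ (by rw [eta_map, hy, map_zero, LinearMap.comp_zero])
  obtain ⟨x, rfl⟩ := (hfg.exact y).1 hgy
  have hx : x = 0 := hX <| LinearMap.ext fun w => hfg.inj <| by
    rw [eta_map] at hy
    simpa using LinearMap.congr_fun hy w
  rw [hx, map_zero]

theorem EtaBij.extension (hfg : IsShortExact f g) (hX : D.EtaBij V X) (hZ : D.EtaBij V Z) :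
    D.EtaBij V Y := by
  refine ⟨EtaInj.extension hfg hX.etaInj hZ.etaInj, fun k => ?_⟩
  obtain ⟨z, hz⟩ := hZ.2 (g ∘ₗ k)
  obtain ⟨y, rfl⟩ := hfg.surj z
  obtain ⟨l, hl⟩ := hfg.exists_codesc (k - D.eta V y) <| by
    rw [LinearMap.comp_sub, ← eta_map, hz, sub_self]
  obtain ⟨x, rfl⟩ := hX.2 l
  exact ⟨f x + y, by rw [map_add, eta_map, hl, sub_add_cancel]⟩

section Projective

variable (V)

theorem etaInj_self : D.EtaInj V R := by
  refine (injective_iff_map_eq_zero _).2 fun r hr => D.faithful r fun x y => ?_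
  have hev : ∀ f x, V.ev f (r * y * D.e * x) = 0 := fun f x => by
    have hθ : D.theta V f * r = 0 := LinearMap.congr_fun hr f
    rw [← D.tr_theta, ← mul_assoc _ r y, mul_assoc _ _ r, hθ, mul_zero, zero_mul, zero_mul,
      map_zero]
  have hry : r * y * D.e = 0 := V.ev_separates fun f => by
    rw [← mul_one (r * y * D.e), hev, map_zero]
  rw [mul_assoc, mul_assoc, ← mul_assoc r, hry, mul_zero, map_zero]

variable {V} {h : E →ₗ[R] R} {ψ : R →ₗ[K] R}
  (hψ : ∀ y f, V.ev f (ψ y) = D.tr (D.e * h f * y * D.e))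

include hψ

theorem dualMap_mul_e (y : R) : ψ (y * D.e) = ψ y :=
  V.ev_separates fun f => by
    rw [hψ, hψ]
    simp only [mul_assoc, D.idem]

theorem dualMap_mul_corner (b y : R) : ψ (y * D.e * b * D.e) = ψ y * D.e * b * D.e :=
  V.ev_separates fun f => by
    have htr := D.tr_comm b (h f * y)
    simp only [mul_assoc] at htr ⊢
    rw [← V.ev_smul, hψ, hψ, map_smul]
    simp only [mul_assoc, smul_eq_mul, D.e_mul_e_mul, D.idem]
    exact htr.symm

theorem dualMap_eq_mul : ∃ r, ∀ y, ψ y = r * y * D.e := by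
  have hψe : ∀ y, ψ y * D.e = ψ y := fun y => by
    have h1 := dualMap_mul_corner hψ 1 y
    simp only [mul_one, mul_assoc, D.idem] at h1
    rw [← h1, dualMap_mul_e hψ]
  obtain ⟨r, hr⟩ := D.balanced
    (((LinearMap.mul K R).compr₂ (D.tr ∘ₗ LinearMap.mulRight K D.e)).compl₁₂ LinearMap.id ψ)
    (fun b x y => by
      have htr := D.tr_comm b (x * ψ y)
      simp only [LinearMap.compl₁₂_apply, LinearMap.compr₂_apply, LinearMap.comp_apply,
        LinearMap.id_apply, LinearMap.mul_apply', LinearMap.mulRight_apply, dualMap_mul_corner hψ]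
      simp only [dualMap_mul_e hψ, mul_assoc, D.idem] at htr ⊢
      exact htr)
  refine ⟨r, fun y => ?_⟩
  have h0 : (ψ y - r * y) * D.e = 0 := D.nondeg_right _ fun x => by
    have hxy := hr x y
    simp only [LinearMap.compl₁₂_apply, LinearMap.compr₂_apply, LinearMap.comp_apply,
      LinearMap.id_apply, LinearMap.mul_apply', LinearMap.mulRight_apply,
      dualMap_mul_e hψ] at hxy
    rw [mul_sub, sub_mul, map_sub, hxy, ← mul_assoc, sub_self]
  rw [sub_mul, hψe] at h0
  exact sub_eq_zero.1 h0

omit hψ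
variable [FiniteDimensional K R] (V)

-- The transpose of `h` along `tr` is a map `Re → Re` commuting with `eRe`, so the double
-- centralizer property makes it a left multiplication.
theorem etaBij_self : D.EtaBij V R := by
  refine ⟨etaInj_self V, fun h => ?_⟩
  obtain ⟨ψ, hψ⟩ := V.exists_ev_eq h ((LinearMap.mul K R).flip.compr₂
    (D.tr ∘ₗ LinearMap.mulLeft K D.e ∘ₗ LinearMap.mulRight K D.e))
  have hψ : ∀ y f, V.ev f (ψ y) = D.tr (D.e * h f * y * D.e) := fun y f => by
    rw [hψ]; simp [mul_assoc]
  obtain ⟨r, hr⟩ := dualMap_eq_mul hψ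
  refine ⟨r, LinearMap.ext fun f => D.eq_of_tr fun x y => ?_⟩
  have hxf := hψ y (x • f)
  rw [V.ev_smul, hr, map_smul, smul_eq_mul, ← mul_assoc] at hxf
  rw [← hxf, eta_apply, smul_eq_mul, ← mul_assoc, mul_assoc _ r y, tr_theta]

theorem etaBij_of_projective {P : Type u} [AddCommGroup P] [Module R P] [Module.Finite R P]
    [Module.Projective R P] : D.EtaBij V P := by
  obtain ⟨n, p, s, -, -, hps⟩ := Module.Finite.exists_comp_eq_id_of_projective R P
  exact (EtaBij.pi (etaBij_self V)).of_retract s p hps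

end Projective

end GendoCore

end Eta

/-! ### Injective cogenerators and injective envelopes -/

section Maps

variable {K : Type u} [Field K] {R : Type u} [Ring R] [Algebra K R] (D : GendoCore K R)
  {E : Type u} [AddCommGroup E] [Module R E] (V : RegularDual K R E)
  {M : Type u} [AddCommGroup M] [Module R M] [Module K M] [IsScalarTower K R M]

namespace GendoCore

theorem mul_e (q : leftIdeal D.e) : (q : R) * D.e = q := (mem_leftIdeal_iff D.idem).1 q.2

theorem leftIdeal_ext {q q' : leftIdeal D.e}
    (h : ∀ x, D.tr (D.e * x * q) = D.tr (D.e * x * q')) : q = q' := by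
  refine Subtype.ext (sub_eq_zero.1 ?_)
  have := D.nondeg_right (q - q') fun x => by
    rw [mul_sub, sub_mul, mul_assoc, D.mul_e, mul_assoc _ (q' : R), D.mul_e, map_sub, h, sub_self]
  rwa [sub_mul, D.mul_e, D.mul_e] at this

theorem exists_formMap (μ : M →ₗ[K] K) (m : M) :
    ∃ q : leftIdeal D.e, ∀ x, D.tr (D.e * x * q) = μ ((D.e * x) • m) := by
  obtain ⟨y, hy⟩ := D.rep_right (μ ∘ₗ (LinearMap.toSpanSingleton R M m).restrictScalars K)
  refine ⟨⟨y * D.e, ⟨y, rfl⟩⟩, fun x => ?_⟩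
  rw [← mul_assoc]
  exact hy x

/-- The map `M → Re` attached to a linear form `μ` on `M` by the perfect pairing `eR × Re → K`. -/
def formMap (μ : M →ₗ[K] K) : M →ₗ[R] leftIdeal D.e where
  toFun m := (D.exists_formMap μ m).choose
  map_add' m m' := D.leftIdeal_ext fun x => by
    rw [(D.exists_formMap μ (m + m')).choose_spec, Submodule.coe_add, mul_add, map_add,
      (D.exists_formMap μ m).choose_spec, (D.exists_formMap μ m').choose_spec, smul_add, map_add]
  map_smul' r m := D.leftIdeal_ext fun x => by
    rw [(D.exists_formMap μ (r • m)).choose_spec, RingHom.id_apply, Submodule.coe_smul, smul_eq_mul,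
      ← mul_assoc, mul_assoc D.e x r, (D.exists_formMap μ m).choose_spec, ← mul_assoc,
      mul_smul (D.e * x)]

theorem tr_formMap (μ : M →ₗ[K] K) (m : M) (x : R) :
    D.tr (D.e * x * D.formMap μ m) = μ ((D.e * x) • m) :=
  (D.exists_formMap μ m).choose_spec x

theorem leftIdeal_injective : Module.Injective R (leftIdeal D.e) :=
  injective_of_forall_extend (K := K) fun X Y _ _ _ _ _ _ _ _ f hf g => by
    obtain ⟨l, hl⟩ := LinearMap.exists_leftInverse_of_injective (f.restrictScalars K)
      (LinearMap.ker_eq_bot.2 hf)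
    have hl' : ∀ x, l (f x) = x := LinearMap.congr_fun hl
    let μ : X →ₗ[K] K := D.tr ∘ₗ ((leftIdeal D.e).subtype ∘ₗ g).restrictScalars K
    refine ⟨D.formMap (μ ∘ₗ l), fun x => D.leftIdeal_ext fun y => ?_⟩
    rw [tr_formMap, ← map_smul, LinearMap.comp_apply, hl']
    simp [μ]

instance leftIdeal_projective : Module.Projective R (leftIdeal D.e) :=
  Module.Projective.of_split (leftIdeal D.e).subtype
    (LinearMap.codRestrict (leftIdeal D.e) (LinearMap.toSpanSingleton R R D.e)
      fun x => ⟨x, rfl⟩) (by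
        ext x
        exact D.mul_e x)

instance leftIdeal_finite : Module.Finite R (leftIdeal D.e) :=
  Module.Finite.of_surjective
    (LinearMap.codRestrict (leftIdeal D.e) (LinearMap.toSpanSingleton R R D.e)
      fun x => ⟨x, rfl⟩) fun x => ⟨x, Subtype.ext (D.mul_e x)⟩

end GendoCore

namespace RegularDual

/-- The map `M → D(R)`, `m ↦ (x ↦ μ (x m))`, attached to a linear form `μ` on `M`. -/
def formMap (μ : M →ₗ[K] K) : M →ₗ[R] E where
  toFun m := V.ev.symm (μ ∘ₗ (LinearMap.toSpanSingleton R M m).restrictScalars K)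
  map_add' m m' := V.ev.injective (by ext x; simp)
  map_smul' r m := V.ev.injective (by ext x; simp [V.ev_smul, mul_smul])

theorem ev_formMap (μ : M →ₗ[K] K) (m : M) (x : R) : V.ev (V.formMap μ m) x = μ (x • m) := by
  simp [formMap]

include V in
theorem injective : Module.Injective R E :=
  injective_of_forall_extend (K := K) fun X Y _ _ _ _ _ _ _ _ f hf g => by
    obtain ⟨l, hl⟩ := LinearMap.exists_leftInverse_of_injective (f.restrictScalars K)
      (LinearMap.ker_eq_bot.2 hf)
    have hl' : ∀ x, l (f x) = x := LinearMap.congr_fun hl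
    let μ : X →ₗ[K] K :=
      { toFun := fun x => V.ev (g x) 1
        map_add' := fun x y => by rw [map_add, map_add]; rfl
        map_smul' := fun c x => by
          rw [← algebraMap_smul R c x, map_smul, V.ev_smul, one_mul, ← mul_one (algebraMap K R c),
            ← Algebra.smul_def, map_smul]; rfl }
    refine ⟨V.formMap (μ ∘ₗ l), fun x => V.ev.injective (LinearMap.ext fun y => ?_)⟩
    rw [ev_formMap, ← map_smul, LinearMap.comp_apply, hl']
    change V.ev (g (y • x)) 1 = _
    rw [map_smul, V.ev_smul, one_mul]

include V in
theorem finite [FiniteDimensional K R] : Module.Finite R E := by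
  let := scalarModule K R E
  have := scalarModule_isScalarTower K R E
  let L : E →ₗ[K] (R →ₗ[K] K) :=
    { toFun := V.ev
      map_add' := V.ev.map_add
      map_smul' := fun c f => by
        ext x
        change V.ev (algebraMap K R c • f) x = c • V.ev f x
        rw [V.ev_smul, ← Algebra.commutes, ← Algebra.smul_def, map_smul] }
  have : Module.Finite K E := Module.Finite.of_injective L V.ev.injective
  exact Module.Finite.of_restrictScalars_finite K R E

end RegularDual

namespace GendoCore

variable (M) in
theorem exists_injective_pi_leftIdeal [FiniteDimensional K M]
    (hM : ∀ m : M, (∀ x, (D.e * x) • m = 0) → m = 0) :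
    ∃ (n : ℕ) (j : M →ₗ[R] (Fin n → leftIdeal D.e)), Function.Injective j := by
  let b := Module.finBasis K M
  refine ⟨_, LinearMap.pi fun i => D.formMap (b.coord i), ?_⟩
  refine (injective_iff_map_eq_zero _).2 fun m hm => hM m fun x => b.ext_elem fun i => ?_
  have hi : D.formMap (b.coord i) m = 0 := congrFun hm i
  have htr := D.tr_formMap (b.coord i) m x
  rw [hi] at htr
  simpa using htr.symm

end GendoCore

omit [Module K M] [IsScalarTower K R M] in
include V in
theorem RegularDual.exists_injective_pi [FiniteDimensional K R] [Module.Finite R M] :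
    ∃ (n : ℕ) (j : M →ₗ[R] (Fin n → E)), Function.Injective j := by
  let := scalarModule K R M
  have := scalarModule_isScalarTower K R M
  have : Module.Finite K M := Module.Finite.trans R M
  let b := Module.finBasis K M
  refine ⟨_, LinearMap.pi fun i => V.formMap (b.coord i), ?_⟩
  refine (injective_iff_map_eq_zero _).2 fun m hm => b.ext_elem fun i => ?_
  have hi : V.formMap (b.coord i) m = 0 := congrFun hm i
  have hev := V.ev_formMap (b.coord i) m 1
  rw [hi] at hev
  simpa using hev.symm

end Maps

section Envelope

variable {R : Type u} [Ring R] {M Q : Type u} [AddCommGroup M] [Module R M] [AddCommGroup Q]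
  [Module R Q]

theorem exists_extend_of_disjoint_range [Module.Injective R Q] {ι : M →ₗ[R] Q}
    (hι : Function.Injective ι) {S : Submodule R Q} (hS : S ⊓ LinearMap.range ι = ⊥) :
    ∃ h : Q →ₗ[R] Q, h ∘ₗ ι = ι ∧ ∀ s ∈ S, h s = 0 := by
  have hinj : Function.Injective (ι.coprod S.subtype) := by
    rw [← LinearMap.ker_eq_bot, LinearMap.ker_coprod_of_disjoint_range _ _ <| by
      rw [Submodule.range_subtype]; exact (disjoint_iff.2 hS).symm, LinearMap.ker_eq_bot.2 hι,
      Submodule.ker_subtype, Submodule.prod_bot]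
  obtain ⟨h, hh⟩ := Module.Injective.out (X := M × S) (ι.coprod S.subtype) hinj
    (ι ∘ₗ LinearMap.fst R M S)
  exact ⟨h, LinearMap.ext fun m => by simpa using hh (m, 0), fun s hs => by
    simpa using hh (0, ⟨s, hs⟩)⟩

-- A minimal injective submodule of `Q` containing `M`: if `S ≤ N` is disjoint from `M`, then an
-- endomorphism of `N` fixing `M` and killing `S` is bijective, so `S = 0`.
theorem exists_isEssential_of_injective [IsArtinian R Q] [IsNoetherian R Q] [Module.Injective R Q]
    (j : M →ₗ[R] Q) (hj : Function.Injective j) :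
    ∃ (I : ModuleCat.{u} R) (ι : M →ₗ[R] I), Module.Finite R I ∧ Module.Injective R I ∧
      Function.Injective ι ∧ IsEssential (LinearMap.range ι) := by
  let 𝒮 : Set (Submodule R Q) := {N | LinearMap.range j ≤ N ∧ Module.Injective R N}
  have hne : 𝒮.Nonempty := ⟨⊤, le_top, injective_of_linearEquiv Submodule.topEquiv⟩
  obtain ⟨N, ⟨hjN, hN⟩, hmin⟩ := IsArtinian.set_has_minimal 𝒮 hne
  let ι : M →ₗ[R] N := j.codRestrict N fun m => hjN ⟨m, rfl⟩
  have hι : Function.Injective ι := fun a b h => hj (congrArg Subtype.val h)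
  refine ⟨ModuleCat.of R N, ι, inferInstanceAs (Module.Finite R N), hN, hι, fun S hS => ?_⟩
  change Submodule R N at S
  obtain ⟨h, hhι, hhS⟩ := exists_extend_of_disjoint_range hι hS
  have hpow : ∀ k, (h ^ k) ∘ₗ ι = ι := fun k => by
    induction k with
    | zero => rfl
    | succ k ih => rw [pow_succ, Module.End.mul_eq_comp, LinearMap.comp_assoc, hhι, ih]
  have hbij : Function.Bijective h := bijective_of_minimal (P := (· ∈ 𝒮)) hmin h fun k hc => by
    obtain ⟨r, hr⟩ := exists_retraction_of_isCompl hc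
    have : Module.Injective R (LinearMap.range (h ^ k)) := injective_of_retract _ r hr
    refine ⟨?_, injective_of_linearEquiv (N := LinearMap.range (h ^ k))
      (Submodule.equivMapOfInjective N.subtype Subtype.val_injective _).symm⟩
    rintro _ ⟨m, rfl⟩
    exact ⟨ι m, ⟨ι m, LinearMap.congr_fun (hpow k) m⟩, rfl⟩
  exact eq_bot_iff.2 fun s hs => hbij.1 ((hhS s hs).trans (map_zero h).symm)

theorem exists_injectiveEnvelope {K : Type u} [Field K] [Algebra K R] [FiniteDimensional K R]
    {E : Type u} [AddCommGroup E] [Module R E] (V : RegularDual K R E) (M : Type u)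
    [AddCommGroup M] [Module R M] [Module.Finite R M] :
    ∃ (I : ModuleCat.{u} R) (ι : M →ₗ[R] I), Module.Finite R I ∧ Module.Injective R I ∧
      Function.Injective ι ∧ IsEssential (LinearMap.range ι) := by
  have := IsArtinianRing.of_finite K R
  have := IsNoetherianRing.of_finite K R
  have := V.injective
  have := V.finite
  obtain ⟨n, j, hj⟩ := V.exists_injective_pi (M := M)
  exact exists_isEssential_of_injective j hj

end Envelope

/-! ### Dominant dimension -/

section MinimalInjectiveResolution

variable {R : Type u} [Ring R] {M : Type u} [AddCommGroup M] [Module R M]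
  (J : MinimalInjectiveResolution R M)

/-- The resolution of the image of the first differential. -/
def MinimalInjectiveResolution.shift : MinimalInjectiveResolution R (LinearMap.range (J.d 0)) where
  I n := J.I (n + 1)
  finite n := J.finite (n + 1)
  injective n := J.injective (n + 1)
  ι := (LinearMap.range (J.d 0)).subtype
  d n := J.d (n + 1)
  ι_injective := Subtype.val_injective
  exact_zero x := by
    rw [J.exact_succ 0 x]
    simp
  exact_succ n := J.exact_succ (n + 1)
  ι_essential := by rw [Submodule.range_subtype]; exact J.d_essential 0
  d_essential n := J.d_essential (n + 1)

theorem MinimalInjectiveResolution.isShortExact : IsShortExact J.ι (J.d 0).rangeRestrict where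
  inj := J.ι_injective
  exact x := by
    rw [← J.exact_zero x, ← Subtype.coe_inj]
    rfl
  surj := LinearMap.surjective_rangeRestrict _

end MinimalInjectiveResolution

instance projective_pi {R : Type u} [Ring R] (n : ℕ) (P : Type u) [AddCommGroup P] [Module R P]
    [Module.Projective R P] : Module.Projective R (Fin n → P) :=
  Module.Projective.of_equiv (DFinsupp.linearEquivFunOnFintype (R := R) (M := fun _ : Fin n => P))

theorem IsEssential.injective_of_comp {R : Type u} [Ring R] {M N Q : Type u} [AddCommGroup M]
    [Module R M] [AddCommGroup N] [Module R N] [AddCommGroup Q] [Module R Q] {ι : M →ₗ[R] N}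
    (h : IsEssential (LinearMap.range ι)) {k : N →ₗ[R] Q} (hk : Function.Injective (k ∘ₗ ι)) :
    Function.Injective k := by
  refine LinearMap.ker_eq_bot.1 (h _ (eq_bot_iff.2 ?_))
  rintro _ ⟨hx, ⟨m, rfl⟩⟩
  rw [(injective_iff_map_eq_zero _).1 hk m hx, map_zero]
  exact zero_mem _

section EtaDomDim

variable {K : Type u} [Field K] {R : Type u} [Ring R] [Algebra K R] {D : GendoCore K R}
  {E : Type u} [AddCommGroup E] [Module R E] {V : RegularDual K R E}

namespace GendoCore

theorem theta_form (x y : R) {f : E} (hf : ∀ a, V.ev f a = D.tr (D.e * x * a * y * D.e)) :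
    D.theta V f = y * D.e * x :=
  D.eq_of_tr fun x' y' => by
    have := D.tr_comm (x * y') (x' * y)
    rw [tr_theta, hf]
    simp only [mul_assoc] at this ⊢
    exact this

variable [FiniteDimensional K R]

variable (D) in
theorem span_traceForms_eq_top :
    Submodule.span K {μ : Module.Dual K R | ∃ x y, ∀ a, μ a = D.tr (D.e * x * a * y * D.e)} =
      ⊤ := by
  set W := Submodule.span K {μ : Module.Dual K R | ∃ x y, ∀ a, μ a = D.tr (D.e * x * a * y * D.e)}
  have hW : W.dualCoannihilator = ⊥ := eq_bot_iff.2 fun r hr => D.faithful r fun x y =>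
    (Submodule.mem_dualCoannihilator _).1 hr (D.tr ∘ₗ LinearMap.mulRight K D.e ∘ₗ
      LinearMap.mulRight K y ∘ₗ LinearMap.mulLeft K (D.e * x))
      (Submodule.subset_span ⟨x, y, fun _ => rfl⟩)
  rw [← Subspace.dualCoannihilator_dualAnnihilator_eq (W := W), hW, Submodule.dualAnnihilator_bot]

theorem EtaInj.eq_zero {M : Type u} [AddCommGroup M] [Module R M] (h : D.EtaInj V M) {m : M}
    (hm : ∀ x, (D.e * x) • m = 0) : m = 0 := by
  have hθ : ∀ μ, D.theta V (V.ev.symm μ) • m = 0 := fun μ => by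
    have hμ : μ ∈ Submodule.span K _ := span_traceForms_eq_top D ▸ Submodule.mem_top
    induction hμ using Submodule.span_induction with
    | mem μ hμ =>
      obtain ⟨x, y, hxy⟩ := hμ
      rw [theta_form x y fun a => by rw [V.ev.apply_symm_apply, hxy], mul_assoc, mul_smul, hm,
        smul_zero]
    | zero => rw [map_zero, map_zero, zero_smul]
    | add μ μ' _ _ h h' => rw [map_add, map_add, add_smul, h, h', add_zero]
    | smul c μ _ h => rw [V.ev_symm_smul, map_smul, smul_eq_mul, mul_smul, h, smul_zero]
  refine h (LinearMap.ext fun f => ?_)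
  rw [map_zero, eta_apply, ← V.ev.symm_apply_apply f, hθ, LinearMap.zero_apply]

theorem EtaInj.exists_injective_pi_leftIdeal {M : Type u} [AddCommGroup M] [Module R M]
    [Module.Finite R M] (h : D.EtaInj V M) :
    ∃ (n : ℕ) (j : M →ₗ[R] (Fin n → leftIdeal D.e)), Function.Injective j := by
  let := scalarModule K R M
  have := scalarModule_isScalarTower K R M
  have : Module.Finite K M := Module.Finite.trans R M
  exact D.exists_injective_pi_leftIdeal M fun m hm => h.eq_zero hm

theorem EtaInj.projective_of_essential {M : Type u} [AddCommGroup M] [Module R M]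
    [Module.Finite R M] (h : D.EtaInj V M) {I : Type u} [AddCommGroup I] [Module R I]
    [Module.Injective R I] (ι : M →ₗ[R] I) (hι : Function.Injective ι)
    (hess : IsEssential (LinearMap.range ι)) : Module.Projective R I := by
  obtain ⟨n, j, hj⟩ := h.exists_injective_pi_leftIdeal
  have := D.leftIdeal_injective
  obtain ⟨k, hk⟩ := Module.Injective.out ι hι j
  have hkj : k ∘ₗ ι = j := LinearMap.ext hk
  obtain ⟨r, hr⟩ := Module.Injective.out k (hess.injective_of_comp (hkj ▸ hj)) LinearMap.id
  exact Module.Projective.of_split k r (LinearMap.ext hr)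

theorem etaBij_of_resolution {M : Type u} [AddCommGroup M] [Module R M]
    (J : MinimalInjectiveResolution R M) [Module.Projective R (J.I 0)]
    [Module.Projective R (J.I 1)] : D.EtaBij V M := by
  have := J.finite
  exact EtaBij.of_exact J.ι_injective J.exact_zero (etaBij_of_projective V)
    (etaBij_of_projective V (P := J.I 1)).etaInj

variable (D V) in
include D V in
theorem extVanishesAt_of_resolution (n : ℕ) : ∀ {M : Type u} [AddCommGroup M] [Module R M]
    (J : MinimalInjectiveResolution R M), (∀ i < n + 3, Module.Projective R (J.I i)) →
      ExtVanishesAt R E M (n + 1) := by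
  induction n with
  | zero =>
    intro M _ _ J hJ
    have := J.injective
    have : Module.Projective R (J.shift.I 0) := hJ 1 (by omega)
    have : Module.Projective R (J.shift.I 1) := hJ 2 (by omega)
    have hη : D.EtaBij V (LinearMap.range (J.d 0)) := etaBij_of_resolution J.shift
    refine J.isShortExact.extVanishesAt_one_of_lift (.of_injective le_rfl) fun k => ?_
    obtain ⟨w, rfl⟩ := hη.2 k
    obtain ⟨y, rfl⟩ := J.isShortExact.surj w
    exact ⟨D.eta V y, (eta_map D V _ y).symm⟩
  | succ n ih =>
    intro M _ _ J hJ
    have := J.injective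
    exact J.isShortExact.extVanishesAt_covariant₁ (ih J.shift fun i hi => hJ (i + 1) (by omega))
      (.of_injective (by omega))

theorem etaBij_of_two_le_domDim {M : Type u} [AddCommGroup M] [Module R M]
    (h : 2 ≤ domDim R M) : D.EtaBij V M := by
  obtain ⟨J, hJ⟩ := exists_resolution_of_le_domDim (n := 1) (by exact_mod_cast h)
  have := hJ 0 (by omega)
  have := hJ 1 (by omega)
  exact etaBij_of_resolution J

variable (D V) in
include D V in
theorem extVanishesAt_of_le_domDim {n : ℕ} {M : Type u} [AddCommGroup M] [Module R M]
    (h : ((n + 3 : ℕ) : ℕ∞) ≤ domDim R M) : ExtVanishesAt R E M (n + 1) := by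
  obtain ⟨J, hJ⟩ := exists_resolution_of_le_domDim (n := n + 2) h
  exact extVanishesAt_of_resolution D V n J hJ

end GendoCore

section Construction

variable [FiniteDimensional K R] (V) (M : Type u) [AddCommGroup M] [Module R M] [Module.Finite R M]

/-- A chosen injective envelope. -/
def envelope : ModuleCat.{u} R := (exists_injectiveEnvelope V M).choose

/-- The embedding of a module in its chosen injective envelope. -/
def toEnvelope : M →ₗ[R] envelope V M := (exists_injectiveEnvelope V M).choose_spec.choose

theorem toEnvelope_spec :
    Module.Finite R (envelope V M) ∧ Module.Injective R (envelope V M) ∧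
      Function.Injective (toEnvelope V M) ∧ IsEssential (LinearMap.range (toEnvelope V M)) :=
  (exists_injectiveEnvelope V M).choose_spec.choose_spec

instance : Module.Finite R (envelope V M) := (toEnvelope_spec V M).1

instance : Module.Injective R (envelope V M) := (toEnvelope_spec V M).2.1

/-- The cokernel of the injective envelope. -/
abbrev Cosyzygy : Type u := envelope V M ⧸ LinearMap.range (toEnvelope V M)

/-- The iterated cosyzygies. -/
def cosyzygy (M : ModuleCat.{u} R) [Module.Finite R M] :
    ℕ → {N : ModuleCat.{u} R // Module.Finite R N}
  | 0 => ⟨M, inferInstance⟩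
  | n + 1 =>
    have := (cosyzygy M n).2
    ⟨ModuleCat.of R (Cosyzygy V (cosyzygy M n).1), inferInstanceAs (Module.Finite R (_ ⧸ _))⟩

instance (M : ModuleCat.{u} R) [Module.Finite R M] (n : ℕ) :
    Module.Finite R (cosyzygy V M n).1 := (cosyzygy V M n).2

/-- The projection onto the next cosyzygy. -/
def toCosyzygy (M : ModuleCat.{u} R) [Module.Finite R M] (n : ℕ) :
    envelope V (cosyzygy V M n).1 →ₗ[R] (cosyzygy V M (n + 1)).1 :=
  (LinearMap.range (toEnvelope V (cosyzygy V M n).1)).mkQ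

theorem isShortExact_toCosyzygy (M : ModuleCat.{u} R) [Module.Finite R M] (n : ℕ) :
    IsShortExact (toEnvelope V (cosyzygy V M n).1) (toCosyzygy V M n) :=
  IsShortExact.mkQ_range _ (toEnvelope_spec V _).2.2.1

/-- The minimal injective resolution built from injective envelopes. -/
def minimalResolution (M : ModuleCat.{u} R) [Module.Finite R M] :
    MinimalInjectiveResolution R M where
  I n := envelope V (cosyzygy V M n).1
  finite n := inferInstance
  injective n := inferInstance
  ι := toEnvelope V M
  d n := toEnvelope V (cosyzygy V M (n + 1)).1 ∘ₗ toCosyzygy V M n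
  ι_injective := (toEnvelope_spec V M).2.2.1
  exact_zero x := by
    refine Iff.trans ?_ ((isShortExact_toCosyzygy V M 0).exact x)
    exact map_eq_zero_iff _ (toEnvelope_spec V (cosyzygy V M 1).1).2.2.1
  exact_succ n x := by
    refine Iff.trans (Iff.trans ?_ ((isShortExact_toCosyzygy V M (n + 1)).exact x)) ?_
    · exact map_eq_zero_iff _ (toEnvelope_spec V (cosyzygy V M (n + 2)).1).2.2.1
    · constructor
      · rintro ⟨y, rfl⟩
        obtain ⟨z, rfl⟩ := (isShortExact_toCosyzygy V M n).surj y
        exact ⟨z, rfl⟩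
      · rintro ⟨z, rfl⟩
        exact ⟨_, rfl⟩
  ι_essential := (toEnvelope_spec V M).2.2.2
  d_essential n := by
    rw [LinearMap.range_comp_of_range_eq_top _
      (LinearMap.range_eq_top.2 (isShortExact_toCosyzygy V M n).surj)]
    exact (toEnvelope_spec V (cosyzygy V M (n + 1)).1).2.2.2

end Construction

namespace GendoCore

variable [FiniteDimensional K R]

theorem EtaBij.projective_envelope {N : Type u} [AddCommGroup N] [Module R N] [Module.Finite R N]
    (hN : D.EtaBij V N) : Module.Projective R (envelope V N) :=
  hN.etaInj.projective_of_essential _ (toEnvelope_spec V N).2.2.1 (toEnvelope_spec V N).2.2.2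

theorem etaBij_cosyzygy {M : ModuleCat.{u} R} [Module.Finite R M] (h : D.EtaBij V M)
    (hE : ExtVanishes R E M) (n : ℕ) :
    D.EtaBij V (cosyzygy V M n).1 ∧ ExtVanishes R E (cosyzygy V M n).1 := by
  induction n with
  | zero => exact ⟨h, hE⟩
  | succ n ih =>
    obtain ⟨hη, hExt⟩ := ih
    have := hη.projective_envelope
    have hses := isShortExact_toCosyzygy V M n
    exact ⟨EtaBij.coker hses hη (etaBij_of_projective V) (hExt 1 le_rfl), fun i hi =>
      hses.extVanishesAt_covariant₃ (.of_injective hi) (hExt (i + 1) (by omega))⟩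

theorem domDim_eq_top_iff (M : Type u) [AddCommGroup M] [Module R M] [Module.Finite R M] :
    domDim R M = ⊤ ↔ D.EtaBij V M ∧ ExtVanishes R E M := by
  refine ⟨fun h => ⟨etaBij_of_two_le_domDim (h ▸ le_top), fun i hi => ?_⟩, fun ⟨hη, hE⟩ => ?_⟩
  · obtain ⟨i, rfl⟩ := Nat.exists_eq_add_of_le' hi
    exact extVanishesAt_of_le_domDim D V (h ▸ le_top)
  · exact ENat.eq_top_iff_forall_ge.2 fun n => le_domDim (minimalResolution V (ModuleCat.of R M))
      fun i _ => (etaBij_cosyzygy hη hE i).1.projective_envelope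

end GendoCore

end EtaDomDim

section Duality

variable {K : Type u} [Field K] {A : Type u} [Ring A] [Algebra K A]

instance KDual.instModuleScalar {M : Type u} [AddCommGroup M] [Module K M] :
    Module K (KDual K M) := inferInstanceAs (Module K (M →ₗ[K] K))

instance KDual.instFiniteDimensional {M : Type u} [AddCommGroup M] [Module K M]
    [FiniteDimensional K M] : FiniteDimensional K (KDual K M) :=
  inferInstanceAs (FiniteDimensional K (M →ₗ[K] K))

instance KDual.instIsScalarTowerLeft {M : Type u} [AddCommGroup M] [Module K M] [Module Aᵐᵒᵖ M]
    [IsScalarTower K Aᵐᵒᵖ M] : IsScalarTower K A (KDual K M) :=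
  ⟨fun c a f => LinearMap.ext fun m => by
    change f.toForm (MulOpposite.op (c • a) • m) = c • f.toForm (MulOpposite.op a • m)
    rw [MulOpposite.op_smul, smul_assoc, map_smul]⟩

instance KDual.instIsScalarTowerRight {M : Type u} [AddCommGroup M] [Module K M] [Module A M]
    [IsScalarTower K A M] : IsScalarTower K Aᵐᵒᵖ (KDual K M) :=
  ⟨fun c a f => LinearMap.ext fun m => by
    change f.toForm ((c • a).unop • m) = c • f.toForm (a.unop • m)
    rw [MulOpposite.unop_smul, smul_assoc, map_smul]⟩

/-- A perfect balanced pairing of a right module `X` with a left module `X'`. -/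
structure DualPairing (K A : Type u) [Field K] [Ring A] [Algebra K A]
    (X X' : Type u) [AddCommGroup X] [Module K X] [Module Aᵐᵒᵖ X] [AddCommGroup X'] [Module K X']
    [Module A X'] where
  p : X →ₗ[K] X' →ₗ[K] K
  perf : p.IsPerfPair
  bal : ∀ (a : A) (x : X) (x' : X'), p (MulOpposite.op a • x) x' = p x (a • x')

namespace DualPairing

section

variable (A)

/-- The pairing of a right module with its dual. -/
def self (X : Type u) [AddCommGroup X] [Module K X] [Module Aᵐᵒᵖ X] [IsScalarTower K Aᵐᵒᵖ X]
    [FiniteDimensional K X] : DualPairing K A X (KDual K X) where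
  p := Module.Dual.eval K X
  perf := inferInstanceAs (Module.Dual.eval K X).IsPerfPair
  bal _ _ _ := rfl

/-- The pairing of the dual of a left module with this module. -/
def ofLeft (X : Type u) [AddCommGroup X] [Module K X] [Module A X] [IsScalarTower K A X]
    [FiniteDimensional K X] : DualPairing K A (KDual K X) X where
  p := (LinearMap.id : Module.Dual K X →ₗ[K] Module.Dual K X)
  perf := inferInstanceAs (LinearMap.id : Module.Dual K X →ₗ[K] Module.Dual K X).IsPerfPair
  bal _ _ _ := rfl

end

variable {X X' Y Y' Z Z' : Type u}
  [AddCommGroup X] [Module K X] [Module Aᵐᵒᵖ X] [AddCommGroup X'] [Module K X'] [Module A X']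
  [AddCommGroup Y] [Module K Y] [Module Aᵐᵒᵖ Y] [AddCommGroup Y'] [Module K Y'] [Module A Y']
  [AddCommGroup Z] [Module K Z] [Module Aᵐᵒᵖ Z] [AddCommGroup Z'] [Module K Z'] [Module A Z']
  (pX : DualPairing K A X X') (pY : DualPairing K A Y Y') (pZ : DualPairing K A Z Z')

theorem ext_left {x y : X} (h : ∀ x', pX.p x x' = pX.p y x') : x = y :=
  pX.perf.bijective_left.1 (LinearMap.ext h)

theorem ext_right {x y : X'} (h : ∀ z, pX.p z x = pX.p z y) : x = y :=
  pX.perf.bijective_right.1 (LinearMap.ext h)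

theorem exists_left (μ : X' →ₗ[K] K) : ∃ x, ∀ x', pX.p x x' = μ x' := by
  obtain ⟨x, hx⟩ := pX.perf.bijective_left.2 μ
  exact ⟨x, LinearMap.congr_fun hx⟩

theorem exists_right (μ : X →ₗ[K] K) : ∃ x', ∀ x, pX.p x x' = μ x := by
  obtain ⟨x, hx⟩ := pX.perf.bijective_right.2 μ
  exact ⟨x, LinearMap.congr_fun hx⟩

/-- Two maps are adjoint with respect to the pairings. -/
def IsAdj (k : X →ₗ[Aᵐᵒᵖ] Y) (k' : Y' →ₗ[A] X') : Prop :=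
  ∀ x y', pX.p x (k' y') = pY.p (k x) y'

theorem exists_adj_right [IsScalarTower K Aᵐᵒᵖ X] [IsScalarTower K Aᵐᵒᵖ Y] (k : X →ₗ[Aᵐᵒᵖ] Y) :
    ∃ k' : Y' →ₗ[A] X', IsAdj pX pY k k' := by
  choose k' hk' using fun y' : Y' =>
    pX.exists_right ((pY.p.flip y') ∘ₗ k.restrictScalars K)
  refine ⟨⟨⟨k', fun a b => pX.ext_right fun x => ?_⟩, fun a y' => pX.ext_right fun x => ?_⟩,
    fun x y' => hk' y' x⟩
  · rw [hk', map_add, map_add, hk', hk']; rfl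
  · change pX.p x (k' (a • y')) = pX.p x (a • k' y')
    rw [← pX.bal, hk', hk']
    simp [pY.bal]

theorem exists_adj_left [IsScalarTower K A X'] [IsScalarTower K A Y'] (k' : Y' →ₗ[A] X') :
    ∃ k : X →ₗ[Aᵐᵒᵖ] Y, IsAdj pX pY k k' := by
  choose k hk using fun x : X => pY.exists_left (pX.p x ∘ₗ k'.restrictScalars K)
  refine ⟨⟨⟨k, fun a b => pY.ext_left fun y' => ?_⟩, fun a x => pY.ext_left fun y' => ?_⟩,
    fun x y' => (hk x y').symm⟩
  · rw [hk, map_add, map_add, LinearMap.add_apply, hk, hk]; rfl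
  · change pY.p (k (a • x)) y' = pY.p (a • k x) y'
    conv_rhs => rw [← MulOpposite.op_unop a, pY.bal, hk]
    rw [hk]
    have := pX.bal a.unop x (k' y')
    rw [MulOpposite.op_unop] at this
    simpa using this

variable {pX pY pZ}

theorem IsAdj.comp {k : X →ₗ[Aᵐᵒᵖ] Y} {k' : Y' →ₗ[A] X'} {l : Y →ₗ[Aᵐᵒᵖ] Z} {l' : Z' →ₗ[A] Y'}
    (hk : IsAdj pX pY k k') (hl : IsAdj pY pZ l l') : IsAdj pX pZ (l ∘ₗ k) (k' ∘ₗ l') :=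
  fun x z' => (hk x (l' z')).trans (hl (k x) z')

theorem IsAdj.eq_left {k l : X →ₗ[Aᵐᵒᵖ] Y} {k' : Y' →ₗ[A] X'} (hk : IsAdj pX pY k k')
    (hl : IsAdj pX pY l k') : k = l :=
  LinearMap.ext fun x => pY.ext_left fun y' => by rw [← hk, hl]

theorem IsAdj.eq_right {k : X →ₗ[Aᵐᵒᵖ] Y} {k' l' : Y' →ₗ[A] X'} (hk : IsAdj pX pY k k')
    (hl : IsAdj pX pY k l') : k' = l' :=
  LinearMap.ext fun y' => pX.ext_right fun x => by rw [hk, hl]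

theorem IsAdj.surjective [IsScalarTower K A X'] [IsScalarTower K A Y'] {k : X →ₗ[Aᵐᵒᵖ] Y}
    {k' : Y' →ₗ[A] X'} (hk : IsAdj pX pY k k')
    (h : Function.Injective k') : Function.Surjective k := by
  intro y
  obtain ⟨l, hl⟩ := LinearMap.exists_leftInverse_of_injective (k'.restrictScalars K)
    (LinearMap.ker_eq_bot.2 h)
  have hl' : ∀ y', l (k' y') = y' := LinearMap.congr_fun hl
  obtain ⟨x, hx⟩ := pX.exists_left (pY.p y ∘ₗ l)
  exact ⟨x, pY.ext_left fun y' => by rw [← hk, hx, LinearMap.comp_apply, hl']⟩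

theorem isShortExact_of_isAdj [IsScalarTower K Aᵐᵒᵖ X] [IsScalarTower K Aᵐᵒᵖ Y]
    [IsScalarTower K Aᵐᵒᵖ Z] {f : X →ₗ[Aᵐᵒᵖ] Y} {g : Y →ₗ[Aᵐᵒᵖ] Z}
    {f' : Y' →ₗ[A] X'} {g' : Z' →ₗ[A] Y'} (hf : IsAdj pX pY f f') (hg : IsAdj pY pZ g g')
    (h : IsShortExact f g) : IsShortExact g' f' where
  inj := by
    refine (injective_iff_map_eq_zero _).2 fun z' hz' => pZ.ext_right fun z => ?_
    obtain ⟨y, rfl⟩ := h.surj z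
    rw [← hg, hz', map_zero, map_zero]
  surj := by
    intro x'
    obtain ⟨l, hl⟩ := LinearMap.exists_leftInverse_of_injective (f.restrictScalars K)
      (LinearMap.ker_eq_bot.2 h.inj)
    have hl' : ∀ x, l (f x) = x := LinearMap.congr_fun hl
    obtain ⟨y', hy'⟩ := pY.exists_right (pX.p.flip x' ∘ₗ l)
    exact ⟨y', pX.ext_right fun x => by
      rw [hf, hy', LinearMap.comp_apply, hl', LinearMap.flip_apply]⟩
  exact y' := by
    constructor
    · intro hy'
      obtain ⟨s, hs⟩ := LinearMap.exists_rightInverse_of_surjective (g.restrictScalars K)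
        (LinearMap.range_eq_top.2 h.surj)
      have hs' : ∀ z, g (s z) = z := LinearMap.congr_fun hs
      obtain ⟨z', hz'⟩ := pZ.exists_right (pY.p.flip y' ∘ₗ s)
      refine ⟨z', pY.ext_right fun y => ?_⟩
      rw [hg, hz', LinearMap.comp_apply, LinearMap.flip_apply]
      obtain ⟨x, hx⟩ := (h.exact (s (g y) - y)).1 (by rw [map_sub, hs', sub_self])
      rw [← sub_eq_zero, ← LinearMap.sub_apply, ← map_sub, ← hx, ← hf, hy', map_zero]
    · rintro ⟨z', rfl⟩
      exact pX.ext_right fun x => by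
        rw [hf, hg, h.exact.apply_apply_eq_zero, map_zero, map_zero, LinearMap.zero_apply]

end DualPairing

namespace KDual

section

variable {X Y : Type u} [AddCommGroup X] [Module K X] [Module A X] [IsScalarTower K A X]
  [AddCommGroup Y] [Module K Y] [Module A Y] [IsScalarTower K A Y]

/-- The dual `D(f) : D(Y) → D(X)` of a map `f : X → Y` of left modules. -/
def map (f : X →ₗ[A] Y) : KDual K Y →ₗ[Aᵐᵒᵖ] KDual K X where
  toFun μ := μ.toForm ∘ₗ f.restrictScalars K
  map_add' _ _ := rfl
  map_smul' a μ := LinearMap.ext fun x => by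
    change μ.toForm (a.unop • f x) = μ.toForm (f (a.unop • x))
    rw [map_smul f]

theorem map_surjective {f : X →ₗ[A] Y} (hf : Function.Injective f) :
    Function.Surjective (map (K := K) f) := fun μ => by
  obtain ⟨l, hl⟩ := LinearMap.exists_leftInverse_of_injective (f.restrictScalars K)
    (LinearMap.ker_eq_bot.2 hf)
  exact ⟨μ.toForm ∘ₗ l, LinearMap.ext fun x => congrArg μ.toForm (LinearMap.congr_fun hl x)⟩

end

section

variable {X P : Type u} [AddCommGroup X] [Module K X] [Module A X] [IsScalarTower K A X]
  [AddCommGroup P] [Module K P] [Module Aᵐᵒᵖ P] [IsScalarTower K Aᵐᵒᵖ P]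

/-- The map `P → D(X)` corresponding to `g : X → D(P)`: both encode the same balanced bilinear
form on `P × X`. -/
def swap (g : X →ₗ[A] KDual K P) : P →ₗ[Aᵐᵒᵖ] KDual K X where
  toFun p :=
    { toFun := fun x => (g x).toForm p
      map_add' := fun x y => by rw [map_add]; rfl
      map_smul' := fun c x => by rw [← algebraMap_smul A c x, map_smul, algebraMap_smul]; rfl }
  map_add' p q := LinearMap.ext fun x => map_add (g x).toForm p q
  map_smul' a p := LinearMap.ext fun x => by
    change (g x).toForm (a • p) = (g (a.unop • x)).toForm p
    rw [map_smul g]; rfl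

/-- The inverse correspondence to `KDual.swap`. -/
def unswap (h : P →ₗ[Aᵐᵒᵖ] KDual K X) : X →ₗ[A] KDual K P where
  toFun x :=
    { toFun := fun p => (h p).toForm x
      map_add' := fun p q => by rw [map_add]; rfl
      map_smul' := fun c p => by rw [← algebraMap_smul Aᵐᵒᵖ c p, map_smul, algebraMap_smul]; rfl }
  map_add' x y := LinearMap.ext fun p => map_add (h p).toForm x y
  map_smul' a x := LinearMap.ext fun p => by
    change (h p).toForm (a • x) = (h (MulOpposite.op a • p)).toForm x
    rw [map_smul h]; rfl

end

theorem injective_of_projective (P : Type u) [AddCommGroup P] [Module K P] [Module Aᵐᵒᵖ P]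
    [IsScalarTower K Aᵐᵒᵖ P] [Module.Projective Aᵐᵒᵖ P] : Module.Injective A (KDual K P) :=
  injective_of_forall_extend (K := K) fun _ _ _ _ _ _ _ _ _ _ f hf g => by
    obtain ⟨h, hh⟩ := Module.projective_lifting_property (map f) (swap g) (map_surjective hf)
    exact ⟨unswap h, fun x => LinearMap.ext fun p =>
      congrArg (fun μ => μ.toForm x) (LinearMap.congr_fun hh p)⟩

end KDual

section ExtDuality

variable {X X' Y Y' : Type u}
  [AddCommGroup X] [Module K X] [Module Aᵐᵒᵖ X] [AddCommGroup X'] [Module K X'] [Module A X']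
  [AddCommGroup Y] [Module K Y] [Module Aᵐᵒᵖ Y] [AddCommGroup Y'] [Module K Y'] [Module A Y']
  [IsScalarTower K Aᵐᵒᵖ X] [IsScalarTower K Aᵐᵒᵖ Y] [IsScalarTower K A Y']

theorem extVanishesAt_one_iff_dual {P P' Z Z' : Type u}
    [AddCommGroup P] [Module K P] [Module Aᵐᵒᵖ P] [AddCommGroup P'] [Module K P'] [Module A P']
    [AddCommGroup Z] [Module K Z] [Module Aᵐᵒᵖ Z] [AddCommGroup Z'] [Module K Z'] [Module A Z']
    [IsScalarTower K Aᵐᵒᵖ P] [IsScalarTower K Aᵐᵒᵖ Z] [IsScalarTower K A P'] [IsScalarTower K A Z']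
    [Module.Projective Aᵐᵒᵖ P] [Module.Injective A P']
    {pX : DualPairing K A X X'} (pY : DualPairing K A Y Y')
    {pP : DualPairing K A P P'} {pZ : DualPairing K A Z Z'}
    {f : Z →ₗ[Aᵐᵒᵖ] P} {g : P →ₗ[Aᵐᵒᵖ] X} {f' : P' →ₗ[A] Z'} {g' : X' →ₗ[A] P'}
    (hs : IsShortExact f g) (hf : DualPairing.IsAdj pZ pP f f')
    (hg : DualPairing.IsAdj pP pX g g') :
    ExtVanishesAt Aᵐᵒᵖ X Y 1 ↔ ExtVanishesAt A Y' X' 1 := by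
  have hs' := DualPairing.isShortExact_of_isAdj hf hg hs
  constructor
  · intro h
    refine hs'.extVanishesAt_one_of_lift (.of_injective le_rfl) fun k' => ?_
    obtain ⟨k, hk⟩ := pZ.exists_adj_left pY k'
    obtain ⟨l, rfl⟩ := hs.exists_extend h k
    obtain ⟨l', hl'⟩ := pP.exists_adj_right pY l
    exact ⟨l', (hf.comp hl').eq_right hk⟩
  · intro h
    refine hs.extVanishesAt_one_of_extend (.of_projective le_rfl) fun k => ?_
    obtain ⟨k', hk⟩ := pZ.exists_adj_right pY k
    obtain ⟨l', rfl⟩ := hs'.exists_lift h k'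
    obtain ⟨l, hl⟩ := pP.exists_adj_left pY l'
    exact ⟨l, (hf.comp hl).eq_left hk⟩

variable [FiniteDimensional K A] [FiniteDimensional K X]

theorem extVanishesAt_iff_dual (pX : DualPairing K A X X') (pY : DualPairing K A Y Y') (i : ℕ) :
    ExtVanishesAt Aᵐᵒᵖ X Y (i + 1) ↔ ExtVanishesAt A Y' X' (i + 1) := by
  induction i using Nat.strong_induction_on generalizing X X' with
  | _ i ih =>
    have : Module.Finite Aᵐᵒᵖ X := Module.Finite.of_restrictScalars_finite K Aᵐᵒᵖ X
    obtain ⟨n, π, hπ⟩ := Module.Finite.exists_fin' Aᵐᵒᵖ X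
    have hs := IsShortExact.ker_subtype π hπ
    have := finiteDimensional_submodule (K := K) (LinearMap.ker π)
    let pP := DualPairing.self A (K := K) (Fin n → Aᵐᵒᵖ)
    let pZ := DualPairing.self A (K := K) (LinearMap.ker π)
    obtain ⟨f', hf⟩ := pZ.exists_adj_right pP (LinearMap.ker π).subtype
    obtain ⟨g', hg⟩ := pP.exists_adj_right pX π
    have hs' := DualPairing.isShortExact_of_isAdj hf hg hs
    have := KDual.injective_of_projective (K := K) (A := A) (Fin n → Aᵐᵒᵖ)
    obtain _ | i := i
    · exact extVanishesAt_one_iff_dual pY hs hf hg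
    · have hZ := ih i i.lt_succ_self pZ
      constructor
      · intro h
        exact hs'.extVanishesAt_covariant₁
          (hZ.1 (hs.extVanishesAt_contravariant₁ (.of_projective (by lia)) h))
          (.of_injective (by lia))
      · intro h
        exact hs.extVanishesAt_contravariant₃
          (hZ.2 (hs'.extVanishesAt_covariant₃ (.of_injective (by lia)) h))
          (.of_projective (by lia))

theorem extVanishes_iff_dual (pX : DualPairing K A X X') (pY : DualPairing K A Y Y') :
    ExtVanishes Aᵐᵒᵖ X Y ↔ ExtVanishes A Y' X' := by
  refine forall₂_congr fun i hi => ?_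
  obtain ⟨i, rfl⟩ := Nat.exists_eq_add_of_le' hi
  exact extVanishesAt_iff_dual pX pY i

end ExtDuality

end Duality

section Bimodule

/-- The `(R, S)`-bimodule `A` is free of rank one over both `R` and `S`, with the common generator
`u`. For a ring `A` this treats the right and the left regular module symmetrically: `(R, S)` is
`(Aᵐᵒᵖ, A)` or `(A, Aᵐᵒᵖ)`, and `u = 1`. -/
structure IsRegularBimodule (R S : Type u) [Ring R] [Ring S] (A : Type u) [AddCommGroup A]
    [Module R A] [Module S A] (u : A) : Prop where
  left : Function.Bijective fun r : R => r • u
  right : Function.Bijective fun s : S => s • u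

variable {R S : Type u} [Ring R] [Ring S] {A : Type u} [AddCommGroup A] [Module R A] [Module S A]

theorem IsRegularBimodule.symm {u : A} (h : IsRegularBimodule R S A u) :
    IsRegularBimodule S R A u :=
  ⟨h.right, h.left⟩

variable [SMulCommClass R S A] {u : A} (h : IsRegularBimodule R S A u)
  (P : Type u) [AddCommGroup P] [Module R P]

/-- The isomorphism `Hom_R(R ^ n, A) ≃ S ^ n` given by the generator of `A`. -/
def dualFreeEquiv (n : ℕ) : ((Fin n → R) →ₗ[R] A) ≃ₗ[S] (Fin n → S) :=
  (LinearEquiv.piRing R A (Fin n) S).trans (LinearEquiv.piCongrRight fun _ =>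
    (LinearEquiv.ofBijective (LinearMap.toSpanSingleton S A u) h.right).symm)

include h

theorem exists_retract_dual [Module.Finite R P] [Module.Projective R P] :
    ∃ (n : ℕ) (a : (P →ₗ[R] A) →ₗ[S] (Fin n → S)) (b : (Fin n → S) →ₗ[S] (P →ₗ[R] A)),
      b ∘ₗ a = LinearMap.id := by
  obtain ⟨n, p, s, -, -, hps⟩ := Module.Finite.exists_comp_eq_id_of_projective R P
  refine ⟨n, (dualFreeEquiv h n).toLinearMap ∘ₗ LinearMap.lcomp S A p,
    LinearMap.lcomp S A s ∘ₗ (dualFreeEquiv h n).symm.toLinearMap, ?_⟩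
  ext φ x
  simpa using congrArg φ (LinearMap.congr_fun hps x)

theorem projective_dual [Module.Finite R P] [Module.Projective R P] :
    Module.Projective S (P →ₗ[R] A) := by
  obtain ⟨n, a, b, hab⟩ := exists_retract_dual h P
  exact Module.Projective.of_split a b hab

theorem finite_dual_of_projective [Module.Finite R P] [Module.Projective R P] :
    Module.Finite S (P →ₗ[R] A) := by
  obtain ⟨n, a, b, hab⟩ := exists_retract_dual h P
  exact Module.Finite.of_surjective b fun x => ⟨a x, LinearMap.congr_fun hab x⟩

theorem finite_dual [IsNoetherianRing S] [Module.Finite R P] : Module.Finite S (P →ₗ[R] A) := by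
  obtain ⟨n, π, hπ⟩ := Module.Finite.exists_fin' R P
  have := finite_dual_of_projective h (Fin n → R)
  exact Module.Finite.of_injective (LinearMap.lcomp S A π)
    (LinearMap.lcomp_injective_of_surjective π hπ)

theorem exists_eval_free (n : ℕ) (Φ : ((Fin n → R) →ₗ[R] A) →ₗ[S] A) : ∃ x, ∀ φ, Φ φ = φ x := by
  choose x hx using fun i : Fin n =>
    h.left.2 (Φ (LinearMap.toSpanSingleton R A u ∘ₗ LinearMap.proj i))
  refine ⟨x, fun φ => ?_⟩
  choose s hs using fun i : Fin n => h.right.2 (φ (Pi.single i 1))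
  have hφ : φ = ∑ i, s i • (LinearMap.toSpanSingleton R A u ∘ₗ LinearMap.proj i) := by
    refine LinearMap.pi_ext' fun i => LinearMap.ext_ring ?_
    simp only [LinearMap.comp_apply, LinearMap.coe_single, ← hs i, LinearMap.sum_apply,
      LinearMap.smul_apply, LinearMap.proj_apply, LinearMap.toSpanSingleton_apply]
    rw [Finset.sum_eq_single i (fun j _ hj => ?_) (by simp)]
    · simp
    · rw [Pi.single_eq_of_ne hj, zero_smul, smul_zero]
  rw [hφ, map_sum, LinearMap.sum_apply]
  refine Finset.sum_congr rfl fun i _ => ?_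
  rw [map_smul, ← hx]
  rfl

theorem exists_eval_projective [Module.Finite R P] [Module.Projective R P]
    (Φ : (P →ₗ[R] A) →ₗ[S] A) : ∃ x, ∀ φ, Φ φ = φ x := by
  obtain ⟨n, p, s, -, -, hps⟩ := Module.Finite.exists_comp_eq_id_of_projective R P
  obtain ⟨x, hx⟩ := exists_eval_free h n (Φ ∘ₗ LinearMap.lcomp S A s)
  refine ⟨p x, fun φ => ?_⟩
  have hφ : (φ ∘ₗ p) ∘ₗ s = φ := by rw [LinearMap.comp_assoc, hps, LinearMap.comp_id]
  calc Φ φ = Φ ((φ ∘ₗ p) ∘ₗ s) := by rw [hφ]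
    _ = φ (p x) := hx (φ ∘ₗ p)

omit [SMulCommClass R S A] in
variable {P} in
theorem eq_of_forall_dual [Module.Projective R P] {x y : P} (hxy : ∀ φ : P →ₗ[R] A, φ x = φ y) :
    x = y := by
  refine sub_eq_zero.1 ((Module.forall_dual_apply_eq_zero_iff R (x - y)).1 fun ψ => h.left.1 ?_)
  have := hxy (LinearMap.toSpanSingleton R A u ∘ₗ ψ)
  simp only [LinearMap.comp_apply, LinearMap.toSpanSingleton_apply] at this
  simp [sub_smul, this]

end Bimodule

section Transpose

variable {R S : Type u} [Ring R] [Ring S] {A : Type u} [AddCommGroup A] [Module R A] [Module S A]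
  [SMulCommClass R S A] {u : A} {P₁ P₀ M : Type u} [AddCommGroup P₁] [Module R P₁]
  [AddCommGroup P₀] [Module R P₀] [AddCommGroup M] [Module R M] {f : P₁ →ₗ[R] P₀}
  {p : P₀ →ₗ[R] M}

variable (S A) in
theorem isShortExact_lcomp (hfp : Function.Exact f p) (hp : Function.Surjective p) :
    IsShortExact (LinearMap.lcomp S A p) (LinearMap.lcomp S A f).rangeRestrict where
  inj := LinearMap.lcomp_injective_of_surjective p hp
  exact φ := by
    rw [← Subtype.coe_inj]
    constructor
    · exact fun hφ => exists_desc_of_exact hfp hp φ hφ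
    · rintro ⟨ψ, rfl⟩
      ext y
      simp [hfp.apply_apply_eq_zero]
  surj := LinearMap.surjective_rangeRestrict _

variable (h : IsRegularBimodule R S A u) [Module.Finite R P₁] [Module.Projective R P₁]

include h

theorem extVanishesAt_range_lcomp {i : ℕ} (hi : 1 ≤ i)
    (hT : ExtVanishes S (Transpose R S A f) A) :
    ExtVanishesAt S (LinearMap.range (LinearMap.lcomp S A f)) A i := by
  have := projective_dual h P₁
  exact (IsShortExact.subtype_mkQ _).extVanishesAt_contravariant₁ (.of_projective hi)
    (hT (i + 1) (by lia))

variable [Module.Projective R P₀]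

theorem exists_eval_coker [Module.Finite R P₀] (hfp : Function.Exact f p)
    (hp : Function.Surjective p) (hT : ExtVanishes S (Transpose R S A f) A)
    (Φ : (M →ₗ[R] A) →ₗ[S] A) :
    ∃ m, ∀ φ, Φ φ = φ m := by
  obtain ⟨Φ', hΦ'⟩ := (isShortExact_lcomp S A hfp hp).exists_extend
    (extVanishesAt_range_lcomp h le_rfl hT) Φ
  obtain ⟨x, hx⟩ := exists_eval_projective h P₀ Φ'
  exact ⟨p x, fun φ => by rw [← hΦ']; exact hx _⟩

theorem eq_zero_of_forall_dual_coker (hfp : Function.Exact f p) (hp : Function.Surjective p)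
    (hT : ExtVanishes S (Transpose R S A f) A) {m : M} (hm : ∀ φ : M →ₗ[R] A, φ m = 0) :
    m = 0 := by
  obtain ⟨x, rfl⟩ := hp m
  let evalAt : (P₀ →ₗ[R] A) →ₗ[S] A := ⟨⟨fun φ => φ x, fun _ _ => rfl⟩, fun _ _ => rfl⟩
  obtain ⟨e, he⟩ := (isShortExact_lcomp S A hfp hp).exists_desc evalAt (LinearMap.ext hm)
  obtain ⟨Φ, hΦ⟩ := (IsShortExact.subtype_mkQ _).exists_extend (hT 1 le_rfl) e
  obtain ⟨y, hy⟩ := exists_eval_projective h P₁ Φ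
  have hxy : x = f y := eq_of_forall_dual h fun φ => by
    calc φ x = e ((LinearMap.lcomp S A f).rangeRestrict φ) := (LinearMap.congr_fun he φ).symm
      _ = Φ (φ ∘ₗ f) := (LinearMap.congr_fun hΦ _).symm
      _ = φ (f y) := hy _
  rw [hxy, hfp.apply_apply_eq_zero]

end Transpose

section Copresentation

variable {R S : Type u} [Ring R] [Ring S] {A : Type u} [AddCommGroup A] [Module R A] [Module S A]
  [SMulCommClass R S A] {u : A} (h : IsRegularBimodule R S A u) {M : Type u} [AddCommGroup M]
  [Module R M]

include h

omit [SMulCommClass R S A] in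
theorem exists_copresentation_dual [SMulCommClass S R A] [IsNoetherianRing S] (N : Type u)
    [AddCommGroup N] [Module S N] [Module.Finite S N] :
    ∃ (P P' : ModuleCat.{u} R) (k : (N →ₗ[S] A) →ₗ[R] P) (l : P →ₗ[R] P'),
      Module.Finite R P ∧ Module.Projective R P ∧ Module.Finite R P' ∧ Module.Projective R P' ∧
      Function.Injective k ∧ Function.Exact k l := by
  obtain ⟨a, π, hπ⟩ := Module.Finite.exists_fin' S N
  obtain ⟨b, ρ, hρ⟩ := Module.Finite.exists_fin' S (LinearMap.ker π)
  have hρπ : Function.Exact ((LinearMap.ker π).subtype ∘ₗ ρ) π := by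
    rw [LinearMap.exact_iff, LinearMap.range_comp, LinearMap.range_eq_top.2 hρ,
      Submodule.map_subtype_top]
  have hs := isShortExact_lcomp R A hρπ hπ
  refine ⟨.of R ((Fin a → S) →ₗ[S] A), .of R ((Fin b → S) →ₗ[S] A), LinearMap.lcomp R A π,
    LinearMap.lcomp R A ((LinearMap.ker π).subtype ∘ₗ ρ), finite_dual_of_projective h.symm _,
    projective_dual h.symm _, finite_dual_of_projective h.symm _, projective_dual h.symm _, hs.inj,
    fun φ => ?_⟩
  rw [← hs.exact φ, ← Subtype.coe_inj]
  rfl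

namespace GorensteinProjectiveAux

theorem extVanishes_dual (hM : GorensteinProjectiveAux R S A M) :
    ExtVanishes S (M →ₗ[R] A) A := by
  obtain ⟨-, P₁, P₀, f, p, _, _, _, _, hfp, hp, hT⟩ := hM
  have := projective_dual h P₀
  exact fun i hi => (isShortExact_lcomp S A hfp hp).extVanishesAt_contravariant₁
    (.of_projective hi) (extVanishesAt_range_lcomp h (by lia) hT)

theorem nonempty_equiv_bidual [SMulCommClass S R A] (hM : GorensteinProjectiveAux R S A M) :
    Nonempty (M ≃ₗ[R] ((M →ₗ[R] A) →ₗ[S] A)) := by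
  obtain ⟨-, P₁, P₀, f, p, _, _, _, _, hfp, hp, hT⟩ := hM
  let ev : M →ₗ[R] (M →ₗ[R] A) →ₗ[S] A := LinearMap.flip LinearMap.id
  refine ⟨.ofBijective ev ⟨(injective_iff_map_eq_zero ev).2 fun m hm => ?_, fun Φ => ?_⟩⟩
  · exact eq_zero_of_forall_dual_coker h hfp hp hT (LinearMap.congr_fun hm)
  · obtain ⟨m, hm⟩ := exists_eval_coker h hfp hp hT Φ
    exact ⟨m, LinearMap.ext fun φ => (hm φ).symm⟩

theorem exists_copresentation [IsNoetherianRing S] (hM : GorensteinProjectiveAux R S A M) :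
    ∃ (P P' : ModuleCat.{u} R) (k : M →ₗ[R] P) (l : P →ₗ[R] P'),
      Module.Finite R P ∧ Module.Projective R P ∧ Module.Finite R P' ∧ Module.Projective R P' ∧
      Function.Injective k ∧ Function.Exact k l := by
  have := SMulCommClass.symm R S A
  obtain ⟨e⟩ := hM.nonempty_equiv_bidual h
  have : Module.Finite R M := by
    obtain ⟨-, -, P₀, -, p, -, -, _, -, -, hp, -⟩ := hM
    exact Module.Finite.of_surjective p hp
  have := finite_dual h M
  obtain ⟨P, P', k, l, hP, hP₁, hP', hP'₁, hk, hkl⟩ := exists_copresentation_dual h (M →ₗ[R] A)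
  refine ⟨P, P', k ∘ₗ e.toLinearMap, l, hP, hP₁, hP', hP'₁, hk.comp e.injective, ?_⟩
  rwa [LinearMap.exact_iff, LinearEquiv.range_comp, ← LinearMap.exact_iff]

end GorensteinProjectiveAux

end Copresentation

theorem isRegularBimodule_right (A : Type u) [Ring A] : IsRegularBimodule Aᵐᵒᵖ A A (1 : A) where
  left := by
    convert unop_bijective (α := A) using 1
    ext r; simp
  right := by
    convert Function.bijective_id (α := A) using 1
    ext r; simp

theorem isRegularBimodule_left (A : Type u) [Ring A] : IsRegularBimodule A Aᵐᵒᵖ A (1 : A) :=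
  (isRegularBimodule_right A).symm

section InfiniteDominantDimension

variable {K : Type u} [Field K] {A : Type u} [Ring A] [Algebra K A]

variable (K A) in
/-- The dual of the regular left module, as the dual attached to `Aᵐᵒᵖ`. -/
def regularDualRight : RegularDual K Aᵐᵒᵖ (KDual K A) where
  ev := (((opLinearEquiv K : A ≃ₗ[K] Aᵐᵒᵖ).arrowCongr (LinearEquiv.refl K K)).toAddEquiv :
    (A →ₗ[K] K) ≃+ (Aᵐᵒᵖ →ₗ[K] K))
  ev_smul _ _ _ := rfl

variable (K A) in
/-- The dual of the regular right module, as the dual attached to `A`. -/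
def regularDualLeft : RegularDual K A (KDual K A) where
  ev := AddEquiv.refl (A →ₗ[K] K)
  ev_smul _ _ _ := rfl

section Nakayama

variable [FiniteDimensional K A] {D : GendoCore K A} {M N : Type u}
  [AddCommGroup M] [Module K M] [Module Aᵐᵒᵖ M] [AddCommGroup N] [Module K N] [Module A N]
  [IsScalarTower K Aᵐᵒᵖ M] [IsScalarTower K A N]

theorem nonempty_equiv_dual_right (p : DualPairing K A M N)
    (h : D.op.EtaBij (regularDualRight K A) M) : Nonempty (M ≃ₗ[Aᵐᵒᵖ] (N →ₗ[A] A)) := by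
  let q := DualPairing.ofLeft A (K := K) A
  choose Ψ hΨ using fun m : M => q.exists_adj_right p (D.op.eta (regularDualRight K A) m)
  let L : M →ₗ[Aᵐᵒᵖ] (N →ₗ[A] A) :=
    { toFun := Ψ
      map_add' := fun m m' => (hΨ (m + m')).eq_right fun f n => by
        rw [LinearMap.add_apply, map_add, hΨ, hΨ, map_add, LinearMap.add_apply, map_add,
          LinearMap.add_apply]
      map_smul' := fun a m => (hΨ (a • m)).eq_right fun f n => by
        have htheta : D.op.theta (regularDualRight K A) (a.unop • f) =
            D.op.theta (regularDualRight K A) f * a := D.op.theta_eq_mul _ fun _ => rfl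
        have hΨx := hΨ m (a.unop • f) n
        rw [GendoCore.eta_apply, htheta, mul_smul] at hΨx
        exact hΨx }
  refine ⟨LinearEquiv.ofBijective L ⟨fun m m' hm => h.1 ?_, fun k => ?_⟩⟩
  · have hm' : Ψ m = Ψ m' := hm
    exact (hΨ m).eq_left (hm' ▸ hΨ m')
  · obtain ⟨l, hl⟩ := q.exists_adj_left p k
    obtain ⟨m, rfl⟩ := h.2 l
    exact ⟨m, (hΨ m).eq_right hl⟩

theorem nonempty_equiv_dual_left (p : DualPairing K A M N)
    (h : D.EtaBij (regularDualLeft K A) N) : Nonempty (N ≃ₗ[A] (M →ₗ[Aᵐᵒᵖ] A)) := by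
  let q := DualPairing.self A (K := K) A
  choose Ψ hΨ using fun n : N => p.exists_adj_left q (D.eta (regularDualLeft K A) n)
  let L : N →ₗ[A] (M →ₗ[Aᵐᵒᵖ] A) :=
    { toFun := Ψ
      map_add' := fun m m' => (hΨ (m + m')).eq_left fun x f => by
        rw [LinearMap.add_apply, map_add, map_add, LinearMap.add_apply, LinearMap.add_apply,
          map_add, hΨ, hΨ]
      map_smul' := fun a n => (hΨ (a • n)).eq_left fun x f => by
        have htheta : D.theta (regularDualLeft K A) (MulOpposite.op a • f) =
            D.theta (regularDualLeft K A) f * a := D.theta_eq_mul _ fun _ => rfl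
        have hΨx := hΨ n x (MulOpposite.op a • f)
        rw [GendoCore.eta_apply, htheta, mul_smul] at hΨx
        exact hΨx }
  refine ⟨LinearEquiv.ofBijective L ⟨fun m m' hm => h.1 ?_, fun k => ?_⟩⟩
  · have hm' : Ψ m = Ψ m' := hm
    exact (hΨ m).eq_right (hm' ▸ hΨ m')
  · obtain ⟨l, hl⟩ := p.exists_adj_right q k
    obtain ⟨m, rfl⟩ := h.2 l
    exact ⟨m, (hΨ m).eq_left hl⟩

end Nakayama

section TFAE

variable [FiniteDimensional K A] (D : GendoCore K A) (hnearly : IsNearlyGorenstein K A)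
  (M : Type u) [AddCommGroup M] [Module K M] [Module Aᵐᵒᵖ M] [IsScalarTower K Aᵐᵒᵖ M]
  [FiniteDimensional K M]

theorem domDim_right_eq_top_iff : domDim Aᵐᵒᵖ M = ⊤ ↔
    D.op.EtaBij (regularDualRight K A) M ∧ ExtVanishes Aᵐᵒᵖ (KDual K A) M := by
  have : Module.Finite Aᵐᵒᵖ M := Module.Finite.of_restrictScalars_finite K Aᵐᵒᵖ M
  exact GendoCore.domDim_eq_top_iff M

theorem codomDim_eq_top_iff : codomDim K A M = ⊤ ↔
    D.EtaBij (regularDualLeft K A) (KDual K M) ∧ ExtVanishes A (KDual K A) (KDual K M) := by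
  have : Module.Finite A (KDual K M) := Module.Finite.of_restrictScalars_finite K A _
  exact GendoCore.domDim_eq_top_iff (KDual K M)

theorem extVanishes_regular_iff :
    ExtVanishes Aᵐᵒᵖ M A ↔ ExtVanishes A (KDual K A) (KDual K M) :=
  extVanishes_iff_dual (DualPairing.self A M) (DualPairing.self A A)

theorem extVanishes_dual_regular_iff :
    ExtVanishes Aᵐᵒᵖ (KDual K A) M ↔ ExtVanishes A (KDual K M) A :=
  extVanishes_iff_dual (DualPairing.ofLeft A A) (DualPairing.self A M)

include D in
theorem IsGorensteinProjective.etaBij {M : Type u} [AddCommGroup M] [Module Aᵐᵒᵖ M]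
    (h : IsGorensteinProjective A M) : D.op.EtaBij (regularDualRight K A) M := by
  have := IsNoetherianRing.of_finite K A
  obtain ⟨P, P', k, l, _, _, _, _, hk, hkl⟩ :=
    GorensteinProjectiveAux.exists_copresentation (isRegularBimodule_right A) h
  exact GendoCore.EtaBij.of_exact hk hkl (D.op.etaBij_of_projective _)
    (D.op.etaBij_of_projective _).etaInj

include D in
theorem GorensteinProjectiveAux.etaBij_left {N : Type u} [AddCommGroup N] [Module A N]
    (h : GorensteinProjectiveAux A Aᵐᵒᵖ A N) : D.EtaBij (regularDualLeft K A) N := by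
  have := IsNoetherianRing.of_finite K Aᵐᵒᵖ
  obtain ⟨P, P', k, l, _, _, _, _, hk, hkl⟩ :=
    GorensteinProjectiveAux.exists_copresentation (isRegularBimodule_left A) h
  exact GendoCore.EtaBij.of_exact hk hkl (D.etaBij_of_projective _)
    (D.etaBij_of_projective _).etaInj

include D hnearly in
theorem tfae_domDim_eq_top : List.TFAE [
    domDim Aᵐᵒᵖ M = ⊤,
    IsGorensteinProjectiveInjective K A M ∧ Nonempty (NakayamaInv K A M ≃ₗ[Aᵐᵒᵖ] M),
    IsGorensteinProjectiveInjective K A M,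
    codomDim K A M = ⊤] := by
  obtain ⟨hinj, hproj⟩ := hnearly M
  tfae_have 1 → 2 := by
    intro h
    obtain ⟨heta, hext⟩ := (domDim_right_eq_top_iff D M).1 h
    obtain ⟨ψ⟩ := nonempty_equiv_dual_right (DualPairing.self A M) heta
    have hGI := hinj.2 hext
    exact ⟨⟨hproj.2 ((GorensteinProjectiveAux.extVanishes_dual (isRegularBimodule_left A)
      hGI).congr_left ψ.symm), hGI⟩, ⟨ψ.symm⟩⟩
  tfae_have 2 → 3 := fun h => h.1
  tfae_have 3 → 1 := fun h =>
    (domDim_right_eq_top_iff D M).2 ⟨h.1.etaBij D, hinj.1 h.2⟩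
  tfae_have 3 → 4 := fun h =>
    (codomDim_eq_top_iff D M).2 ⟨GorensteinProjectiveAux.etaBij_left D h.2,
      (extVanishes_regular_iff M).1 (hproj.1 h.1)⟩
  tfae_have 4 → 3 := by
    intro h
    obtain ⟨heta, hext⟩ := (codomDim_eq_top_iff D M).1 h
    have hGP := hproj.2 ((extVanishes_regular_iff M).2 hext)
    obtain ⟨ψ⟩ := nonempty_equiv_dual_left (DualPairing.self A M) heta
    exact ⟨hGP, hinj.2 ((extVanishes_dual_regular_iff M).2
      ((GorensteinProjectiveAux.extVanishes_dual (isRegularBimodule_right A) hGP).congr_left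
        ψ.symm))⟩
  tfae_finish

end TFAE

end InfiniteDominantDimension

section Trace

variable {K : Type u} [Field K] {R : Type u} [Ring R] [Algebra K R]

namespace GendoCore

variable (D : GendoCore K R)

/-- The module `(Re)ⁿ`. -/
abbrev QPow (n : ℕ) : Type u := Fin n → leftIdeal D.e

instance (n : ℕ) : Module.Injective R (D.QPow n) :=
  have := D.leftIdeal_injective
  inferInstance

/-- The generator `e` of the `i`-th summand of `(Re)ⁿ`. -/
def gen {n : ℕ} (i : Fin n) : D.QPow n := Pi.single i ⟨D.e, ⟨D.e, D.idem⟩⟩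

theorem e_smul_gen {n : ℕ} (i : Fin n) : D.e • D.gen i = D.gen i := by
  rw [gen, ← Pi.single_smul]
  congr 1
  exact Subtype.ext D.idem

theorem sum_smul_gen {n : ℕ} (y : D.QPow n) : ∑ i, (y i : R) • D.gen i = y := by
  conv_rhs => rw [← Finset.univ_sum_single y]
  refine Finset.sum_congr rfl fun i _ => ?_
  rw [gen, ← Pi.single_smul]
  congr 1
  exact Subtype.ext (D.mul_e (y i))

variable {D} in
theorem map_eq_sum {n : ℕ} {Z : Type u} [AddCommGroup Z] [Module R Z] (a : D.QPow n →ₗ[R] Z)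
    (y : D.QPow n) : a y = ∑ i, (y i : R) • a (D.gen i) := by
  conv_lhs => rw [← D.sum_smul_gen y, map_sum]
  simp only [map_smul]

theorem e_mul_map_gen {n m : ℕ} (c : D.QPow n →ₗ[R] D.QPow m) (i : Fin n) (j : Fin m) :
    D.e * (c (D.gen i) j : R) = c (D.gen i) j := by
  conv_rhs => rw [← D.e_smul_gen, map_smul]
  rfl

theorem map_gen_eq {n m : ℕ} (c : D.QPow n →ₗ[R] D.QPow m) (i : Fin n) (j : Fin m) :
    D.e * (c (D.gen i) j : R) * D.e = c (D.gen i) j := by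
  rw [e_mul_map_gen, D.mul_e]

/-- The trace of an endomorphism of `(Re)ⁿ`, with values in `K` through the trace form of `eRe`. -/
def trace {n : ℕ} (h : D.QPow n →ₗ[R] D.QPow n) : K := ∑ i, D.tr (h (D.gen i) i : R)

theorem trace_comp_comm {n m : ℕ} (c : D.QPow n →ₗ[R] D.QPow m) (d : D.QPow m →ₗ[R] D.QPow n) :
    D.trace (d ∘ₗ c) = D.trace (c ∘ₗ d) := by
  have trace_comp : ∀ {n m : ℕ} (c : D.QPow n →ₗ[R] D.QPow m) (d : D.QPow m →ₗ[R] D.QPow n),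
      D.trace (d ∘ₗ c) = ∑ i, ∑ j, D.tr ((c (D.gen i) j : R) * d (D.gen j) i) := by
    intro n m c d
    refine Finset.sum_congr rfl fun i _ => ?_
    rw [LinearMap.comp_apply, map_eq_sum d, Finset.sum_apply, AddSubmonoidClass.coe_finsetSum,
      map_sum]
    rfl
  rw [trace_comp, trace_comp, Finset.sum_comm]
  refine Finset.sum_congr rfl fun j _ => Finset.sum_congr rfl fun i _ => ?_
  have := D.tr_comm (c (D.gen i) j) (d (D.gen j) i)
  have h1 : D.e * (c (D.gen i) j : R) * D.e * d (D.gen j) i * D.e =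
      c (D.gen i) j * d (D.gen j) i := by
    rw [map_gen_eq, mul_assoc, D.mul_e]
  have h2 : D.e * (d (D.gen j) i : R) * D.e * c (D.gen i) j * D.e =
      d (D.gen j) i * c (D.gen i) j := by
    rw [map_gen_eq, mul_assoc, D.mul_e]
  rwa [h1, h2] at this

variable {Z : Type u} [AddCommGroup Z] [Module R Z] [Module K Z] [IsScalarTower K R Z]

/-- The map `(Re)ⁿ → Z`, `y ↦ yᵢ z`. -/
def coordMap {n : ℕ} (i : Fin n) : Z →ₗ[K] (D.QPow n →ₗ[R] Z) where
  toFun z := LinearMap.toSpanSingleton R Z z ∘ₗ (leftIdeal D.e).subtype ∘ₗ LinearMap.proj i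
  map_add' z z' := LinearMap.ext fun y => smul_add (y i : R) z z'
  map_smul' c z := LinearMap.ext fun y => by
    change (y i : R) • c • z = c • (y i : R) • z
    rw [← algebraMap_smul R c z, ← algebraMap_smul R c ((y i : R) • z), smul_smul, smul_smul,
      Algebra.commutes]

theorem coordMap_apply {n : ℕ} (i : Fin n) (z : Z) (y : D.QPow n) :
    D.coordMap (K := K) i z y = (y i : R) • z := rfl

theorem eq_sum_coordMap {n : ℕ} (a : D.QPow n →ₗ[R] Z) :
    a = ∑ i, D.coordMap (K := K) i (a (D.gen i)) := by
  refine LinearMap.ext fun y => ?_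
  rw [map_eq_sum a, LinearMap.sum_apply]
  rfl

/-- The form on `Hom(Qⁿ, Z)` attached to a map `Z → Qⁿ`. -/
def traceAgainst {n : ℕ} (b : Z →ₗ[R] D.QPow n) : (D.QPow n →ₗ[R] Z) →ₗ[K] K where
  toFun a := D.trace (b ∘ₗ a)
  map_add' a a' := by simp [trace, Finset.sum_add_distrib]
  map_smul' c a := by
    simp only [trace, LinearMap.comp_apply, LinearMap.smul_apply, RingHom.id_apply,
      Finset.smul_sum, ← map_smul]
    refine Finset.sum_congr rfl fun i _ => congrArg D.tr ?_
    rw [← algebraMap_smul R c (a (D.gen i)), map_smul, ← algebraMap_smul R c (_ : R)]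
    rfl

theorem eq_of_trace_eq {n : ℕ} {b b' : Z →ₗ[R] D.QPow n}
    (h : ∀ a : D.QPow n →ₗ[R] Z, D.trace (b ∘ₗ a) = D.trace (b' ∘ₗ a)) : b = b' := by
  have trace_comp_coordMap : ∀ (b : Z →ₗ[R] D.QPow n) (i : Fin n) (z : Z) (x : R),
      D.trace (b ∘ₗ D.coordMap (K := K) i (x • z)) = D.tr (D.e * x * b z i) := by
    intro b i z x
    rw [trace, Finset.sum_eq_single i]
    · rw [LinearMap.comp_apply, coordMap_apply, gen, Pi.single_eq_same, map_smul, map_smul,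
        mul_assoc]
      rfl
    · intro j _ hj
      rw [LinearMap.comp_apply, coordMap_apply, gen, Pi.single_eq_of_ne' hj]
      simp
    · simp
  refine LinearMap.ext fun z => funext fun i => D.leftIdeal_ext fun x => ?_
  rw [← trace_comp_coordMap, ← trace_comp_coordMap, h]

theorem exists_traceAgainst {n : ℕ} (Φ : (D.QPow n →ₗ[R] Z) →ₗ[K] K) :
    ∃ b : Z →ₗ[R] D.QPow n, ∀ a, Φ a = D.trace (b ∘ₗ a) := by
  refine ⟨LinearMap.pi fun i => D.formMap (Φ ∘ₗ D.coordMap i), fun a => ?_⟩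
  conv_lhs => rw [D.eq_sum_coordMap (K := K) a, map_sum]
  refine Finset.sum_congr rfl fun i _ => ?_
  have hform := D.tr_formMap (Φ ∘ₗ D.coordMap (n := n) i) (a (D.gen i)) 1
  rw [mul_one, ← map_smul, D.e_smul_gen] at hform
  refine hform.symm.trans (congrArg D.tr ?_)
  rw [LinearMap.comp_apply, LinearMap.pi_apply]
  conv_rhs => rw [← D.e_smul_gen, map_smul, map_smul]
  rfl

-- By `eq_of_trace_eq` and `exists_traceAgainst`, `Hom(Z, Qⁿ)` is the `K`-dual of `Hom(Qⁿ, Z)`, so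
-- exactness of `Hom(-, Z)` at `Qⁿ` dualizes to exactness of `Hom(Z, -)`.
theorem exists_lift_of_exact_hom {n m p : ℕ} (d : D.QPow p →ₗ[R] D.QPow n)
    (c : D.QPow n →ₗ[R] D.QPow m)
    (hex : ∀ a : D.QPow n →ₗ[R] Z, a ∘ₗ d = 0 → ∃ a' : D.QPow m →ₗ[R] Z, a' ∘ₗ c = a)
    (g : Z →ₗ[R] D.QPow n) (hg : c ∘ₗ g = 0) : ∃ g' : Z →ₗ[R] D.QPow p, d ∘ₗ g' = g := by
  let L : (D.QPow n →ₗ[R] Z) →ₗ[K] (D.QPow p →ₗ[R] Z) := LinearMap.lcomp K Z d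
  have hmem : D.traceAgainst (K := K) g ∈ LinearMap.range L.dualMap := by
    rw [LinearMap.range_dualMap_eq_dualAnnihilator_ker, Submodule.mem_dualAnnihilator]
    intro a ha
    obtain ⟨a', rfl⟩ := hex a ha
    change D.trace (g ∘ₗ a' ∘ₗ c) = 0
    rw [← LinearMap.comp_assoc, trace_comp_comm, ← LinearMap.comp_assoc, hg]
    simp [trace]
  obtain ⟨Φ, hΦ⟩ := hmem
  obtain ⟨g', hg'⟩ := D.exists_traceAgainst Φ
  refine ⟨g', D.eq_of_trace_eq (K := K) fun a => ?_⟩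
  have htrace : D.trace (g ∘ₗ a) = Φ (a ∘ₗ d) := (LinearMap.congr_fun hΦ a).symm
  rw [htrace, hg', LinearMap.comp_assoc, trace_comp_comm, LinearMap.comp_assoc]

end GendoCore

end Trace

/-! ### Admissible classes of modules -/

section ModuleClass

variable {R : Type u} [Ring R]

/-- A class of `R`-modules, as a predicate on unbundled modules; closure under isomorphism is not
part of the definition. -/
abbrev ModuleClass (R : Type u) [Ring R] : Type (u + 1) :=
  ∀ (V : Type u) [AddCommGroup V] [Module R V], Prop

variable {𝒳 : ModuleClass R} {U T : Type u} [AddCommGroup U] [Module R U] [AddCommGroup T]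
  [Module R T]

/-- Every map from `V` to the target of `f` factors through `f`. -/
def Lifts (f : U →ₗ[R] T) (V : Type u) [AddCommGroup V] [Module R V] : Prop :=
  ∀ φ : V →ₗ[R] T, ∃ l : V →ₗ[R] U, f ∘ₗ l = φ

/-- A right approximation `U → T` by the class `𝒳`: a map from a member of `𝒳` through which every
map from a member of `𝒳` to `T` factors. -/
structure IsApprox (𝒳 : ModuleClass R) (f : U →ₗ[R] T) : Prop where
  mem : 𝒳 U
  lift : ∀ (V : Type u) [AddCommGroup V] [Module R V], 𝒳 V → Lifts f V

/-- A right approximation which is right minimal. -/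
structure IsMinimalApprox (𝒳 : ModuleClass R) (f : U →ₗ[R] T) : Prop extends IsApprox 𝒳 f where
  bijective : ∀ h : U →ₗ[R] U, f ∘ₗ h = f → Function.Bijective h

/-- A class of finitely generated modules containing `0` and closed under summands and
extensions. -/
structure IsExtensionClosed (𝒳 : ModuleClass R) : Prop where
  finite : ∀ (V : Type u) [AddCommGroup V] [Module R V], 𝒳 V → Module.Finite R V
  zero : 𝒳 PUnit.{u + 1}
  retract : ∀ {V W : Type u} [AddCommGroup V] [Module R V] [AddCommGroup W] [Module R W]
    (a : V →ₗ[R] W) (b : W →ₗ[R] V), b ∘ₗ a = LinearMap.id → 𝒳 W → 𝒳 V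
  extension : ∀ {X Y Z : Type u} [AddCommGroup X] [Module R X] [AddCommGroup Y] [Module R Y]
    [AddCommGroup Z] [Module R Z] {f : X →ₗ[R] Y} {g : Y →ₗ[R] Z},
    IsShortExact f g → 𝒳 X → 𝒳 Z → 𝒳 Y

theorem IsExtensionClosed.congr (h𝒳 : IsExtensionClosed 𝒳) (a : T ≃ₗ[R] U) (hU : 𝒳 U) : 𝒳 T :=
  h𝒳.retract a.toLinearMap a.symm.toLinearMap (by ext; simp) hU

end ModuleClass

section ProjectiveSummand

variable {R : Type u} [Ring R] {N P T : Type u} [AddCommGroup N] [Module R N] [AddCommGroup P]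
  [Module R P] [AddCommGroup T] [Module R T]

theorem exists_minimal_submodule [IsArtinian R N] (P : Submodule R N → Prop) (h : ∃ S, P S) :
    ∃ S, P S ∧ ∀ S', P S' → ¬ S' < S :=
  (wellFounded_lt (α := Submodule R N)).has_min {S | P S} h

theorem exists_equiv_ker_prod {l : N →ₗ[R] P} {s : P →ₗ[R] N} (hs : l ∘ₗ s = LinearMap.id) :
    ∃ a : N ≃ₗ[R] LinearMap.ker l × P,
      a.toLinearMap ∘ₗ (LinearMap.ker l).subtype = LinearMap.inl R _ _ := by
  obtain ⟨a, ha, -⟩ := (LinearMap.exact_subtype_ker_map l).splitSurjectiveEquiv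
    (LinearMap.ker l).injective_subtype ⟨s, hs⟩
  exact ⟨a, by rw [ha, ← LinearMap.comp_assoc, LinearEquiv.comp_symm, LinearMap.id_comp]⟩

theorem exists_retraction_ker {l : N →ₗ[R] P} {s : P →ₗ[R] N} (hs : l ∘ₗ s = LinearMap.id) :
    ∃ r : N →ₗ[R] LinearMap.ker l, r ∘ₗ (LinearMap.ker l).subtype = LinearMap.id := by
  obtain ⟨a, ha⟩ := exists_equiv_ker_prod hs
  exact ⟨LinearMap.fst R _ _ ∘ₗ a.toLinearMap, by
    rw [LinearMap.comp_assoc, ha, LinearMap.fst_comp_inl]⟩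

-- Minimality of `P'` makes `N → P'` followed by a lift of `P' → T` to `N` an automorphism of `P'`.
theorem exists_projective_summand [IsArtinianRing R] [Module.Finite R P] [Module.Projective R P]
    {π : N →ₗ[R] T} (hsurj : Function.Surjective π) (q : P →ₗ[R] T) (l : N →ₗ[R] P)
    (hql : q ∘ₗ l = π) :
    ∃ (P' : ModuleCat.{u} R) (q' : P' →ₗ[R] T) (l' : N →ₗ[R] P') (s : P' →ₗ[R] N),
      Module.Projective R P' ∧ q' ∘ₗ l' = π ∧ l' ∘ₗ s = LinearMap.id := by
  obtain ⟨P', ⟨hP', q', l', hq⟩, hmin⟩ := exists_minimal_submodule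
    (fun P' : Submodule R P => Module.Projective R P' ∧
      ∃ (q' : P' →ₗ[R] T) (l' : N →ₗ[R] P'), q' ∘ₗ l' = π) ⟨⊤,
        .of_equiv (Submodule.topEquiv (R := R) (M := P)).symm,
        q ∘ₗ Submodule.topEquiv.toLinearMap, Submodule.topEquiv.symm.toLinearMap ∘ₗ l, hql⟩
  obtain ⟨m, hm⟩ := Module.projective_lifting_property π q' hsurj
  have hfix : q' ∘ₗ (l' ∘ₗ m) = q' := by rw [← LinearMap.comp_assoc, hq, hm]
  have hbij := bijective_of_minimal hmin (l' ∘ₗ m) fun k hk => by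
    let s := P'.equivSubtypeMap (LinearMap.range ((l' ∘ₗ m) ^ k))
    obtain ⟨r, hr⟩ := exists_retraction_of_isCompl hk
    have : Module.Projective R (LinearMap.range ((l' ∘ₗ m) ^ k)) := .of_split _ r hr
    refine ⟨.of_equiv s, q' ∘ₗ Submodule.subtype _ ∘ₗ s.symm.toLinearMap,
      s.toLinearMap ∘ₗ ((l' ∘ₗ m) ^ k).rangeRestrict ∘ₗ l', LinearMap.ext fun v => ?_⟩
    simp only [LinearMap.comp_apply, LinearEquiv.coe_coe, LinearEquiv.symm_apply_apply]
    exact (LinearMap.congr_fun (comp_pow_eq_of_comp_eq hfix k) (l' v)).trans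
      (LinearMap.congr_fun hq v)
  let s := LinearEquiv.ofBijective _ hbij
  exact ⟨ModuleCat.of R P', q', l', m ∘ₗ s.symm.toLinearMap, hP', hq,
    LinearMap.ext fun x => s.apply_symm_apply x⟩

end ProjectiveSummand

section AdmissibleClass

variable {K : Type u} [Field K] {R : Type u} [Ring R] [Algebra K R]

/-- A contravariantly finite, extension closed class in which `(Re)ⁿ` gives both syzygies and
cosyzygies, and in which projective modules are injective. These are the properties of the class of
modules of infinite dominant dimension that force its members to be injective. -/
structure AdmissibleClass (D : GendoCore K R) (𝒳 : ModuleClass R) : Prop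
    extends IsExtensionClosed 𝒳 where
  qpow : ∀ n, 𝒳 (D.QPow n)
  cosyzygy : ∀ (V : Type u) [AddCommGroup V] [Module R V], 𝒳 V →
    ∃ (n : ℕ) (W : ModuleCat.{u} R) (f : V →ₗ[R] D.QPow n) (g : D.QPow n →ₗ[R] W),
      IsShortExact f g ∧ 𝒳 W
  syzygy : ∀ (V : Type u) [AddCommGroup V] [Module R V], 𝒳 V →
    ∃ (n : ℕ) (W : ModuleCat.{u} R) (f : W →ₗ[R] D.QPow n) (g : D.QPow n →ₗ[R] V),
      IsShortExact f g ∧ 𝒳 W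
  injective : ∀ (V : Type u) [AddCommGroup V] [Module R V], 𝒳 V → Module.Projective R V →
    Module.Injective R V
  approx : ∀ (T : Type u) [AddCommGroup T] [Module R T], Module.Finite R T →
    ∃ (U : ModuleCat.{u} R) (f : U →ₗ[R] T), IsApprox 𝒳 f

namespace AdmissibleClass

variable {D : GendoCore K R} {𝒳 : ModuleClass R} (h𝒳 : AdmissibleClass D 𝒳)

include h𝒳

theorem exists_minimalApprox [IsArtinianRing R] (T : Type u) [AddCommGroup T] [Module R T]
    [hT : Module.Finite R T] : ∃ (U : ModuleCat.{u} R) (f : U →ₗ[R] T), IsMinimalApprox 𝒳 f := by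
  obtain ⟨U, f, hf⟩ := h𝒳.approx T hT
  have := h𝒳.finite U hf.mem
  obtain ⟨N, hN, hmin⟩ := exists_minimal_submodule
    (fun N : Submodule R U => IsApprox 𝒳 (f ∘ₗ N.subtype)) ⟨⊤,
      h𝒳.congr Submodule.topEquiv hf.mem, fun V _ _ hV φ => by
        obtain ⟨l, hl⟩ := hf.lift V hV φ
        exact ⟨Submodule.topEquiv.symm.toLinearMap ∘ₗ l, hl⟩⟩
  refine ⟨ModuleCat.of R N, f ∘ₗ N.subtype, hN, fun h hh => ?_⟩
  refine bijective_of_minimal hmin h fun k hk => ⟨?_, fun V _ _ hV φ => ?_⟩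
  · obtain ⟨r, hr⟩ := exists_retraction_of_isCompl hk
    exact h𝒳.congr (N.equivSubtypeMap _).symm (h𝒳.retract _ r hr hN.mem)
  · obtain ⟨l, hl⟩ := hN.lift V hV φ
    refine ⟨(N.equivSubtypeMap _).toLinearMap ∘ₗ (h ^ k).rangeRestrict ∘ₗ l,
      LinearMap.ext fun v => ?_⟩
    exact (LinearMap.congr_fun (comp_pow_eq_of_comp_eq hh k) (l v)).trans
      (LinearMap.congr_fun hl v)

section MinimalApprox

variable {U T : Type u} [AddCommGroup U] [Module R U] [AddCommGroup T] [Module R T]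
  {f : U →ₗ[R] T} (hf : IsMinimalApprox 𝒳 f)

include hf

-- Wakamatsu's lemma: the pushout of `P ← W → U` is an extension of `V` by `U`, so its map to `T`
-- factors through `f`, and minimality makes the factorization a retraction onto `U`.
theorem exists_extend_ker {W P V : Type u} [AddCommGroup W] [Module R W]
    [AddCommGroup P] [Module R P] [AddCommGroup V] [Module R V] {i : W →ₗ[R] P} {q : P →ₗ[R] V}
    (h : IsShortExact i q) (hV : 𝒳 V) (a : W →ₗ[R] LinearMap.ker f) :
    ∃ b : P →ₗ[R] LinearMap.ker f, b ∘ₗ i = a := by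
  let a' := (LinearMap.ker f).subtype ∘ₗ a
  have ha' : f ∘ₗ a' = 0 ∘ₗ i := LinearMap.ext fun w => (a w).2
  obtain ⟨k, hk⟩ := hf.lift _ (h𝒳.extension (h.pushout a') hf.mem hV) (Pushout.desc f 0 ha')
  have hfix : f ∘ₗ (k ∘ₗ Pushout.inl a' i) = f := by
    rw [← LinearMap.comp_assoc, hk, Pushout.desc_comp_inl]
  let s := LinearEquiv.ofBijective _ (hf.bijective _ hfix)
  have hs : ∀ x, f (s.symm x) = f x := fun x => by
    conv_rhs => rw [← s.apply_symm_apply x]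
    exact (LinearMap.congr_fun hfix (s.symm x)).symm
  refine ⟨LinearMap.codRestrict _ (s.symm.toLinearMap ∘ₗ k ∘ₗ Pushout.inr a' i) fun p => ?_,
    LinearMap.ext fun w => Subtype.ext ?_⟩
  · rw [LinearMap.mem_ker]
    exact (hs _).trans ((LinearMap.congr_fun hk _).trans
      (LinearMap.congr_fun (Pushout.desc_comp_inr ha') p))
  · change s.symm (k (Pushout.inr a' i (i w))) = a' w
    rw [LinearEquiv.symm_apply_eq]
    exact congrArg k (LinearMap.congr_fun (Pushout.condition a' i) w).symm

theorem exists_factor_ker {V : Type u} [AddCommGroup V] [Module R V] (hV : 𝒳 V)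
    (g : LinearMap.ker f →ₗ[R] V) :
    ∃ (p : ℕ) (a : LinearMap.ker f →ₗ[R] D.QPow p) (b : D.QPow p →ₗ[R] V), b ∘ₗ a = g := by
  obtain ⟨n, W₁, ι, π, h₁, hW₁⟩ := h𝒳.cosyzygy V hV
  obtain ⟨m, W₂, κ, ρ, h₂, hW₂⟩ := h𝒳.cosyzygy W₁ hW₁
  obtain ⟨p, W', _, σ, h₃, -⟩ := h𝒳.syzygy V hV
  let := scalarModule K R (LinearMap.ker f)
  have := scalarModule_isScalarTower K R (LinearMap.ker f)
  obtain ⟨g', hg'⟩ := D.exists_lift_of_exact_hom (ι ∘ₗ σ) (κ ∘ₗ π) (fun a ha => by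
    obtain ⟨a₁, rfl⟩ := h₁.exists_desc a (LinearMap.ext fun v => by
      obtain ⟨y, rfl⟩ := h₃.surj v
      exact LinearMap.congr_fun ha y)
    obtain ⟨a₂, rfl⟩ := h𝒳.exists_extend_ker hf h₂ hW₂ a₁
    exact ⟨a₂, rfl⟩) (ι ∘ₗ g) (LinearMap.ext fun z => by
      simp [h₁.exact.apply_apply_eq_zero])
  exact ⟨p, g', σ, LinearMap.ext fun z => h₁.inj (LinearMap.congr_fun hg' z)⟩

theorem exists_extend_of_ker {V : Type u} [AddCommGroup V] [Module R V] (hV : 𝒳 V)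
    (g : LinearMap.ker f →ₗ[R] V) : ∃ g' : U →ₗ[R] V, g' ∘ₗ (LinearMap.ker f).subtype = g := by
  obtain ⟨p, a, b, rfl⟩ := h𝒳.exists_factor_ker hf hV g
  obtain ⟨a', ha'⟩ := Module.Injective.out (Q := D.QPow p) (LinearMap.ker f).subtype
    (LinearMap.ker f).injective_subtype a
  exact ⟨b ∘ₗ a', LinearMap.ext fun z => congrArg b (ha' z)⟩

theorem exists_retract_of_isSimpleModule [IsSimpleModule R T] (hT : ¬ 𝒳 T)
    (hsurj : Function.Surjective f) :
    ∃ (n : ℕ) (a : U →ₗ[R] D.QPow n) (b : D.QPow n →ₗ[R] U), b ∘ₗ a = LinearMap.id := by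
  obtain ⟨n, a, b, hba⟩ := h𝒳.exists_factor_ker hf hf.mem (LinearMap.ker f).subtype
  obtain ⟨a', ha'⟩ := Module.Injective.out (Q := D.QPow n) (LinearMap.ker f).subtype
    (LinearMap.ker f).injective_subtype a
  obtain ⟨c, hc⟩ : ∃ c : T →ₗ[R] U, c ∘ₗ f = LinearMap.id - b ∘ₗ a' :=
    (IsShortExact.ker_subtype f hsurj).exists_desc _ (LinearMap.ext fun z => by
      have h1 : b (a z) = z := LinearMap.congr_fun hba z
      have h2 : a' z = a z := ha' z
      simp [h1, h2])
  have hfix : f ∘ₗ (b ∘ₗ a') = f := by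
    rcases LinearMap.bijective_or_eq_zero (f ∘ₗ c) with hbij | h0
    · let s := LinearEquiv.ofBijective _ hbij
      exact absurd (h𝒳.retract c (s.symm.toLinearMap ∘ₗ f)
        (LinearMap.ext fun t => s.symm_apply_apply t) hf.mem) hT
    · have : f ∘ₗ (LinearMap.id - b ∘ₗ a') = 0 := by
        rw [← hc, ← LinearMap.comp_assoc, h0, LinearMap.zero_comp]
      rw [LinearMap.comp_sub, sub_eq_zero] at this
      exact this.symm
  let s := LinearEquiv.ofBijective _ (hf.bijective _ hfix)
  exact ⟨n, a', s.symm.toLinearMap ∘ₗ b, LinearMap.ext fun x => s.symm_apply_apply x⟩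

theorem surjective_of_e_smul_ne_zero [IsSimpleModule R T] {t : T} (ht : D.e • t ≠ 0) :
    Function.Surjective f := by
  let a : D.QPow 1 →ₗ[R] T :=
    LinearMap.toSpanSingleton R T t ∘ₗ (leftIdeal D.e).subtype ∘ₗ LinearMap.proj 0
  obtain ⟨l, hl⟩ := hf.lift _ (h𝒳.qpow 1) a
  refine LinearMap.surjective_of_ne_zero fun h => ht ?_
  rw [h, LinearMap.zero_comp] at hl
  exact (LinearMap.congr_fun hl fun _ => ⟨D.e, D.e, D.idem⟩).symm

end MinimalApprox

section Annihilated

variable {T : Type u} [AddCommGroup T] [Module R T] (hT : ∀ t : T, D.e • t = 0)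
  {V : Type u} [AddCommGroup V] [Module R V] (hV : 𝒳 V)

include hT hV

theorem map_eq_zero_of_e_smul_eq_zero_right (a : V →ₗ[R] T) : a = 0 := by
  obtain ⟨n, W, i, q, h, -⟩ := h𝒳.syzygy V hV
  refine LinearMap.ext fun v => ?_
  obtain ⟨y, rfl⟩ := h.surj v
  rw [← LinearMap.comp_apply, GendoCore.map_eq_sum (a ∘ₗ q)]
  refine Finset.sum_eq_zero fun i _ => ?_
  rw [← D.e_smul_gen, map_smul, hT, smul_zero]

theorem map_eq_zero_of_e_smul_eq_zero_left (a : T →ₗ[R] V) : a = 0 := by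
  obtain ⟨n, W, i, q, h, -⟩ := h𝒳.cosyzygy V hV
  refine LinearMap.ext fun t => h.inj (funext fun j => D.leftIdeal_ext fun x => ?_)
  have hx : D.e * x * (i (a t) j : R) = (i (a (D.e • x • t)) j : R) := by
    rw [map_smul, map_smul, map_smul, map_smul, mul_assoc]
    rfl
  rw [hx, hT, LinearMap.zero_apply, map_zero]
  simp

theorem extVanishesAt_of_e_smul_eq_zero : ExtVanishesAt R V T 1 ∧ ExtVanishesAt R T V 1 := by
  constructor
  · obtain ⟨n, W, i, q, h, hW⟩ := h𝒳.syzygy V hV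
    exact h.extVanishesAt_one_of_extend (.of_projective le_rfl) fun k =>
      ⟨0, (h𝒳.map_eq_zero_of_e_smul_eq_zero_right hT hW k).symm⟩
  · obtain ⟨n, W, i, q, h, hW⟩ := h𝒳.cosyzygy V hV
    exact h.extVanishesAt_one_of_lift (.of_injective le_rfl) fun k =>
      ⟨0, by rw [h𝒳.map_eq_zero_of_e_smul_eq_zero_left hT hW k, LinearMap.comp_zero]⟩

end Annihilated

section Simple

variable [IsArtinianRing R] {T : Type u} [AddCommGroup T] [Module R T] [IsSimpleModule R T]
  {V : Type u} [AddCommGroup V] [Module R V]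

theorem exists_projective_minimalApprox (hT : ¬ 𝒳 T) {t : T} (ht : D.e • t ≠ 0) :
    ∃ (U : ModuleCat.{u} R) (f : U →ₗ[R] T), IsMinimalApprox 𝒳 f ∧ Function.Surjective f ∧
      Module.Projective R U := by
  obtain ⟨U, f, hf⟩ := h𝒳.exists_minimalApprox T
  have hsurj := h𝒳.surjective_of_e_smul_ne_zero hf ht
  obtain ⟨n, a, b, hab⟩ := h𝒳.exists_retract_of_isSimpleModule hf hT hsurj
  exact ⟨U, f, hf, hsurj, .of_split a b hab⟩

theorem extVanishesAt_of_not_mem (hT : ¬ 𝒳 T) {t : T} (ht : D.e • t ≠ 0) (hV : 𝒳 V) :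
    ExtVanishesAt R V T 1 ∧ ExtVanishesAt R T V 1 := by
  obtain ⟨U, f, hf, hsurj, hU⟩ := h𝒳.exists_projective_minimalApprox hT ht
  have := h𝒳.injective U hf.mem hU
  obtain ⟨n, W, i, q, h, hW⟩ := h𝒳.syzygy V hV
  constructor
  · refine h.extVanishesAt_one_of_extend (.of_projective le_rfl) fun k => ?_
    obtain ⟨l, rfl⟩ := hf.lift W hW k
    obtain ⟨l', hl'⟩ := Module.Injective.out (Q := U) i h.inj l
    exact ⟨f ∘ₗ l', LinearMap.ext fun w => congrArg f (hl' w)⟩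
  · exact (IsShortExact.ker_subtype f hsurj).extVanishesAt_one_of_extend (.of_projective le_rfl)
      fun k => h𝒳.exists_extend_of_ker hf hV k

theorem extVanishesAt_of_isSimpleModule (hT : 𝒳 T → Module.Projective R T) (hV : 𝒳 V) :
    ExtVanishesAt R V T 1 ∧ ExtVanishesAt R T V 1 := by
  by_cases hTX : 𝒳 T
  · have := hT hTX
    have := h𝒳.injective T hTX this
    exact ⟨.of_injective le_rfl, .of_projective le_rfl⟩
  by_cases he : ∀ t : T, D.e • t = 0
  · exact h𝒳.extVanishesAt_of_e_smul_eq_zero he hV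
  · push Not at he
    obtain ⟨t, ht⟩ := he
    exact h𝒳.extVanishesAt_of_not_mem hTX ht hV

theorem exists_projective_factorization (hT : 𝒳 T → Module.Projective R T) (hV : 𝒳 V)
    {π : V →ₗ[R] T} (hπ : Function.Surjective π) :
    ∃ (P : ModuleCat.{u} R) (q : P →ₗ[R] T) (l : V →ₗ[R] P),
      Module.Finite R P ∧ Module.Projective R P ∧ q ∘ₗ l = π := by
  by_cases hTX : 𝒳 T
  · exact ⟨ModuleCat.of R T, LinearMap.id, π, h𝒳.finite T hTX, hT hTX, rfl⟩
  · obtain ⟨t, ht⟩ : ∃ t : T, D.e • t ≠ 0 := by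
      by_contra! he
      have := IsSimpleModule.nontrivial R T
      exact LinearMap.ne_zero_of_surjective hπ (h𝒳.map_eq_zero_of_e_smul_eq_zero_right he hV π)
    obtain ⟨U, f, hf, -, hU⟩ := h𝒳.exists_projective_minimalApprox hTX ht
    obtain ⟨l, hl⟩ := hf.lift V hV π
    exact ⟨U, f, l, h𝒳.finite U hf.mem, hU, hl⟩

theorem exists_proper_submodule (hT : 𝒳 T → Module.Projective R T) (hV : 𝒳 V)
    (hVp : ¬ Module.Projective R V) {π : V →ₗ[R] T} (hπ : Function.Surjective π) :
    ∃ N : Submodule R V, 𝒳 N ∧ ¬ Module.Projective R N ∧ N ≠ ⊤ := by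
  obtain ⟨P, q, l, hPf, hPp, hql⟩ := h𝒳.exists_projective_factorization hT hV hπ
  obtain ⟨P', q', l', s, hP', hq', hs⟩ := exists_projective_summand hπ q l hql
  obtain ⟨r, hr⟩ := exists_retraction_ker hs
  refine ⟨LinearMap.ker l', h𝒳.retract _ r hr hV, fun hk => hVp ?_, fun htop => ?_⟩
  · obtain ⟨a, -⟩ := exists_equiv_ker_prod hs
    exact .of_equiv a.symm
  · have := IsSimpleModule.nontrivial R T
    refine LinearMap.ne_zero_of_surjective hπ ?_
    rw [← hq', LinearMap.ker_eq_top.1 htop, LinearMap.comp_zero]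

end Simple

theorem exists_isSimpleModule [IsArtinianRing R] {V : Type u} [AddCommGroup V] [Module R V]
    (hV : 𝒳 V) (hVp : ¬ Module.Projective R V) :
    ∃ T : ModuleCat.{u} R, IsSimpleModule R T ∧ 𝒳 T ∧ ¬ Module.Projective R T := by
  have := h𝒳.finite V hV
  obtain ⟨N, ⟨hN, hNp⟩, hmin⟩ := exists_minimal_submodule
    (fun N : Submodule R V => 𝒳 N ∧ ¬ Module.Projective R N) ⟨⊤,
      h𝒳.congr Submodule.topEquiv hV, fun _ => hVp (.of_equiv Submodule.topEquiv)⟩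
  have := h𝒳.finite N hN
  have : Nontrivial N := by
    by_contra hn
    rw [not_nontrivial_iff_subsingleton] at hn
    exact hNp inferInstance
  obtain ⟨T, π, hT, hπ⟩ := exists_simple_quotient R N
  refine ⟨T, hT, ?_⟩
  by_contra! hcon
  obtain ⟨S, hS, hSp, hStop⟩ := h𝒳.exists_proper_submodule hcon hN hNp hπ
  let s := N.equivSubtypeMap S
  refine hmin (S.map N.subtype) ⟨h𝒳.congr s.symm hS, fun _ => hSp (.of_equiv s.symm)⟩
    (lt_of_le_of_ne (Submodule.map_subtype_le _ _) fun heq => hStop ?_)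
  refine Submodule.map_injective_of_injective N.injective_subtype ?_
  rw [heq, Submodule.map_subtype_top]

end AdmissibleClass

end AdmissibleClass

/-! ### Filtrations by simple modules and connectedness -/

section Filtration

variable {R : Type u} [Ring R] {X Y Z W N M S : Type u} [AddCommGroup X] [Module R X]
  [AddCommGroup Y] [Module R Y] [AddCommGroup Z] [Module R Z] [AddCommGroup W] [Module R W]
  [AddCommGroup N] [Module R N] [AddCommGroup M] [Module R M] [AddCommGroup S] [Module R S]

/-- The class of modules that do not belong to `𝒯`. -/
abbrev ModuleClass.compl (𝒯 : ModuleClass R) : ModuleClass R := fun V _ _ => ¬ 𝒯 V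

/-- Modules with a finite filtration whose factors are simple modules in the class `𝒯`. -/
inductive Filtered (𝒯 : ModuleClass R) : ∀ (M : Type u) [AddCommGroup M] [Module R M], Prop
  | of_subsingleton {M : Type u} [AddCommGroup M] [Module R M] (h : Subsingleton M) : Filtered 𝒯 M
  | extension {X Y Z : Type u} [AddCommGroup X] [Module R X] [AddCommGroup Y] [Module R Y]
      [AddCommGroup Z] [Module R Z] {f : X →ₗ[R] Y} {g : Y →ₗ[R] Z} (h : IsShortExact f g)
      (hX : Filtered 𝒯 X) (hZ : IsSimpleModule R Z) (hT : 𝒯 Z) : Filtered 𝒯 Y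

variable {𝒯 𝒯' : ModuleClass R}

theorem IsShortExact.congr_middle {f : X →ₗ[R] Y} {g : Y →ₗ[R] Z} (h : IsShortExact f g)
    (a : Y ≃ₗ[R] W) : IsShortExact (a.toLinearMap ∘ₗ f) (g ∘ₗ a.symm.toLinearMap) where
  inj := a.injective.comp h.inj
  exact := by
    refine fun w => (h.exact (a.symm w)).trans (exists_congr fun x => ?_)
    exact a.toEquiv.eq_symm_apply
  surj := h.surj.comp a.symm.surjective

theorem IsShortExact.restrict_ker {f : X →ₗ[R] Y} {g : Y →ₗ[R] Z} (h : IsShortExact f g)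
    {i : N →ₗ[R] X} {p : Y →ₗ[R] W} (hi : IsShortExact i (p ∘ₗ f)) :
    IsShortExact (LinearMap.codRestrict (LinearMap.ker p) (f ∘ₗ i) hi.exact.apply_apply_eq_zero)
      (g ∘ₗ (LinearMap.ker p).subtype) where
  inj x x' hx := hi.inj (h.inj (congrArg Subtype.val hx))
  exact y := by
    constructor
    · intro hy
      obtain ⟨x, hx⟩ := (h.exact y).1 hy
      obtain ⟨n, rfl⟩ := (hi.exact x).1 (by rw [LinearMap.comp_apply, hx]; exact y.2)
      exact ⟨n, Subtype.ext hx⟩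
    · rintro ⟨n, rfl⟩
      exact h.exact.apply_apply_eq_zero _
  surj z := by
    obtain ⟨y, rfl⟩ := h.surj z
    obtain ⟨x, hx⟩ := hi.surj (p y)
    rw [LinearMap.comp_apply] at hx
    exact ⟨⟨y - f x, by simp [hx]⟩, by simp [h.exact.apply_apply_eq_zero]⟩

namespace Filtered

theorem of_isSimpleModule (hS : IsSimpleModule R S) (hT : 𝒯 S) : Filtered 𝒯 S :=
  .extension (X := PUnit.{u + 1}) (f := 0) (g := LinearMap.id)
    ⟨fun _ _ _ => rfl, fun _ => ⟨fun h => ⟨0, h.symm⟩, fun ⟨_, h⟩ => h.symm⟩,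
      Function.surjective_id⟩ (.of_subsingleton inferInstance) hS hT

theorem congr (a : M ≃ₗ[R] N) (hM : Filtered 𝒯 M) : Filtered 𝒯 N := by
  cases hM with
  | of_subsingleton h => exact .of_subsingleton a.symm.injective.subsingleton
  | extension h hX hZ hT => exact .extension (h.congr_middle a) hX hZ hT

theorem map_eq_zero_of_forall_simple
    (hS : ∀ (Z : Type u) [AddCommGroup Z] [Module R Z], IsSimpleModule R Z → 𝒯 Z →
      ∀ φ : S →ₗ[R] Z, φ = 0) (hM : Filtered 𝒯 M) (φ : S →ₗ[R] M) : φ = 0 := by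
  induction hM with
  | of_subsingleton h => exact LinearMap.ext fun x => Subsingleton.elim _ _
  | extension h _ hZ hT ih =>
    obtain ⟨b, rfl⟩ := h.exists_codesc φ (hS _ hZ hT _)
    rw [ih b, LinearMap.comp_zero]

theorem map_eq_zero
    (hdisj : ∀ (S Z : Type u) [AddCommGroup S] [Module R S] [AddCommGroup Z] [Module R Z],
      𝒯 S → 𝒯' Z → IsEmpty (S ≃ₗ[R] Z))
    (hM : Filtered 𝒯 M) (hN : Filtered 𝒯' N) (φ : M →ₗ[R] N) : φ = 0 := by
  induction hM with
  | of_subsingleton h =>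
    exact LinearMap.ext fun x => by rw [Subsingleton.elim x 0, map_zero, map_zero]
  | extension h _ hZ hT ih =>
    obtain ⟨b, rfl⟩ := h.exists_desc φ (ih _)
    rw [hN.map_eq_zero_of_forall_simple (fun Z' _ _ hZ' hT' ψ => ?_) b, LinearMap.zero_comp]
    rcases LinearMap.bijective_or_eq_zero ψ with hψ | hψ
    · exact ((hdisj _ Z' hT hT').false (LinearEquiv.ofBijective ψ hψ)).elim
    · exact hψ

theorem extVanishesAt_one
    (hS : ∀ (Z : Type u) [AddCommGroup Z] [Module R Z], IsSimpleModule R Z → 𝒯 Z →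
      ExtVanishesAt R S Z 1) (hM : Filtered 𝒯 M) : ExtVanishesAt R S M 1 := by
  induction hM with
  | @of_subsingleton M _ _ h =>
    have : Module.Injective R M := ⟨fun X Y _ _ _ _ f _ g => ⟨0, fun x => Subsingleton.elim _ _⟩⟩
    exact .of_injective le_rfl
  | extension h _ hZ hT ih => exact h.extVanishesAt_covariant₂ ih (hS _ hZ hT)

theorem exists_prod_of_extension {N₁ N₂ : Type u} [AddCommGroup N₁] [Module R N₁]
    [AddCommGroup N₂] [Module R N₂] {f : N →ₗ[R] M} {g : M →ₗ[R] S} (h : IsShortExact f g)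
    (s : N ≃ₗ[R] N₁ × N₂) (hN₁ : Filtered 𝒯 N₁) (hS : IsSimpleModule R S) (hT : 𝒯 S)
    (hE : ExtVanishesAt R S N₂ 1) :
    ∃ M₁ : ModuleCat.{u} R, Filtered 𝒯 M₁ ∧ Nonempty (M ≃ₗ[R] M₁ × N₂) := by
  obtain ⟨p, hp⟩ := h.exists_extend hE (LinearMap.snd R N₁ N₂ ∘ₗ s.toLinearMap)
  have hker : IsShortExact (s.symm.toLinearMap ∘ₗ LinearMap.inl R N₁ N₂) (p ∘ₗ f) := by
    rw [hp]
    exact IsShortExact.inl_snd.congr_middle s.symm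
  obtain ⟨a, -⟩ := exists_equiv_ker_prod (l := p)
    (s := f ∘ₗ s.symm.toLinearMap ∘ₗ LinearMap.inr R N₁ N₂) <| by
      rw [← LinearMap.comp_assoc, hp]
      ext x
      simp
  exact ⟨ModuleCat.of R (LinearMap.ker p), .extension (h.restrict_ker hker) hN₁ hS hT, ⟨a⟩⟩

end Filtered

theorem exists_prod_filtered
    (hE : ∀ (S Z : Type u) [AddCommGroup S] [Module R S] [AddCommGroup Z] [Module R Z],
      IsSimpleModule R S → 𝒯 S → IsSimpleModule R Z → ¬ 𝒯 Z →
        ExtVanishesAt R S Z 1 ∧ ExtVanishesAt R Z S 1) (hM : IsFiniteLength R M) :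
    ∃ M₁ M₂ : ModuleCat.{u} R, Filtered 𝒯 M₁ ∧ Filtered 𝒯.compl M₂ ∧
      Nonempty (M ≃ₗ[R] M₁ × M₂) := by
  induction hM with
  | @of_subsingleton M _ _ h =>
    exact ⟨ModuleCat.of R M, ModuleCat.of R M, .of_subsingleton h, .of_subsingleton h,
      ⟨LinearEquiv.ofLinearMap 0 0 (LinearMap.ext fun x => Subsingleton.elim _ _)
        (LinearMap.ext fun x => Subsingleton.elim _ _)⟩⟩
  | @of_simple_quotient M _ _ N hS _ ih =>
    obtain ⟨N₁, N₂, h₁, h₂, ⟨s⟩⟩ := ih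
    have hN := IsShortExact.subtype_mkQ N
    by_cases hT : 𝒯 (M ⧸ N)
    · obtain ⟨M₁, hM₁, hs⟩ := Filtered.exists_prod_of_extension hN s h₁ hS hT
        (h₂.extVanishesAt_one fun Z _ _ hZ hZ' => (hE _ Z hS hT hZ hZ').1)
      exact ⟨M₁, N₂, hM₁, h₂, hs⟩
    · obtain ⟨M₂, hM₂, ⟨t⟩⟩ := Filtered.exists_prod_of_extension (𝒯 := 𝒯.compl) hN
        (s ≪≫ₗ LinearEquiv.prodComm R N₁ N₂) h₂ hS hT
        (h₁.extVanishesAt_one fun Z _ _ hZ hZ' => (hE Z _ hZ hZ' hS hT).2)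
      exact ⟨N₁, M₂, h₁, hM₂, ⟨t ≪≫ₗ LinearEquiv.prodComm R M₂ N₁⟩⟩

section Connected

variable {M₁ M₂ : Type u} [AddCommGroup M₁] [Module R M₁] [AddCommGroup M₂] [Module R M₂]
  (h₁₂ : ∀ φ : M₁ →ₗ[R] M₂, φ = 0) (h₂₁ : ∀ φ : M₂ →ₗ[R] M₁, φ = 0)

include h₁₂ h₂₁

theorem map_fst_zero_eq (ψ : M₁ × M₂ →ₗ[R] M₁ × M₂) (x : M₁ × M₂) :
    ψ (x.1, 0) = ((ψ x).1, 0) := by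
  have hsnd : (ψ (x.1, 0)).2 = 0 :=
    LinearMap.congr_fun (h₁₂ (LinearMap.snd R M₁ M₂ ∘ₗ ψ ∘ₗ LinearMap.inl R M₁ M₂)) x.1
  have hfst : (ψ (0, x.2)).1 = 0 :=
    LinearMap.congr_fun (h₂₁ (LinearMap.fst R M₁ M₂ ∘ₗ ψ ∘ₗ LinearMap.inr R M₁ M₂)) x.2
  have hx : ψ x = ψ (x.1, 0) + ψ (0, x.2) := by
    rw [← map_add, Prod.mk_add_mk, add_zero, zero_add]
  exact Prod.ext (by rw [hx, Prod.fst_add, hfst, add_zero]) hsnd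

theorem exists_central_idempotent (s : R ≃ₗ[R] M₁ × M₂) :
    ∃ c : R, IsIdempotentElem c ∧ (∀ a, c * a = a * c) ∧ ∀ a, s (a * c) = ((s a).1, 0) := by
  let c : R := s.symm ((s 1).1, 0)
  have hc : s c = ((s 1).1, 0) := s.apply_symm_apply _
  have hmul : ∀ a, s (a * c) = ((s a).1, 0) := fun a => by
    have ha : s a = a • s 1 := by rw [← map_smul, smul_eq_mul, mul_one]
    rw [← smul_eq_mul, map_smul, hc, ha, Prod.smul_mk, smul_zero, Prod.smul_fst]
  refine ⟨c, s.injective (by rw [hmul, hc]), fun a => s.injective ?_, hmul⟩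
  have hψ := map_fst_zero_eq h₁₂ h₂₁
    (s.toLinearMap ∘ₗ LinearMap.toSpanSingleton R R a ∘ₗ s.symm.toLinearMap) (s 1)
  simpa [c, hmul] using hψ

theorem subsingleton_or_subsingleton_of_connected
    (hconn : ∀ c : R, IsIdempotentElem c → (∀ a, c * a = a * c) → c = 0 ∨ c = 1)
    (s : R ≃ₗ[R] M₁ × M₂) : Subsingleton M₁ ∨ Subsingleton M₂ := by
  obtain ⟨c, hidem, hcentral, hc⟩ := exists_central_idempotent h₁₂ h₂₁ s
  have hc' : ∀ x : M₁ × M₂, s (s.symm x * c) = (x.1, 0) := fun x => by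
    rw [hc, s.apply_symm_apply]
  rcases hconn c hidem hcentral with rfl | rfl
  · refine .inl (subsingleton_of_forall_eq 0 fun x => ?_)
    simpa [eq_comm] using congrArg Prod.fst (hc' (x, 0))
  · refine .inr (subsingleton_of_forall_eq 0 fun x => ?_)
    simpa using congrArg Prod.snd (hc' (0, x))

end Connected

theorem filtered_or_filtered_compl_of_connected
    (hconn : ∀ c : R, IsIdempotentElem c → (∀ a, c * a = a * c) → c = 0 ∨ c = 1)
    (hR : IsFiniteLength R R)
    (hdisj : ∀ (S Z : Type u) [AddCommGroup S] [Module R S] [AddCommGroup Z] [Module R Z],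
      𝒯 S → ¬ 𝒯 Z → IsEmpty (S ≃ₗ[R] Z))
    (hE : ∀ (S Z : Type u) [AddCommGroup S] [Module R S] [AddCommGroup Z] [Module R Z],
      IsSimpleModule R S → 𝒯 S → IsSimpleModule R Z → ¬ 𝒯 Z →
        ExtVanishesAt R S Z 1 ∧ ExtVanishesAt R Z S 1) :
    Filtered 𝒯 R ∨ Filtered 𝒯.compl R := by
  obtain ⟨M₁, M₂, h₁, h₂, ⟨s⟩⟩ := exists_prod_filtered hE hR
  have h₂₁ : ∀ φ : M₂ →ₗ[R] M₁, φ = 0 := h₂.map_eq_zero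
    (fun S Z _ _ _ _ hS hZ => ⟨fun a => (hdisj Z S hZ hS).false a.symm⟩) h₁
  rcases subsingleton_or_subsingleton_of_connected (h₁.map_eq_zero hdisj h₂) h₂₁ hconn s
    with hM | hM
  · let := uniqueOfSubsingleton (0 : M₁)
    exact .inr (h₂.congr (LinearEquiv.uniqueProd.symm ≪≫ₗ s.symm))
  · let := uniqueOfSubsingleton (0 : M₂)
    exact .inl (h₁.congr (LinearEquiv.prodUnique.symm ≪≫ₗ s.symm))

theorem IsExtensionClosed.of_filtered {𝒳 : ModuleClass R} (h𝒳 : IsExtensionClosed 𝒳)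
    (h𝒯 : ∀ (V : Type u) [AddCommGroup V] [Module R V], 𝒯 V → 𝒳 V) (hM : Filtered 𝒯 M) : 𝒳 M := by
  induction hM with
  | of_subsingleton h =>
    exact h𝒳.retract (W := PUnit) 0 0 (LinearMap.ext fun x => Subsingleton.elim _ _) h𝒳.zero
  | extension h _ _ hT ih => exact h𝒳.extension h ih (h𝒯 _ hT)

end Filtration

section Connected

variable {K : Type u} [Field K] {R : Type u} [Ring R] [Algebra K R]

-- Nonprojective simple members do not extend with other simple modules in either direction, so by
-- connectedness either there are none or `R` is filtered by them and is itself a member.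
theorem AdmissibleClass.injective_of_mem [IsArtinianRing R] {D : GendoCore K R} {𝒳 : ModuleClass R}
    (h𝒳 : AdmissibleClass D 𝒳)
    (hconn : ∀ c : R, IsIdempotentElem c → (∀ a, c * a = a * c) → c = 0 ∨ c = 1)
    (hself : ¬ Module.Injective R R) (V : Type u) [AddCommGroup V] [Module R V] (hV : 𝒳 V) :
    Module.Injective R V := by
  refine h𝒳.injective V hV ?_
  by_contra hVp
  obtain ⟨S, hS, hSX, hSp⟩ := h𝒳.exists_isSimpleModule hV hVp
  let 𝒯 : ModuleClass R := fun V _ _ => 𝒳 V ∧ ¬ Module.Projective R V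
  have hdisj : ∀ (S Z : Type u) [AddCommGroup S] [Module R S] [AddCommGroup Z] [Module R Z],
      𝒯 S → ¬ 𝒯 Z → IsEmpty (S ≃ₗ[R] Z) := fun S Z _ _ _ _ hS hZ =>
    ⟨fun a => hZ ⟨h𝒳.congr a.symm hS.1, fun _ => hS.2 (.of_equiv a.symm)⟩⟩
  rcases filtered_or_filtered_compl_of_connected hconn
    (isFiniteLength_iff_isNoetherian_isArtinian.2 ⟨inferInstance, inferInstance⟩) hdisj
    fun S Z _ _ _ _ _ hS _ hZ => h𝒳.extVanishesAt_of_isSimpleModule (by tauto) hS.1 with hR | hR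
  · exact hself (h𝒳.injective R (h𝒳.of_filtered (fun _ _ _ h => h.1) hR) inferInstance)
  · have := IsSimpleModule.nontrivial R S
    obtain ⟨x, hx⟩ := exists_ne (0 : S)
    have hzero : LinearMap.toSpanSingleton R S x = 0 := hR.map_eq_zero (𝒯' := 𝒯)
      (fun S Z _ _ _ _ hS hZ => ⟨fun a => (hdisj Z S hZ hS).false a.symm⟩)
      (.of_isSimpleModule hS ⟨hSX, hSp⟩) _
    exact hx (by simpa using LinearMap.congr_fun hzero 1)

end Connected

/-! ### Approximations by classes of finite type -/

section Approximation

variable {R : Type u} [Ring R]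

namespace Lifts

variable {U U' T V W : Type u} [AddCommGroup U] [Module R U] [AddCommGroup U'] [Module R U']
  [AddCommGroup T] [Module R T] [AddCommGroup V] [Module R V] [AddCommGroup W] [Module R W]
  {f : U →ₗ[R] T}

theorem of_comp_eq {f' : U' →ₗ[R] T} (hf : Lifts f V) (h : U →ₗ[R] U') (hh : f' ∘ₗ h = f) :
    Lifts f' V := fun φ => by
  obtain ⟨l, hl⟩ := hf φ
  exact ⟨h ∘ₗ l, by rw [← LinearMap.comp_assoc, hh, hl]⟩

theorem of_retract (hf : Lifts f W) (a : V →ₗ[R] W) (b : W →ₗ[R] V) (hab : b ∘ₗ a = LinearMap.id) :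
    Lifts f V := fun φ => by
  obtain ⟨l, hl⟩ := hf (φ ∘ₗ b)
  exact ⟨l ∘ₗ a, by rw [← LinearMap.comp_assoc, hl, LinearMap.comp_assoc, hab, LinearMap.comp_id]⟩

theorem congr (hf : Lifts f W) (a : V ≃ₗ[R] W) : Lifts f V :=
  hf.of_retract a.toLinearMap a.symm.toLinearMap (by ext; simp)

theorem prod (hV : Lifts f V) (hW : Lifts f W) : Lifts f (V × W) := fun φ => by
  obtain ⟨l₁, hl₁⟩ := hV (φ ∘ₗ LinearMap.inl R V W)
  obtain ⟨l₂, hl₂⟩ := hW (φ ∘ₗ LinearMap.inr R V W)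
  exact ⟨LinearMap.coprod l₁ l₂, by rw [LinearMap.comp_coprod, hl₁, hl₂, ← LinearMap.comp_coprod,
    LinearMap.coprod_inl_inr, LinearMap.comp_id]⟩

end Lifts

theorem exists_equiv_prod_of_not_indecomposable (V : ModuleCat.{u} R) [Nontrivial V]
    (hV : ¬ Indecomposable V) :
    ∃ Y Z : ModuleCat.{u} R, Nontrivial Y ∧ Nontrivial Z ∧ Nonempty (V ≃ₗ[R] Y × Z) := by
  by_contra! hprod
  refine hV ⟨fun h => not_subsingleton V (ModuleCat.isZero_iff_subsingleton.1 h), fun Y Z a => ?_⟩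
  simp only [ModuleCat.isZero_iff_subsingleton, ← not_nontrivial_iff_subsingleton]
  by_contra! h
  exact (hprod Y Z h.1 h.2).false (a ≪≫ ModuleCat.biprodIsoProd Y Z).toLinearEquiv

namespace IsExtensionClosed

variable {𝒳 : ModuleClass R} (h𝒳 : IsExtensionClosed 𝒳)

include h𝒳

theorem prod {V W : Type u} [AddCommGroup V] [Module R V] [AddCommGroup W] [Module R W] (hV : 𝒳 V)
    (hW : 𝒳 W) : 𝒳 (V × W) :=
  h𝒳.extension IsShortExact.inl_snd hV hW

theorem lifts_of_forall_indecomposable [IsArtinianRing R] {U T : Type u} [AddCommGroup U]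
    [Module R U] [AddCommGroup T] [Module R T] {f : U →ₗ[R] T}
    (hf : ∀ V : ModuleCat.{u} R, 𝒳 V → Indecomposable V → Lifts f V) (V : ModuleCat.{u} R)
    (hV : 𝒳 V) : Lifts f V := by
  have := h𝒳.finite V hV
  induction hm : Module.length R V using WellFoundedLT.induction generalizing V with
  | ind m ih =>
    rcases subsingleton_or_nontrivial V with _ | _
    · exact fun φ => ⟨0, LinearMap.ext fun x => by rw [Subsingleton.elim x 0, map_zero, map_zero]⟩
    by_cases hind : Indecomposable V
    · exact hf V hV hind
    obtain ⟨Y, Z, _, _, ⟨s⟩⟩ := exists_equiv_prod_of_not_indecomposable V hind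
    have hYZ : 𝒳 (Y × Z) := h𝒳.congr s.symm hV
    have hY : 𝒳 Y := h𝒳.retract _ _ (LinearMap.fst_comp_inl R Y Z) hYZ
    have hZ : 𝒳 Z := h𝒳.retract _ _ (LinearMap.snd_comp_inr R Y Z) hYZ
    have hfY := h𝒳.finite Y hY
    have hfZ := h𝒳.finite Z hZ
    have hlen : Module.length R Y + Module.length R Z = m := by
      rw [← Module.length_prod, ← s.length_eq, hm]
    have hlt : Module.length R Y < m :=
      (add_comm _ _).trans hlen ▸ ENat.lt_add_left Module.length_ne_top Module.length_pos
    have hlt' : Module.length R Z < m :=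
      hlen ▸ ENat.lt_add_left Module.length_ne_top Module.length_pos
    exact ((ih _ hlt Y hY hfY rfl).prod (ih _ hlt' Z hZ hfZ rfl)).congr s

section Algebra

variable (K : Type u) [Field K] [Algebra K R] [FiniteDimensional K R] (T : Type u) [AddCommGroup T]
  [Module R T] [Module.Finite R T]

include K

theorem exists_lifts {G : Type u} [AddCommGroup G] [Module R G] (hG : 𝒳 G) :
    ∃ (U : ModuleCat.{u} R) (f : U →ₗ[R] T), 𝒳 U ∧ Lifts f G := by
  let := scalarModule K R T
  have := scalarModule_isScalarTower K R T
  let := scalarModule K R G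
  have := scalarModule_isScalarTower K R G
  have := h𝒳.finite G hG
  have : Module.Finite K G := Module.Finite.trans R G
  have : Module.Finite K T := Module.Finite.trans R T
  have : Module.Finite K (G →ₗ[R] T) := Module.Finite.of_injective
    (LinearMap.restrictScalarsₗ K R G T K) (LinearMap.restrictScalars_injective K)
  suffices h : ∀ N : Submodule K (G →ₗ[R] T), N.FG →
      ∃ (U : ModuleCat.{u} R) (f : U →ₗ[R] T), 𝒳 U ∧ ∀ φ ∈ N, ∃ l : G →ₗ[R] U, f ∘ₗ l = φ by
    obtain ⟨U, f, hU, hf⟩ := h ⊤ Module.Finite.fg_top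
    exact ⟨U, f, hU, fun φ => hf φ Submodule.mem_top⟩
  intro N hN
  induction N, hN using Submodule.fg_induction with
  | singleton φ =>
    refine ⟨ModuleCat.of R G, φ, hG, fun ψ hψ => ?_⟩
    obtain ⟨c, rfl⟩ := Submodule.mem_span_singleton.1 hψ
    exact ⟨c • LinearMap.id, LinearMap.ext fun x => by simp⟩
  | sup _ _ _ _ h₁ h₂ =>
    obtain ⟨U₁, f₁, hU₁, hf₁⟩ := h₁
    obtain ⟨U₂, f₂, hU₂, hf₂⟩ := h₂
    refine ⟨ModuleCat.of R (U₁ × U₂), LinearMap.coprod f₁ f₂, h𝒳.prod hU₁ hU₂, fun φ hφ => ?_⟩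
    obtain ⟨φ₁, hφ₁, φ₂, hφ₂, rfl⟩ := Submodule.mem_sup.1 hφ
    obtain ⟨l₁, rfl⟩ := hf₁ φ₁ hφ₁
    obtain ⟨l₂, rfl⟩ := hf₂ φ₂ hφ₂
    exact ⟨LinearMap.prod l₁ l₂, LinearMap.coprod_comp_prod _ _ _ _⟩

theorem exists_lifts_finset {ι : Type*} (G : ι → ModuleCat.{u} R) (s : Finset ι) :
    ∃ (U : ModuleCat.{u} R) (f : U →ₗ[R] T), 𝒳 U ∧ ∀ i ∈ s, 𝒳 (G i) → Lifts f (G i) := by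
  classical
  induction s using Finset.induction_on with
  | empty => exact ⟨ModuleCat.of R PUnit, 0, h𝒳.zero, by simp⟩
  | insert i s _ ih =>
    obtain ⟨U₁, f₁, hU₁, hf₁⟩ := ih
    by_cases hi : 𝒳 (G i)
    · obtain ⟨U₂, f₂, hU₂, hf₂⟩ := h𝒳.exists_lifts K T hi
      refine ⟨ModuleCat.of R (U₁ × U₂), LinearMap.coprod f₁ f₂, h𝒳.prod hU₁ hU₂, fun j hj hGj => ?_⟩
      rcases Finset.mem_insert.1 hj with rfl | hj
      · exact hf₂.of_comp_eq _ (LinearMap.coprod_inr f₁ f₂)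
      · exact (hf₁ j hj hGj).of_comp_eq _ (LinearMap.coprod_inl f₁ f₂)
    · refine ⟨U₁, f₁, hU₁, fun j hj hGj => hf₁ j (Finset.mem_of_mem_insert_of_ne hj ?_) hGj⟩
      rintro rfl
      exact hi hGj

theorem exists_approx_of_finite {n : ℕ} (G : Fin n → ModuleCat.{u} R)
    (hG : ∀ M : ModuleCat.{u} R, 𝒳 M → Indecomposable M → ∃ i, Nonempty (M ≅ G i)) :
    ∃ (U : ModuleCat.{u} R) (f : U →ₗ[R] T), IsApprox 𝒳 f := by
  have := IsArtinianRing.of_finite K R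
  obtain ⟨U, f, hU, hf⟩ := h𝒳.exists_lifts_finset K T G Finset.univ
  refine ⟨U, f, hU, fun V _ _ hV =>
    h𝒳.lifts_of_forall_indecomposable (fun M hM hind => ?_) (ModuleCat.of R V) hV⟩
  obtain ⟨i, ⟨a⟩⟩ := hG M hM hind
  exact (hf i (Finset.mem_univ i) (h𝒳.congr a.symm.toLinearEquiv hM)).congr a.toLinearEquiv

end Algebra

end IsExtensionClosed

end Approximation

/-! ### Modules of infinite dominant dimension -/

section DomInfinite

/-- Finitely generated modules of infinite dominant dimension. -/
def IsDomInfinite (R : Type u) [Ring R] (M : Type u) [AddCommGroup M] [Module R M] : Prop :=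
  Module.Finite R M ∧ domDim R M = ⊤

variable {K : Type u} [Field K] {R : Type u} [Ring R] [Algebra K R] [FiniteDimensional K R]
  (D : GendoCore K R) {E : Type u} [AddCommGroup E] [Module R E] (V : RegularDual K R E)
  {M : Type u} [AddCommGroup M] [Module R M]

theorem isDomInfinite_iff :
    IsDomInfinite R M ↔ Module.Finite R M ∧ D.EtaBij V M ∧ ExtVanishes R E M :=
  and_congr_right fun _ => GendoCore.domDim_eq_top_iff M

include D V

theorem isDomInfinite_qpow (n : ℕ) : IsDomInfinite R (D.QPow n) :=
  (isDomInfinite_iff D V).2 ⟨inferInstance, GendoCore.etaBij_of_projective V,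
    fun _ hi => ExtVanishesAt.of_injective hi⟩

theorem isExtensionClosed_isDomInfinite : IsExtensionClosed (IsDomInfinite R) where
  finite _ _ _ h := h.1
  zero := by
    obtain ⟨_, hη, hE⟩ := (isDomInfinite_iff D V).1 (isDomInfinite_qpow D V 0)
    exact (isDomInfinite_iff D V).2 ⟨inferInstance, hη.of_retract 0 0 (Subsingleton.elim _ _),
      fun i hi => ExtVanishesAt.of_retract_right 0 0 (Subsingleton.elim _ _) (hE i hi)⟩
  retract a b hab h := by
    obtain ⟨_, hη, hE⟩ := (isDomInfinite_iff D V).1 h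
    exact (isDomInfinite_iff D V).2
      ⟨Module.Finite.of_surjective b (LinearMap.surjective_of_comp_eq_id a b hab),
        hη.of_retract a b hab, fun i hi => ExtVanishesAt.of_retract_right a b hab (hE i hi)⟩
  extension {X Y Z} _ _ _ _ _ _ f g h hX hZ := by
    have := IsNoetherianRing.of_finite K R
    obtain ⟨_, hηX, hEX⟩ := (isDomInfinite_iff D V).1 hX
    obtain ⟨_, hηZ, hEZ⟩ := (isDomInfinite_iff D V).1 hZ
    have := isNoetherian_of_range_eq_ker f g h.exact.linearMap_ker_eq.symm
    exact (isDomInfinite_iff D V).2 ⟨inferInstance, GendoCore.EtaBij.extension h hηX hηZ,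
      fun i hi => h.extVanishesAt_covariant₂ (hEX i hi) (hEZ i hi)⟩

namespace IsDomInfinite

theorem coker {n : ℕ} {N : Type u} [AddCommGroup N] [Module R N] {f : M →ₗ[R] D.QPow n}
    {g : D.QPow n →ₗ[R] N} (h : IsShortExact f g) (hM : IsDomInfinite R M) :
    IsDomInfinite R N := by
  obtain ⟨_, hη, hE⟩ := (isDomInfinite_iff D V).1 hM
  exact (isDomInfinite_iff D V).2 ⟨Module.Finite.of_surjective g h.surj,
    GendoCore.EtaBij.coker h hη (GendoCore.etaBij_of_projective V) (hE 1 le_rfl),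
    fun i hi => h.extVanishesAt_covariant₃ (.of_injective hi) (hE (i + 1) (by omega))⟩

theorem exists_injective_qpow (hM : IsDomInfinite R M) :
    ∃ (n : ℕ) (f : M →ₗ[R] D.QPow n), Function.Injective f := by
  obtain ⟨_, hη, -⟩ := (isDomInfinite_iff D V).1 hM
  exact hη.etaInj.exists_injective_pi_leftIdeal

theorem exists_cosyzygy (hM : IsDomInfinite R M) :
    ∃ (n : ℕ) (N : ModuleCat.{u} R) (f : M →ₗ[R] D.QPow n) (g : D.QPow n →ₗ[R] N),
      IsShortExact f g ∧ IsDomInfinite R N := by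
  obtain ⟨n, f, hf⟩ := hM.exists_injective_qpow D V
  have h := IsShortExact.mkQ_range f hf
  exact ⟨n, ModuleCat.of R _, f, _, h, hM.coker D V h⟩

theorem extVanishesAt_one_of_forall {N : Type u} [AddCommGroup N] [Module R N] (j : ℕ)
    (hN : ∀ (X : Type u) [AddCommGroup X] [Module R X], IsDomInfinite R X →
      ExtVanishesAt R X N (j + 1)) (hM : IsDomInfinite R M) : ExtVanishesAt R M N 1 := by
  induction j with
  | zero => exact hN M hM
  | succ j ih =>
    refine ih fun X _ _ hX => ?_
    obtain ⟨m, W, f, q, h, hW⟩ := hX.exists_cosyzygy D V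
    exact h.extVanishesAt_contravariant₁ (.of_projective (by omega)) (hN W hW)

theorem injective_of_projective {g : ℕ} (hR : injectiveDimension (ModuleCat.of R R) ≤ g)
    [Module.Projective R M] (hM : IsDomInfinite R M) : Module.Injective R M := by
  have := hM.1
  obtain ⟨n, p, s, -, -, hps⟩ := Module.Finite.exists_comp_eq_id_of_projective R M
  obtain ⟨m, W, f, q, h, hW⟩ := hM.exists_cosyzygy D V
  obtain ⟨r, hr⟩ := h.exists_retraction <| hW.extVanishesAt_one_of_forall D V g fun X _ _ _ =>
    .of_retract_right s p hps ((ExtVanishesAt.of_injectiveDimension_le hR g.lt_succ_self).pi n)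
  exact injective_of_retract f r hr

end IsDomInfinite

end DomInfinite

section QPowPairing

variable {K : Type u} [Field K] {A : Type u} [Ring A] [Algebra K A] (D : GendoCore K A) (n : ℕ)

namespace GendoCore

/-- The pairing `(x, y) ↦ ∑ tr (xᵢ yᵢ)` of the right module `(eA)ⁿ` with the left module `(Ae)ⁿ`. -/
def qpowForm : D.op.QPow n →ₗ[K] D.QPow n →ₗ[K] K :=
  LinearMap.mk₂ K (fun x y => ∑ i, D.tr ((x i : Aᵐᵒᵖ).unop * y i))
    (fun x x' y => by simp [add_mul, Finset.sum_add_distrib])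
    (fun c x y => by simp [Finset.mul_sum])
    (fun x y y' => by simp [mul_add, Finset.sum_add_distrib])
    (fun c x y => by simp [Finset.mul_sum])

theorem qpowForm_apply (x : D.op.QPow n) (y : D.QPow n) :
    D.qpowForm n x y = ∑ i, D.tr ((x i : Aᵐᵒᵖ).unop * y i) := rfl

theorem qpowForm_single (x : D.op.QPow n) (i : Fin n) (y : leftIdeal D.e) :
    D.qpowForm n x (Pi.single i y) = D.tr ((x i : Aᵐᵒᵖ).unop * y) := by
  rw [qpowForm_apply, Finset.sum_eq_single i (fun j _ hj => by simp [Pi.single_eq_of_ne hj])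
    (by simp), Pi.single_eq_same]

theorem unop_eq_e_mul_unop (x : leftIdeal D.op.e) : (x : Aᵐᵒᵖ).unop = D.e * (x : Aᵐᵒᵖ).unop :=
  (congrArg unop (D.op.mul_e x)).symm

theorem qpowForm_injective : Function.Injective (D.qpowForm n) := by
  refine (injective_iff_map_eq_zero _).2 fun x hx => funext fun i => Subtype.ext (unop_injective ?_)
  rw [D.unop_eq_e_mul_unop]
  refine D.nondeg_left _ fun y => ?_
  rw [← D.unop_eq_e_mul_unop, mul_assoc]
  exact (D.qpowForm_single n x i ⟨y * D.e, y, rfl⟩).symm.trans (LinearMap.congr_fun hx _)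

theorem qpowForm_surjective : Function.Surjective (D.qpowForm n) := fun μ => by
  let ρ : A →ₗ[K] leftIdeal D.e :=
    (LinearMap.toSpanSingleton A A D.e).rangeRestrict.restrictScalars K
  choose x hx using fun i : Fin n => D.rep_left (μ ∘ₗ LinearMap.single K _ i ∘ₗ ρ)
  refine ⟨fun i => ⟨MulOpposite.op (D.e * x i), MulOpposite.op (x i), rfl⟩,
    LinearMap.pi_ext fun i y => ?_⟩
  have hρ : ρ (y * D.e) = y := Subtype.ext <| by
    change (y * D.e : A) * D.e = y
    rw [D.mul_e, D.mul_e]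
  have hxy := hx i y
  rw [LinearMap.comp_apply, LinearMap.comp_apply, hρ, mul_assoc, D.mul_e] at hxy
  exact (D.qpowForm_single n _ i y).trans hxy

/-- The duality between `(eA)ⁿ` and `(Ae)ⁿ` given by `qpowForm`. -/
def qpowPairing [FiniteDimensional K A] : DualPairing K A (D.op.QPow n) (D.QPow n) where
  p := D.qpowForm n
  perf := by
    have : FiniteDimensional K (D.QPow n) := Module.Finite.trans A _
    exact LinearMap.IsPerfPair.of_bijective _ ⟨D.qpowForm_injective n, D.qpowForm_surjective n⟩
  bal a x y := by simp [qpowForm_apply, mul_assoc]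

end GendoCore

end QPowPairing

section FiniteDominantDimension

variable {K : Type u} [Field K] {A : Type u} [Ring A] [Algebra K A] [FiniteDimensional K A]
  (D : GendoCore K A)

section NearlyGorenstein

variable (hnearly : IsNearlyGorenstein K A)

include D hnearly

theorem IsDomInfinite.exists_syzygy {M : Type u} [AddCommGroup M] [Module Aᵐᵒᵖ M]
    (hM : IsDomInfinite Aᵐᵒᵖ M) :
    ∃ (n : ℕ) (N : ModuleCat.{u} Aᵐᵒᵖ) (f : N →ₗ[Aᵐᵒᵖ] D.op.QPow n)
      (g : D.op.QPow n →ₗ[Aᵐᵒᵖ] M), IsShortExact f g ∧ IsDomInfinite Aᵐᵒᵖ N := by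
  have := hM.1
  let := scalarModule K Aᵐᵒᵖ M
  have := scalarModule_isScalarTower K Aᵐᵒᵖ M
  have : FiniteDimensional K M := Module.Finite.trans Aᵐᵒᵖ M
  have hdual : IsDomInfinite A (KDual K M) := ⟨Module.Finite.of_restrictScalars_finite K A _,
    ((tfae_domDim_eq_top D hnearly M).out 0 3).1 hM.2⟩
  obtain ⟨n, j, hj⟩ := hdual.exists_injective_qpow D (regularDualLeft K A)
  obtain ⟨k, hk⟩ := (D.qpowPairing n).exists_adj_left (DualPairing.self A M) j
  have hker := IsShortExact.ker_subtype k (hk.surjective hj)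
  have : FiniteDimensional K (D.op.QPow n) := Module.Finite.trans Aᵐᵒᵖ _
  have := finiteDimensional_submodule (K := K) (LinearMap.ker k)
  obtain ⟨f', hf'⟩ := (DualPairing.self A (LinearMap.ker k)).exists_adj_right (D.qpowPairing n)
    (LinearMap.ker k).subtype
  have hN := hdual.coker D (regularDualLeft K A) (DualPairing.isShortExact_of_isAdj hf' hk hker)
  exact ⟨n, ModuleCat.of Aᵐᵒᵖ (LinearMap.ker k), _, k, hker,
    Module.Finite.of_restrictScalars_finite K Aᵐᵒᵖ _,
    ((tfae_domDim_eq_top D hnearly (LinearMap.ker k)).out 0 3).2 hN.2⟩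

theorem exists_approx_isDomInfinite (hCM : IsCMFinite A) (T : Type u) [AddCommGroup T]
    [Module Aᵐᵒᵖ T] [Module.Finite Aᵐᵒᵖ T] :
    ∃ (U : ModuleCat.{u} Aᵐᵒᵖ) (f : U →ₗ[Aᵐᵒᵖ] T), IsApprox (IsDomInfinite Aᵐᵒᵖ) f := by
  obtain ⟨n, G, hG⟩ := hCM
  refine (isExtensionClosed_isDomInfinite D.op (regularDualRight K A)).exists_approx_of_finite K T G
    fun M hM hind => ?_
  have := hM.1
  let := scalarModule K Aᵐᵒᵖ M
  have := scalarModule_isScalarTower K Aᵐᵒᵖ M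
  have : FiniteDimensional K M := Module.Finite.trans Aᵐᵒᵖ M
  have hGPI : IsGorensteinProjectiveInjective K A M :=
    ((tfae_domDim_eq_top D hnearly M).out 0 2).1 hM.2
  exact hG M hM.1 hind hGPI.1

variable {g : ℕ} (hCM : IsCMFinite A) (hA : injectiveDimension (ModuleCat.of Aᵐᵒᵖ A) ≤ g)

include hCM hA

theorem admissibleClass_isDomInfinite : AdmissibleClass D.op (IsDomInfinite Aᵐᵒᵖ) where
  toIsExtensionClosed := isExtensionClosed_isDomInfinite D.op (regularDualRight K A)
  qpow := isDomInfinite_qpow D.op (regularDualRight K A)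
  cosyzygy _ _ _ h := h.exists_cosyzygy D.op (regularDualRight K A)
  syzygy _ _ _ h := h.exists_syzygy D hnearly
  injective _ _ _ h _ := h.injective_of_projective D.op (regularDualRight K A) (g := g) <|
    (injectiveDimension_eq_of_iso (opLinearEquiv Aᵐᵒᵖ : A ≃ₗ[Aᵐᵒᵖ] Aᵐᵒᵖ).toModuleIso).ge.trans hA
  approx T _ _ _ := exists_approx_isDomInfinite D hnearly hCM T

theorem injective_of_domDim_eq_top (hconn : IsConnectedAlgebra A)
    (hself : ¬ Module.Injective Aᵐᵒᵖ A) {M : Type u} [AddCommGroup M] [Module Aᵐᵒᵖ M]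
    [Module.Finite Aᵐᵒᵖ M] (hM : domDim Aᵐᵒᵖ M = ⊤) : Module.Injective Aᵐᵒᵖ M := by
  have := IsArtinianRing.of_finite K Aᵐᵒᵖ
  refine (admissibleClass_isDomInfinite D hnearly hCM hA).injective_of_mem (fun c hc hcomm => ?_)
    (fun _ => hself (injective_of_linearEquiv (opLinearEquiv Aᵐᵒᵖ : A ≃ₗ[Aᵐᵒᵖ] Aᵐᵒᵖ)))
    M ⟨inferInstance, hM⟩
  exact (hconn.2 c.unop (congrArg unop hc) fun a => (congrArg unop (hcomm (op a))).symm).imp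
    (fun h => unop_injective h) fun h => unop_injective h

end NearlyGorenstein

variable {g : ℕ} (hA : injectiveDimension (ModuleCat.of A A) ≤ g)

include D hA

theorem domDim_eq_top_of_le {M : Type u} [AddCommGroup M] [Module Aᵐᵒᵖ M]
    [Module.Finite Aᵐᵒᵖ M] (hM : ((g + 2 : ℕ) : ℕ∞) ≤ domDim Aᵐᵒᵖ M) : domDim Aᵐᵒᵖ M = ⊤ := by
  let := scalarModule K Aᵐᵒᵖ M
  have := scalarModule_isScalarTower K Aᵐᵒᵖ M
  have : FiniteDimensional K M := Module.Finite.trans Aᵐᵒᵖ M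
  refine (GendoCore.domDim_eq_top_iff (D := D.op) (V := regularDualRight K A) M).2
    ⟨GendoCore.etaBij_of_two_le_domDim (le_trans (by exact_mod_cast Nat.le_add_left 2 g) hM),
      fun i hi => ?_⟩
  obtain ⟨i, rfl⟩ := Nat.exists_eq_add_of_le' hi
  rcases le_or_gt (i + 1) g with hig | hig
  · exact GendoCore.extVanishesAt_of_le_domDim D.op (regularDualRight K A)
      (le_trans (by exact_mod_cast Nat.add_le_add_right hig 2) hM)
  · exact (extVanishesAt_iff_dual (DualPairing.ofLeft A A) (DualPairing.self A M) i).2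
      (.of_injectiveDimension_le hA hig)

theorem finitisticDomDim_le : finitisticDomDim Aᵐᵒᵖ ≤ g + 1 := by
  refine sSup_le ?_
  rintro _ ⟨M, _, rfl, hlt⟩
  by_contra! hgt
  refine hlt.ne (domDim_eq_top_of_le D hA ?_)
  exact_mod_cast Order.add_one_le_of_lt hgt

end FiniteDominantDimension

end GendoSymm

end

theorem mainTheorem3_general {K A : Type u} [Field K] [Ring A] [Algebra K A]
    [FiniteDimensional K A] (hgendo : GendoSymm.IsGendoSymmetric K A) :
    (GendoSymm.IsNearlyGorenstein K A →
      ∀ (M : Type u) [AddCommGroup M] [Module K M] [Module Aᵐᵒᵖ M] [IsScalarTower K Aᵐᵒᵖ M]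
        [FiniteDimensional K M],
        List.TFAE [
          GendoSymm.domDim Aᵐᵒᵖ M = ⊤,
          GendoSymm.IsGorensteinProjectiveInjective K A M ∧
            Nonempty (GendoSymm.NakayamaInv K A M ≃ₗ[Aᵐᵒᵖ] M),
          GendoSymm.IsGorensteinProjectiveInjective K A M,
          GendoSymm.codomDim K A M = ⊤]) ∧
    (GendoSymm.IsConnectedAlgebra A → ¬ Module.Injective Aᵐᵒᵖ A →
      GendoSymm.IsNearlyGorenstein K A → GendoSymm.IsCMFinite A →
      ∀ g : ℕ, injectiveDimension (ModuleCat.of Aᵐᵒᵖ A) ≤ g →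
        ∀ (M : Type u) [AddCommGroup M] [Module Aᵐᵒᵖ M] [Module.Finite Aᵐᵒᵖ M],
          ¬ Module.Injective Aᵐᵒᵖ M → GendoSymm.domDim Aᵐᵒᵖ M < ⊤) ∧
    (∀ g : ℕ, injectiveDimension (ModuleCat.of A A) ≤ g →
      GendoSymm.finitisticDomDim Aᵐᵒᵖ ≤ g + 1) := by
  obtain ⟨D⟩ := hgendo.nonempty_gendoCore
  refine ⟨fun hnearly M _ _ _ _ _ => GendoSymm.tfae_domDim_eq_top D hnearly M,
    fun hconn hself hnearly hCM g hA M _ _ _ hM => lt_top_iff_ne_top.2 fun h => hM ?_,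
    fun g hA => GendoSymm.finitisticDomDim_le D hA⟩
  exact GendoSymm.injective_of_domDim_eq_top D hnearly hCM hA hconn hself h

theorem mainTheorem3 {K A : Type u} [Field K] [Ring A] [Algebra K A] [FiniteDimensional K A]
    (hconn : GendoSymm.IsConnectedAlgebra A)
    (hself : ¬ Module.Injective Aᵐᵒᵖ A)
    (hgendo : GendoSymm.IsGendoSymmetric K A)
    (hnearly : GendoSymm.IsNearlyGorenstein K A) :
    (∀ (M : Type u) [AddCommGroup M] [Module K M] [Module Aᵐᵒᵖ M] [IsScalarTower K Aᵐᵒᵖ M]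
        [FiniteDimensional K M],
        CategoryTheory.Indecomposable (ModuleCat.of Aᵐᵒᵖ M) →
        ¬ Module.Injective Aᵐᵒᵖ M → ¬ Module.Projective Aᵐᵒᵖ M →
        List.TFAE [
          GendoSymm.domDim Aᵐᵒᵖ M = ⊤,
          GendoSymm.IsGorensteinProjectiveInjective K A M ∧
            Nonempty (GendoSymm.NakayamaInv K A M ≃ₗ[Aᵐᵒᵖ] M),
          GendoSymm.IsGorensteinProjectiveInjective K A M,
          GendoSymm.codomDim K A M = ⊤]) ∧
    (∀ g : ℕ, GendoSymm.IsCMFinite A → GendoSymm.IsGorensteinOfDim A g →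
        (∀ (M : Type u) [AddCommGroup M] [Module K M] [Module Aᵐᵒᵖ M] [IsScalarTower K Aᵐᵒᵖ M]
          [FiniteDimensional K M],
          ¬ Module.Injective Aᵐᵒᵖ M → GendoSymm.domDim Aᵐᵒᵖ M < ⊤) ∧
        GendoSymm.finitisticDomDim Aᵐᵒᵖ ≤ g + 1) := by
  obtain ⟨htfae, hfinite, hbound⟩ := mainTheorem3_general hgendo
  exact ⟨fun M _ _ _ _ _ _ _ _ => htfae hnearly M, fun g hCM hG => ⟨fun M _ _ _ _ _ =>
    have : Module.Finite Aᵐᵒᵖ M := .of_restrictScalars_finite K Aᵐᵒᵖ M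
    hfinite hconn hself hnearly hCM g hG.1.le M, hbound g hG.2.le⟩⟩
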